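/- Let $R$ be an associative unital ring that is free as a $\mathbb{Z}$-module, let $I$ be a $\mathbb{Z}$-basis of $R$, and let $N_{V,W}^U\in\mathbb{Z}$ be its structure tensor, so that $VW=\sum_{U\in I}N_{V,W}^U\,U$ for $V,W\in I$. Let $\mathcal{G}_\infty^{\mathbb{Q}}(R)=\bigotimes_{i\ge 1}U(\mathbb{Q}\otimes R)$ be the tensor product of countably many copies of the universal enveloping algebra of $\mathbb{Q}\otimes R$ (a Lie algebra under the commutator), spanned by the pure tensors with all but finitely many factors equal to $1$. Let $T_l(r)$ be the image of $r\in\mathbb{Q}\otimes R$ in the $l$-th factor; extend $T_l$ coefficientwise to power series, and put $\Theta_l(x)=\exp(T_l(\log x))$ for a power series $x$ over $\mathbb{Q}\otimes R$ with constant term $1$. Let $\mathcal{P}^I$ be the set of functions $\vec\lambda$ from $I$ to partitions with $\sum_U|\vec\lambda(U)|<\infty$. For $U\in I$ let $\mathbf{x}_U=\{x_{U,0},x_{U,1},\dots\}$ and $\mathbf{y}_U=\{y_{U,0},y_{U,1},\dots\}$ be independent commuting variables. Denote by $p_l$ the power sums and by $s_\lambda$ the Schur functions. These are evaluated at sets of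 monomials with integer multiplicities: $(\mathbf{a},\mathbf{b})$ is the union, $\mathbf{a}\mathbf{b}$ the set of all products of a letter of $\mathbf{a}$ and a letter of $\mathbf{b}$, and $\mathbf{a}^{\oplus n}$ is $\mathbf{a}$ with multiplicities multiplied by $n\in\mathbb{Z}$. Here $p_l$ is the sum of the $l$-th powers of the letters counted with multiplicity, and $s_\lambda$ is evaluated through its expression as a polynomial in the $p_l$. (0) There is exactly one family $(Z_{\vec\lambda})_{\vec\lambda\in\mathcal{P}^I}$ in $\mathcal{G}_\infty^{\mathbb{Q}}(R)$ with $$\sum_{\vec\lambda\in\mathcal{P}^I}\Big(\prod_{U\in I}s_{\vec\lambda(U)}(\mathbf{x}_U)\Big)\otimes Z_{\vec\lambda}=\prod_{l=1}^{\infty}\Theta_l\Big(1+\sum_{U\in I}p_l(\mathbf{x}_U)\,U\Big).$$ (1) As formal power series in the $x_{U,n},y_{U,n}$ with coefficients in $\mathcal{G}_\infty^{\mathbb{Q}}(R)$ (all sums being coefficientwise finite), $$\Big(\sum_{\vec\mu\in\mathcal{P}^I}\prod_{U\in I}s_{\vec\mu(U)}(\mathbf{x}_U)\otimes Z_{\vec\mu}\Big)\Big(\sum_{\vec\nu\in\mathcal{P}^I}\prod_{U\in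 I}s_{\vec\nu(U)}(\mathbf{y}_U)\otimes Z_{\vec\nu}\Big)=\sum_{\vec\lambda\in\mathcal{P}^I}\prod_{U\in I}s_{\vec\lambda(U)}\Big(\mathbf{x}_U,\mathbf{y}_U,\bigoplus_{V,W\in I}(\mathbf{x}_V\mathbf{y}_W)^{\oplus N_{V,W}^U}\Big)\otimes Z_{\vec\lambda}.$$ (2) For every $\vec\lambda\in\mathcal{P}^I$ there are unique integers $a_{\vec\mu,\vec\nu}^{\vec\lambda}$ such that, as a coefficientwise finite sum, $$\prod_{U\in I}s_{\vec\lambda(U)}\Big(\mathbf{x}_U,\mathbf{y}_U,\bigoplus_{V,W\in I}(\mathbf{x}_V\mathbf{y}_W)^{\oplus N_{V,W}^U}\Big)=\sum_{\vec\mu,\vec\nu\in\mathcal{P}^I}a_{\vec\mu,\vec\nu}^{\vec\lambda}\prod_{V\in I}s_{\vec\mu(V)}(\mathbf{x}_V)\prod_{W\in I}s_{\vec\nu(W)}(\mathbf{y}_W).$$ For all $\vec\mu,\vec\nu\in\mathcal{P}^I$ only finitely many $\vec\lambda$ have $a_{\vec\mu,\vec\nu}^{\vec\lambda}\neq 0$,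 and $$Z_{\vec\mu}Z_{\vec\nu}=\sum_{\vec\lambda\in\mathcal{P}^I}a_{\vec\mu,\vec\nu}^{\vec\lambda}\,Z_{\vec\lambda}.$$ -/

import Mathlib

noncomputable section

open scoped TensorProduct

namespace WreathLimit

/-! ## Formal power series: infinite sums, products, exponential and logarithm

`MvPowerSeries σ A` is the ring of formal power series in the central variables indexed by `σ`,
with coefficients in a ring `A` that need not be commutative. -/

section Formal

variable {σ ι A B : Type*}

/-- Each monomial occurs in only finitely many members of the family. -/
def FormallySummable [Semiring A] (f : ι → MvPowerSeries σ A) : Prop :=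
  ∀ m : σ →₀ ℕ, {i | MvPowerSeries.coeff m (f i) ≠ 0}.Finite

/-- The coefficientwise sum of a formally summable family of power series. -/
def formalSum [Semiring A] (f : ι → MvPowerSeries σ A) : MvPowerSeries σ A :=
  fun m => ∑ᶠ i, MvPowerSeries.coeff m (f i)

/-- The family `f` is formally summable, with sum `S`. -/
def HasFormalSum [Semiring A] (f : ι → MvPowerSeries σ A) (S : MvPowerSeries σ A) : Prop :=
  FormallySummable f ∧ formalSum f = S

/-- `P` is the ordered infinite product `F 0 * F 1 * F 2 * ⋯`: every coefficient of the partial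
products is eventually the corresponding coefficient of `P`. -/
def HasFormalProd [Semiring A] (F : ℕ → MvPowerSeries σ A) (P : MvPowerSeries σ A) : Prop :=
  ∀ m : σ →₀ ℕ, ∀ᶠ n in Filter.atTop,
    MvPowerSeries.coeff m ((List.range n).map F).prod = MvPowerSeries.coeff m P

/-- A series in powers of a power series without constant term makes sense. -/
theorem formallySummable_smul_pow [Ring A] [Module ℚ A] (c : ℕ → ℚ) (f : MvPowerSeries σ A)
    (hf : MvPowerSeries.constantCoeff f = 0) : FormallySummable fun k => c k • f ^ k := by
  intro m
  refine (Set.finite_Iic m.degree).subset fun k hk => ?_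
  by_contra hlt
  refine hk ?_
  have h0 : MvPowerSeries.coeff m (f ^ k) = 0 := by
    refine MvPowerSeries.coeff_of_lt_order (lt_of_lt_of_le ?_
      (MvPowerSeries.le_order_pow_of_constantCoeff_eq_zero k hf))
    exact_mod_cast not_le.mp hlt
  show c k • MvPowerSeries.coeff m (f ^ k) = 0
  rw [h0, smul_zero]

/-- `exp f = ∑ fᵏ / k!`, for `f` without constant term. -/
def expSeries [Ring A] [Module ℚ A] (f : MvPowerSeries σ A) : MvPowerSeries σ A :=
  formalSum fun k : ℕ => ((k.factorial : ℚ)⁻¹) • f ^ k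

/-- `log x = ∑_{k ≥ 1} (-1)ᵏ⁺¹ (x - 1)ᵏ / k`, for `x` with constant term `1`.  (The summand at
`k = 0` vanishes since its coefficient is `0`.) -/
def logSeries [Ring A] [Module ℚ A] (x : MvPowerSeries σ A) : MvPowerSeries σ A :=
  formalSum fun k : ℕ => ((-1) ^ (k + 1) / (k : ℚ)) • (x - 1) ^ k

/-- Apply a function to every coefficient. -/
def mapCoeff (T : A → B) (f : MvPowerSeries σ A) : MvPowerSeries σ B :=
  fun m => T (f m)

/-- The element `s ⊗ z`, for a rational power series `s` and a coefficient `z`. -/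
def tens [AddCommGroup A] [Module ℚ A] (s : MvPowerSeries σ ℚ) (z : A) : MvPowerSeries σ A :=
  fun m => MvPowerSeries.coeff m s • z

end Formal

/-! ## Variable sets and symmetric functions

A variable set whose letters are monomials, each with an integer multiplicity, is recorded as the
formal sum of its letters, an element of `MvPowerSeries σ ℤ`: the coefficient of a monomial is its
multiplicity as a letter.  Thus the union `(𝐱, 𝐲)` of variable sets is the sum, the set `𝐱𝐲` of
all products of a letter of `𝐱` and a letter of `𝐲` is the product, and `𝐱^{⊕ n}` is `n • 𝐱`,
which makes sense for negative `n` too. -/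

section Symmetric

variable {σ I : Type*}

/-- The variable set `{x_{v 0}, x_{v 1}, x_{v 2}, …}`. -/
def varSet (v : ℕ → σ) : MvPowerSeries σ ℤ :=
  formalSum fun n => MvPowerSeries.X (v n)

/-- The `l`-th power sum (`l ≥ 1`) of a variable set: the sum of the `l`-th powers of the letters,
with multiplicity. -/
def powerSum (l : ℕ) (X : MvPowerSeries σ ℤ) : MvPowerSeries σ ℚ :=
  formalSum fun m : σ →₀ ℕ => MvPowerSeries.monomial (l • m) ((MvPowerSeries.coeff m X : ℤ) : ℚ)

/-- The complete symmetric function `h_n` of a variable set, expressed in the power sums by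
`h_0 = 1` and `n h_n = ∑_{r=1}^{n} p_r h_{n-r}` (that is, `H' = P H`). -/
def completeSymm (X : MvPowerSeries σ ℤ) : ℕ → MvPowerSeries σ ℚ
  | 0 => 1
  | n + 1 => ((n + 1 : ℕ) : ℚ)⁻¹ •
      ∑ r : Fin (n + 1), powerSum (r + 1) X * completeSymm X (n - r)
  decreasing_by omega

/-- The Schur function `s_μ` of a variable set, `det (h_{μ_i - i + j})`, where `h_k = 0` for
`k < 0`. -/
def schur (μ : YoungDiagram) (X : MvPowerSeries σ ℤ) : MvPowerSeries σ ℚ :=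
  Matrix.det (Matrix.of fun i j : Fin (μ.colLen 0) =>
    if (i : ℕ) ≤ μ.rowLen i + j then completeSymm X (μ.rowLen i + j - i) else 0)

/-- `I`-indexed multipartitions of finite total size: partition-valued functions on `I` (partitions
being Young diagrams) with only finitely many nonempty values. -/
structure MultiPartition (I : Type*) where
  /-- the partition attached to an index -/
  part : I → YoungDiagram
  finite_support : {U | part U ≠ ⊥}.Finite

/-- `∏_U s_{λ(U)}(𝐗_U)`; all factors with `λ(U)` empty are `1`. -/
def schurProd (lam : MultiPartition I) (X : I → MvPowerSeries σ ℤ) : MvPowerSeries σ ℚ :=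
  ∏ U ∈ lam.finite_support.toFinset, schur (lam.part U) (X U)

/-- `f = ∑_{μ, ν} c(μ, ν) ∏_V s_{μ(V)}(𝐗_V) ∏_W s_{ν(W)}(𝐘_W)`, with integer coefficients `c`. -/
def IsSchurExpansion (X Y : I → MvPowerSeries σ ℤ)
    (f : MvPowerSeries σ ℚ) (c : MultiPartition I → MultiPartition I → ℤ) : Prop :=
  HasFormalSum (fun p : MultiPartition I × MultiPartition I =>
    (c p.1 p.2 : ℚ) • (schurProd p.1 X * schurProd p.2 Y)) f

end Symmetric

/-! ## The algebra `𝒢_∞^ℚ(R)` -/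

section Algebra

variable (R : Type*) [Ring R]

/-- `ℚ ⊗ R`, as an associative `ℚ`-algebra and, through the commutator, as a Lie algebra. -/
def RatRing : Type _ := ℚ ⊗[ℤ] R

instance : Ring (RatRing R) := inferInstanceAs (Ring (ℚ ⊗[ℤ] R))
instance : Algebra ℚ (RatRing R) := inferInstanceAs (Algebra ℚ (ℚ ⊗[ℤ] R))
/-- The bracket is `⁅a, b⁆ = a * b - b * a`. -/
instance : LieRing (RatRing R) := LieRing.ofAssociativeRing
instance : LieAlgebra ℚ (RatRing R) := LieAlgebra.ofAssociativeAlgebra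

/-- The canonical map `R → ℚ ⊗ R`. -/
def toRat (r : R) : RatRing R := (1 : ℚ) ⊗ₜ[ℤ] r

/-- The enveloping algebra of the Lie algebra `ℚ ⊗ R`. -/
abbrev Env : Type _ := UniversalEnvelopingAlgebra ℚ (RatRing R)

/-- The infinite tensor product `⨂_{i ≥ 1} U(ℚ ⊗ R)`: the subalgebra of the tensor product over all
`i` that is spanned by the pure tensors with all but finitely many factors equal to `1`.  (These
pure tensors are closed under multiplication.) -/
def limitSubalgebra : Subalgebra ℚ (⨂[ℚ] _ : ℕ+, Env R) :=
  Algebra.adjoin ℚ {t | ∃ a : ℕ+ → Env R, {i | a i ≠ 1}.Finite ∧ t = PiTensorProduct.tprod ℚ a}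

/-- `𝒢_∞^ℚ(R)`. -/
def LimitAlgebra : Type _ := limitSubalgebra R

instance : Ring (LimitAlgebra R) := inferInstanceAs (Ring (limitSubalgebra R))
instance : Algebra ℚ (LimitAlgebra R) := inferInstanceAs (Algebra ℚ (limitSubalgebra R))

variable {R}

/-- `T_l(r)`: the image of `r` in the `l`-th factor. -/
def T (l : ℕ+) (r : RatRing R) : LimitAlgebra R :=
  ⟨PiTensorProduct.tprod ℚ (Pi.mulSingle l (UniversalEnvelopingAlgebra.ι ℚ r)),
    Algebra.subset_adjoin ⟨_, (Set.finite_singleton l).subset fun i hi => by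
      by_contra h
      exact hi (Pi.mulSingle_eq_of_ne h _), rfl⟩⟩

/-- `Θ_l(x) = exp(T_l(log x))`, for a series `x` with constant term `1`; here `T_l` is extended
coefficientwise. -/
def Theta {σ : Type*} (l : ℕ+) (x : MvPowerSeries σ (RatRing R)) :
    MvPowerSeries σ (LimitAlgebra R) :=
  expSeries (mapCoeff (T l) (logSeries x))

variable {I : Type*}

/-- The series `1 + ∑_{U ∈ I} p_l(𝐗_U) U`. -/
def powerSumSeries {σ : Type*} (b : Module.Basis I ℤ R) (X : I → MvPowerSeries σ ℤ) (l : ℕ+) :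
    MvPowerSeries σ (RatRing R) :=
  1 + formalSum fun U : I => tens (powerSum l (X U)) (toRat R (b U))

/-- The defining property of the family `Z_λ`, where `x_{U,n}` (`U ∈ I`, `n ∈ ℕ`) are independent
variables and `𝐱_U = {x_{U,0}, x_{U,1}, …}`:
`∑_λ (∏_U s_{λ(U)}(𝐱_U)) ⊗ Z_λ = ∏_{l ≥ 1} Θ_l (1 + ∑_U p_l(𝐱_U) U)`. -/
def IsZFamily (b : Module.Basis I ℤ R) (Z : MultiPartition I → LimitAlgebra R) : Prop :=
  ∃ P : MvPowerSeries (I × ℕ) (LimitAlgebra R),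
    HasFormalProd
      (fun k => Theta k.succPNat (powerSumSeries b (fun U => varSet fun n => (U, n)) k.succPNat)) P ∧
    HasFormalSum (fun lam => tens (schurProd lam fun U => varSet fun n => (U, n)) (Z lam)) P

/-- The elements `Z_λ ∈ 𝒢_∞^ℚ(R)` (depending on the basis `I`), characterised by `IsZFamily`. -/
def Zelt (b : Module.Basis I ℤ R) : MultiPartition I → LimitAlgebra R :=
  Classical.epsilon (IsZFamily b)

/-- The structure tensor: `V W = ∑_U N_{V,W}^U U`. -/
def structTensor (b : Module.Basis I ℤ R) (V W U : I) : ℤ :=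
  b.repr (b V * b W) U

/-- The variables: two independent families `x_{U,n}` and `y_{U,n}`. -/
abbrev Vars (I : Type*) : Type _ := (I × ℕ) ⊕ (I × ℕ)

/-- The variable set `𝐱_U`. -/
def xSet (U : I) : MvPowerSeries (Vars I) ℤ := varSet fun n => Sum.inl (U, n)

/-- The variable set `𝐲_U`. -/
def ySet (U : I) : MvPowerSeries (Vars I) ℤ := varSet fun n => Sum.inr (U, n)

/-- The variable set `(𝐱_U, 𝐲_U, ⨁_{V,W} (𝐱_V 𝐲_W)^{⊕ N_{V,W}^U})`. -/
def productSet (b : Module.Basis I ℤ R) (U : I) : MvPowerSeries (Vars I) ℤ :=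
  xSet U + ySet U +
    formalSum fun p : I × I => structTensor b p.1 p.2 U • (xSet p.1 * ySet p.2)

/-- The terms `(∏_U s_{λ(U)}(𝐗_U)) ⊗ Z_λ` of the generating function of the `Z_λ` at the variable
sets `𝐗_U`. -/
def zTerm {σ : Type*} (b : Module.Basis I ℤ R) (X : I → MvPowerSeries σ ℤ)
    (lam : MultiPartition I) : MvPowerSeries σ (LimitAlgebra R) :=
  tens (schurProd lam X) (Zelt b lam)

end Algebra

end WreathLimit

end

noncomputable section

open scoped TensorProduct

set_option linter.unusedSectionVars false

namespace WreathLimit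

section

open MvPowerSeries
open Finset.HasAntidiagonal (antidiagonal mem_antidiagonal)

/-! ## Calculus of formal sums and products -/

section FormalSums

variable {σ τ ι κ A B : Type*}

section Semiring

variable [Semiring A]

/-! The theorem rests on the multiplicativity of `x ↦ exp(T(log x))` for an additive map `T` between
`ℚ`-algebras that preserves commutators (`lieTheta_mul`). With `E` the Euler derivation and `Z = log
x`, the series `exp(-Z) E(exp Z)` is built from `Z` and `E Z` by iterated commutators, so `T`
carries it to the corresponding series for `T Z`; the same holds for the conjugate `exp(-Z) u exp
Z`. Hence `Θ(x)Θ(y)` and `Θ(xy)` solve the same differential equation `E F = F a` with constant term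
`1`, and such a solution is unique.

For the product of generating functions, a variable set is the formal sum of its letters, and taking
`l`-th power sums is then a ring homomorphism: it raises every variable to the `l`-th power. So the
series `1 + ∑ p_l U` at the product variable set factors as the series at `𝐱` times the series at
`𝐲` (`linSeries_productSet`). Factors with different `l` commute, because they live in different
tensor slots, and the infinite products therefore multiply factor by factor
(`generatingFunction_mul`).

The family `Z` exists because the infinite product is a power series in the power sums:
`universalProd` is formed once in independent variables and specialised by substitution. Monomials
in the power sums are integral combinations of Schur functions of the same multidegree
(`monomial_mem_schurSpan`), by Newton's recursion and unitriangularity of the Jacobi–Trudi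
determinants. Re-expanding and exchanging sums gives the coefficients (`hasFormalSum_schurCoeff`).

Uniqueness and integrality both come from functionals dual to the Schur functions that are finite
integer combinations of coefficient functionals (`exists_dual`). They exist because products of
elementary symmetric functions are integral combinations of Schur functions and have distinct
leading monomials with coefficient `1`, which forces an integer transition matrix to have unit
determinant. Schur functions of any variable set with integer multiplicities have integer
coefficients (`schurProd_mem_intSeries`), so the dual functionals take integer values on them: these
values are the structure constants. Applying a dual functional to the identity of generating
functions yields the multiplication rule for the `Z_λ`, and since it reads only finitely many
coefficients, the sum is finite. -/

/-- `f` and `g` have the same coefficient at every monomial dividing `m`. -/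
def EqUpTo (m : σ →₀ ℕ) (f g : MvPowerSeries σ A) : Prop :=
  ∀ n ≤ m, coeff n f = coeff n g

variable {m : σ →₀ ℕ} {f f' g g' h : MvPowerSeries σ A}

theorem EqUpTo.refl (m : σ →₀ ℕ) (f : MvPowerSeries σ A) : EqUpTo m f f := fun _ _ => rfl

theorem EqUpTo.coeff_eq (h : EqUpTo m f g) : coeff m f = coeff m g := h m le_rfl

theorem EqUpTo.mono {n : σ →₀ ℕ} (h : EqUpTo m f g) (hn : n ≤ m) : EqUpTo n f g :=
  fun k hk => h k (hk.trans hn)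

theorem EqUpTo.add (h : EqUpTo m f f') (h' : EqUpTo m g g') : EqUpTo m (f + g) (f' + g') :=
  fun n hn => by rw [map_add, map_add, h n hn, h' n hn]

theorem EqUpTo.mul (h : EqUpTo m f f') (h' : EqUpTo m g g') : EqUpTo m (f * g) (f' * g') := by
  classical
  intro n hn
  rw [coeff_mul, coeff_mul]
  refine Finset.sum_congr rfl fun p hp => ?_
  rw [mem_antidiagonal] at hp
  rw [h p.1 (le_trans (hp ▸ le_self_add) hn), h' p.2 (le_trans (hp ▸ le_add_self) hn)]

theorem EqUpTo.pow (h : EqUpTo m f g) (k : ℕ) : EqUpTo m (f ^ k) (g ^ k) := by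
  induction k with
  | zero => simpa using EqUpTo.refl m 1
  | succ k ih => simpa only [pow_succ] using ih.mul h

theorem EqUpTo.sum {s : Finset ι} {f g : ι → MvPowerSeries σ A}
    (h : ∀ i ∈ s, EqUpTo m (f i) (g i)) : EqUpTo m (∑ i ∈ s, f i) (∑ i ∈ s, g i) :=
  fun n hn => by
    rw [map_sum, map_sum]
    exact Finset.sum_congr rfl fun i hi => h i hi n hn

theorem EqUpTo.formalSum {f g : ι → MvPowerSeries σ A} (h : ∀ i, EqUpTo m (f i) (g i)) :
    EqUpTo m (formalSum f) (formalSum g) :=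
  fun n hn => finsum_congr fun i => h i n hn

theorem coeff_formalSum (f : ι → MvPowerSeries σ A) (m : σ →₀ ℕ) :
    coeff m (formalSum f) = ∑ᶠ i, coeff m (f i) := rfl

theorem coeff_formalSum_eq_sum {f : ι → MvPowerSeries σ A} {m : σ →₀ ℕ} {s : Finset ι}
    (h : ∀ i ∉ s, coeff m (f i) = 0) :
    coeff m (formalSum f) = ∑ i ∈ s, coeff m (f i) :=
  finsum_eq_sum_of_support_subset _ fun i hi => by
    by_contra his
    exact hi (h i his)

/-- A monomial has finitely many divisors, so the finite exceptional sets can be united. Controlling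
all divisors of `m` at once is what survives multiplication, and it lets infinite sums be replaced
by finite ones in products. -/
theorem FormallySummable.exists_finset {f : ι → MvPowerSeries σ A} (hf : FormallySummable f)
    (m : σ →₀ ℕ) : ∃ s : Finset ι, ∀ i ∉ s, EqUpTo m (f i) 0 := by
  classical
  refine ⟨((Set.finite_Iic m).biUnion fun n _ => hf n).toFinset, fun i hi n hn => ?_⟩
  by_contra hne
  exact hi (by
    rw [Set.Finite.mem_toFinset]
    exact Set.mem_biUnion (Set.mem_Iic.2 hn) (by simpa using hne))

theorem eqUpTo_formalSum {f : ι → MvPowerSeries σ A} {m : σ →₀ ℕ} {s : Finset ι}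
    (h : ∀ i ∉ s, EqUpTo m (f i) 0) : EqUpTo m (formalSum f) (∑ i ∈ s, f i) := fun n hn => by
  rw [map_sum]
  exact coeff_formalSum_eq_sum fun i hi => (h i hi n hn).trans (by simp)

theorem HasFormalSum.unique {f : ι → MvPowerSeries σ A} {S S' : MvPowerSeries σ A}
    (h : HasFormalSum f S) (h' : HasFormalSum f S') : S = S' := h.2.symm.trans h'.2

theorem HasFormalSum.summable {f : ι → MvPowerSeries σ A} {S : MvPowerSeries σ A}
    (h : HasFormalSum f S) : FormallySummable f := h.1

theorem HasFormalSum.formalSum_eq {f : ι → MvPowerSeries σ A} {S : MvPowerSeries σ A}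
    (h : HasFormalSum f S) : formalSum f = S := h.2

theorem FormallySummable.hasFormalSum {f : ι → MvPowerSeries σ A} (h : FormallySummable f) :
    HasFormalSum f (formalSum f) := ⟨h, rfl⟩

theorem hasFormalSum_iff {f : ι → MvPowerSeries σ A} {S : MvPowerSeries σ A} :
    HasFormalSum f S ↔ FormallySummable f ∧ ∀ m, ∑ᶠ i, coeff m (f i) = coeff m S :=
  and_congr_right fun _ => ⟨fun h m => by rw [← h]; rfl, fun h => MvPowerSeries.ext h⟩

theorem hasFormalSum_of_finset {f : ι → MvPowerSeries σ A} (s : Finset ι)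
    (h : ∀ i ∉ s, f i = 0) : HasFormalSum f (∑ i ∈ s, f i) := by
  refine hasFormalSum_iff.2 ⟨fun m => s.finite_toSet.subset fun i hi => ?_, fun m => ?_⟩
  · by_contra his
    exact hi (by rw [h i his, map_zero])
  · rw [map_sum]
    exact coeff_formalSum_eq_sum fun i hi => by rw [h i hi, map_zero]

theorem hasFormalSum_single {f : ι → MvPowerSeries σ A} (a : ι)
    (h : ∀ i, i ≠ a → f i = 0) : HasFormalSum f (f a) := by
  simpa using hasFormalSum_of_finset {a} fun i hi => h i (by simpa using hi)

/-- Up to a given monomial both families are finite, and the claim becomes distributivity of finite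
sums. -/
theorem HasFormalSum.mul {f : ι → MvPowerSeries σ A} {g : κ → MvPowerSeries σ A}
    {S T : MvPowerSeries σ A} (hf : HasFormalSum f S) (hg : HasFormalSum g T) :
    HasFormalSum (fun p : ι × κ => f p.1 * g p.2) (S * T) := by
  classical
  have key : ∀ m, ∃ (s : Finset ι) (t : Finset κ), (∀ i ∉ s, EqUpTo m (f i) 0) ∧
      (∀ j ∉ t, EqUpTo m (g j) 0) ∧ ∀ p ∉ s ×ˢ t, EqUpTo m (f p.1 * g p.2) 0 := by
    intro m
    obtain ⟨s, hs⟩ := hf.summable.exists_finset m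
    obtain ⟨t, ht⟩ := hg.summable.exists_finset m
    refine ⟨s, t, hs, ht, fun p hp => ?_⟩
    rw [Finset.mem_product, not_and_or] at hp
    rcases hp with hp | hp
    · simpa using (hs _ hp).mul (EqUpTo.refl m (g p.2))
    · simpa using (EqUpTo.refl m (f p.1)).mul (ht _ hp)
  refine hasFormalSum_iff.2 ⟨fun m => ?_, fun m => ?_⟩
  · obtain ⟨s, t, -, -, h⟩ := key m
    refine (s ×ˢ t).finite_toSet.subset fun p hp => ?_
    by_contra hps
    exact hp (by simpa using (h p hps).coeff_eq)
  · obtain ⟨s, t, hs, ht, h⟩ := key m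
    have h1 := (eqUpTo_formalSum h).coeff_eq
    have h2 := ((eqUpTo_formalSum hs).mul (eqUpTo_formalSum ht)).coeff_eq
    rw [hf.formalSum_eq, hg.formalSum_eq, Finset.sum_mul_sum, ← Finset.sum_product'] at h2
    exact h1.trans h2.symm

theorem HasFormalSum.add {f g : ι → MvPowerSeries σ A} {S T : MvPowerSeries σ A}
    (hf : HasFormalSum f S) (hg : HasFormalSum g T) :
    HasFormalSum (fun i => f i + g i) (S + T) := by
  refine hasFormalSum_iff.2 ⟨fun m => ?_, fun m => ?_⟩
  · refine ((hf.summable m).union (hg.summable m)).subset fun i hi => ?_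
    by_contra h
    simp only [Set.mem_union, Set.mem_ofPred_eq, not_or, not_not] at h
    exact hi (by rw [map_add, h.1, h.2, add_zero])
  · simp only [map_add]
    rw [finsum_add_distrib (hf.summable m) (hg.summable m), ← (hasFormalSum_iff.1 hf).2,
      ← (hasFormalSum_iff.1 hg).2]

theorem HasFormalSum.comp_equiv {f : ι → MvPowerSeries σ A} {S : MvPowerSeries σ A}
    (hf : HasFormalSum f S) (e : κ ≃ ι) : HasFormalSum (fun k => f (e k)) S := by
  refine hasFormalSum_iff.2 ⟨fun m => ?_, fun m => ?_⟩
  · exact (hf.summable m).preimage e.injective.injOn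
  · rw [← (hasFormalSum_iff.1 hf).2]
    exact finsum_comp_equiv e (f := fun i => coeff m (f i))

theorem HasFormalSum.sum_fiberwise {f : ι → MvPowerSeries σ A} {S : MvPowerSeries σ A}
    (hf : HasFormalSum f S) (π : ι → κ) (t : κ → Finset ι) (ht : ∀ i k, i ∈ t k ↔ π i = k) :
    HasFormalSum (fun k => ∑ i ∈ t k, f i) S := by
  classical
  have key : ∀ m, ∀ k ∉ (hf.summable m).toFinset.image π, coeff m (∑ i ∈ t k, f i) = 0 := by
    intro m k hk
    rw [map_sum]
    refine Finset.sum_eq_zero fun i hi => ?_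
    by_contra hne
    exact hk (Finset.mem_image.2 ⟨i, by simpa using hne, (ht i k).1 hi⟩)
  refine hasFormalSum_iff.2 ⟨fun m => ?_, fun m => ?_⟩
  · refine ((hf.summable m).toFinset.image π).finite_toSet.subset fun k hk => ?_
    by_contra h
    exact hk (key m k h)
  · refine (coeff_formalSum_eq_sum (key m)).trans ?_
    rw [← (hasFormalSum_iff.1 hf).2, finsum_eq_sum _ (hf.summable m),
      ← Finset.sum_fiberwise_of_maps_to (fun i hi => Finset.mem_image_of_mem π hi)]
    refine Finset.sum_congr rfl fun k _ => ?_
    rw [map_sum]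
    refine (Finset.sum_subset (fun i hi => ?_) fun i hi hi' => ?_).symm
    · exact (ht i k).2 (Finset.mem_filter.1 hi).2
    · by_contra hne
      exact hi' (Finset.mem_filter.2 ⟨(Set.Finite.mem_toFinset _).2 hne, (ht i k).1 hi⟩)

theorem HasFormalSum.antidiagonal {f g : ℕ → MvPowerSeries σ A} {S T : MvPowerSeries σ A}
    (hf : HasFormalSum f S) (hg : HasFormalSum g T) :
    HasFormalSum (fun k => ∑ p ∈ antidiagonal k, f p.1 * g p.2) (S * T) :=
  (hf.mul hg).sum_fiberwise (fun p => p.1 + p.2) _ fun _ _ => mem_antidiagonal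

theorem FormallySummable.slice {f : ι × κ → MvPowerSeries σ A} (hf : FormallySummable f) (i : ι) :
    FormallySummable fun k => f (i, k) :=
  fun m => (hf m).preimage (Prod.mk_right_injective i).injOn

theorem HasFormalSum.curry {f : ι × κ → MvPowerSeries σ A} {S : MvPowerSeries σ A}
    (hf : HasFormalSum f S) : HasFormalSum (fun i => formalSum fun k => f (i, k)) S := by
  refine hasFormalSum_iff.2 ⟨fun m => ?_, fun m => ?_⟩
  · refine ((hf.summable m).image Prod.fst).subset fun i hi => ?_
    by_contra h
    refine hi (finsum_eq_zero_of_forall_eq_zero fun k => ?_)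
    by_contra hk
    exact h ⟨(i, k), hk, rfl⟩
  · rw [← (hasFormalSum_iff.1 hf).2, finsum_curry _ (hf.summable m)]
    rfl

theorem hasFormalSum_monomial (f : MvPowerSeries σ A) :
    HasFormalSum (fun m => monomial m (coeff m f)) f := by
  classical
  refine hasFormalSum_iff.2 ⟨fun m => (Set.finite_singleton m).subset fun n hn => ?_, fun m => ?_⟩
  · by_contra h
    exact hn (coeff_monomial_ne (Ne.symm h) _)
  · rw [finsum_eq_single _ m fun n hn => coeff_monomial_ne hn.symm _, coeff_monomial_same]

theorem HasFormalProd.unique {F : ℕ → MvPowerSeries σ A} {P Q : MvPowerSeries σ A}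
    (hP : HasFormalProd F P) (hQ : HasFormalProd F Q) : P = Q := by
  refine MvPowerSeries.ext fun m => ?_
  obtain ⟨n, h1, h2⟩ := ((hP m).and (hQ m)).exists
  exact h1.symm.trans h2

theorem HasFormalProd.eventually_eqUpTo {F : ℕ → MvPowerSeries σ A} {P : MvPowerSeries σ A}
    (hP : HasFormalProd F P) (m : σ →₀ ℕ) :
    ∀ᶠ n in Filter.atTop, EqUpTo m ((List.range n).map F).prod P :=
  haveI := Classical.decEq σ
  (Filter.eventually_all_finite (Set.finite_Iic m)).2 fun k _ => hP k

theorem commute_list_range_prod {M : Type*} [Monoid M] {F : ℕ → M} {x : M} (n : ℕ)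
    (h : ∀ j < n, Commute x (F j)) : Commute x ((List.range n).map F).prod := by
  refine Commute.list_prod_right _ _ fun y hy => ?_
  obtain ⟨j, hj, rfl⟩ := List.mem_map.1 hy
  exact h j (List.mem_range.1 hj)

theorem HasFormalProd.mul {F G : ℕ → MvPowerSeries σ A} {P Q : MvPowerSeries σ A}
    (hP : HasFormalProd F P) (hQ : HasFormalProd G Q)
    (hc : ∀ j k, j ≠ k → Commute (F j) (G k)) : HasFormalProd (fun k => F k * G k) (P * Q) := by
  have key : ∀ n, ((List.range n).map fun k => F k * G k).prod =
      ((List.range n).map F).prod * ((List.range n).map G).prod := by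
    intro n
    induction n with
    | zero => simp
    | succ n ih =>
      simp only [List.range_succ, List.map_append, List.prod_append, ih, List.map_cons,
        List.map_nil, List.prod_cons, List.prod_nil, mul_one]
      -- The new factor `F n` has to pass only the earlier `G j`, `j < n`; commutation of `F n` with
      -- `G n` is never needed.
      have := commute_list_range_prod (x := F n) (F := G) n fun j hj => hc n j hj.ne'
      rw [mul_assoc, ← mul_assoc _ (F n), ← this.eq, mul_assoc, ← mul_assoc]
  intro m
  filter_upwards [hP.eventually_eqUpTo m, hQ.eventually_eqUpTo m] with n h1 h2
  rw [key]
  exact (h1.mul h2).coeff_eq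

theorem exists_hasFormalProd {F : ℕ → MvPowerSeries σ A}
    (h : ∀ m, ∃ N, ∀ k ≥ N, EqUpTo m (F k) 1) : ∃ P, HasFormalProd F P := by
  choose N hN using h
  refine ⟨fun m => coeff m ((List.range (N m)).map F).prod, fun m => ?_⟩
  refine Filter.eventually_atTop.2 ⟨N m, fun n hn => ?_⟩
  suffices EqUpTo m ((List.range n).map F).prod ((List.range (N m)).map F).prod from this.coeff_eq
  induction n, hn using Nat.le_induction with
  | base => exact EqUpTo.refl _ _
  | succ n hn ih =>
    simp only [List.range_succ, List.map_append, List.prod_append, List.map_cons,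
        List.map_nil, List.prod_cons, List.prod_nil, mul_one]
    simpa using ih.mul (hN m n hn)

end Semiring

section Ring

variable [Ring A] [Ring B]

/-- Each coefficient of `L f` is determined by finitely many coefficients of `f`. -/
def CoeffFinite (L : MvPowerSeries σ A → MvPowerSeries τ B) : Prop :=
  ∀ n, ∃ M : Finset (σ →₀ ℕ), ∀ f, (∀ m ∈ M, coeff m f = 0) → coeff n (L f) = 0

variable {F : Type*} [FunLike F (MvPowerSeries σ A) (MvPowerSeries τ B)]

/-- A coefficient of `L S` depends on finitely many coefficients of `S`, and these agree with those
of a finite partial sum, where additivity applies. -/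
theorem HasFormalSum.map [AddMonoidHomClass F (MvPowerSeries σ A) (MvPowerSeries τ B)] {L : F}
    (hL : CoeffFinite L) {f : ι → MvPowerSeries σ A} {S : MvPowerSeries σ A}
    (hf : HasFormalSum f S) : HasFormalSum (fun i => L (f i)) (L S) := by
  classical
  have key : ∀ n, ∃ s : Finset ι, (∀ i ∉ s, coeff n (L (f i)) = 0) ∧
      coeff n (L S) = ∑ i ∈ s, coeff n (L (f i)) := by
    intro n
    obtain ⟨M, hM⟩ := hL n
    have hs : ∀ i ∉ (M.biUnion fun m => (hf.summable m).toFinset), ∀ m ∈ M, coeff m (f i) = 0 := by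
      intro i hi m hm
      by_contra hne
      exact hi (Finset.mem_biUnion.2 ⟨m, hm, by rw [Set.Finite.mem_toFinset]; exact hne⟩)
    refine ⟨M.biUnion fun m => (hf.summable m).toFinset, fun i hi => hM _ (hs i hi), ?_⟩
    rw [← sub_eq_zero, ← map_sum, ← map_sum, ← map_sub, ← map_sub]
    refine hM _ fun m hm => ?_
    rw [map_sub, map_sum, ← coeff_formalSum_eq_sum fun i hi => hs i hi m hm, hf.formalSum_eq,
      sub_self]
  refine hasFormalSum_iff.2 ⟨fun n => ?_, fun n => ?_⟩
  · obtain ⟨s, hs, -⟩ := key n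
    refine s.finite_toSet.subset fun i hi => ?_
    by_contra h
    exact hi (hs i h)
  · obtain ⟨s, hs, h⟩ := key n
    rw [h]
    exact coeff_formalSum_eq_sum hs

theorem CoeffFinite.map_formalSum [AddMonoidHomClass F (MvPowerSeries σ A) (MvPowerSeries τ B)]
    {L : F} (hL : CoeffFinite L) {f : ι → MvPowerSeries σ A} (hf : FormallySummable f) :
    L (formalSum f) = formalSum fun i => L (f i) :=
  (hf.hasFormalSum.map hL).2.symm

theorem HasFormalProd.map [RingHomClass F (MvPowerSeries σ A) (MvPowerSeries τ B)] {L : F}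
    (hL : CoeffFinite L) {f : ℕ → MvPowerSeries σ A} {P : MvPowerSeries σ A}
    (hf : HasFormalProd f P) : HasFormalProd (fun k => L (f k)) (L P) := by
  intro n
  obtain ⟨M, hM⟩ := hL n
  filter_upwards [(Filter.eventually_all_finset M).2 fun m _ => hf m] with k hk
  have : ((List.range k).map fun k => L (f k)).prod = L ((List.range k).map f).prod := by
    rw [map_list_prod, List.map_map]
    rfl
  rw [this, ← sub_eq_zero, ← map_sub, ← map_sub]
  exact hM _ fun m hm => by rw [map_sub, hk m hm, sub_self]

theorem coeffFinite_mulLeft (g : MvPowerSeries σ A) : CoeffFinite (AddMonoidHom.mulLeft g) := by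
  classical
  intro n
  refine ⟨(antidiagonal n).image Prod.snd, fun f hf => ?_⟩
  rw [AddMonoidHom.coe_mulLeft, coeff_mul]
  exact Finset.sum_eq_zero fun p hp => by rw [hf _ (Finset.mem_image_of_mem _ hp), mul_zero]

theorem coeffFinite_mulRight (g : MvPowerSeries σ A) : CoeffFinite (AddMonoidHom.mulRight g) := by
  classical
  intro n
  refine ⟨(antidiagonal n).image Prod.fst, fun f hf => ?_⟩
  rw [AddMonoidHom.mulRight_apply, coeff_mul]
  exact Finset.sum_eq_zero fun p hp => by rw [hf _ (Finset.mem_image_of_mem _ hp), zero_mul]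

end Ring

end FormalSums

end

section

open MvPowerSeries
open Finset.HasAntidiagonal (antidiagonal mem_antidiagonal)

/-! ## Exponential series and Lie homomorphisms -/

section DividedPowers

variable {S : Type*} [Ring S] [Algebra ℚ S]

theorem succ_nsmul_cancel {M : Type*} [AddCommGroup M] [Module ℚ M] {k : ℕ} {x y : M}
    (h : (k + 1) • x = (k + 1) • y) : x = y := by
  have h0 : ((k + 1 : ℕ) : ℚ) ≠ 0 := Nat.cast_ne_zero.2 k.succ_ne_zero
  rw [← Nat.cast_smul_eq_nsmul ℚ, ← Nat.cast_smul_eq_nsmul ℚ] at h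
  exact smul_right_injective M h0 h

/-- The divided power `Zᵏ / k!`. -/
def divPow (Z : S) (k : ℕ) : S := ((k.factorial : ℚ)⁻¹) • Z ^ k

theorem divPow_zero (Z : S) : divPow Z 0 = 1 := by simp [divPow]

theorem succ_nsmul_divPow (Z : S) (k : ℕ) : (k + 1) • divPow Z (k + 1) = divPow Z k * Z := by
  rw [divPow, divPow, pow_succ, smul_mul_assoc, ← Nat.cast_smul_eq_nsmul ℚ, smul_smul,
    Nat.factorial_succ]
  congr 1
  have : ((k + 1 : ℕ) : ℚ) ≠ 0 := Nat.cast_ne_zero.2 k.succ_ne_zero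
  push_cast at this ⊢
  field_simp

theorem succ_nsmul_divPow' (Z : S) (k : ℕ) : (k + 1) • divPow Z (k + 1) = Z * divPow Z k := by
  rw [succ_nsmul_divPow, divPow, smul_mul_assoc, mul_smul_comm, pow_mul_comm']

/-- The degree `k` part of `exp(-Z) δ(exp Z)`. -/
def conjCoeff (δ : S →+ S) (Z : S) (k : ℕ) : S :=
  ∑ p ∈ antidiagonal k, divPow (-Z) p.1 * δ (divPow Z p.2)

theorem conjCoeff_zero (δ : S →+ S) (Z : S) : conjCoeff δ Z 0 = δ 1 := by
  simp [conjCoeff, divPow_zero]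

/-- On the antidiagonal, `k + 1` splits as the sum of the two indices. The first index lowers the
divided power of `-Z` and extracts `-Z` on the left; the second lowers that of `Z` and extracts,
through the rule for `δ`, a `Z` or a `v` on the right. -/
theorem succ_nsmul_conjCoeff_aux (δ : S →+ S) (Z v : S) (h : ∀ a, δ (a * Z) = δ a * Z + a * v)
    (k : ℕ) : (k + 1) • conjCoeff δ Z (k + 1) = conjCoeff δ Z k * Z - Z * conjCoeff δ Z k +
      conjCoeff (AddMonoidHom.id S) Z k * v := by
  have h1 : (k + 1) • conjCoeff δ Z (k + 1) =
      ∑ p ∈ antidiagonal (k + 1), p.1 • (divPow (-Z) p.1 * δ (divPow Z p.2)) +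
      ∑ p ∈ antidiagonal (k + 1), p.2 • (divPow (-Z) p.1 * δ (divPow Z p.2)) := by
    rw [conjCoeff, Finset.smul_sum, ← Finset.sum_add_distrib]
    refine Finset.sum_congr rfl fun p hp => ?_
    rw [← add_smul, mem_antidiagonal.1 hp]
  have h2 : ∑ p ∈ antidiagonal (k + 1), p.1 • (divPow (-Z) p.1 * δ (divPow Z p.2)) =
      - (Z * conjCoeff δ Z k) := by
    rw [Finset.Nat.sum_antidiagonal_succ, zero_smul, zero_add, conjCoeff, Finset.mul_sum,
      ← Finset.sum_neg_distrib]
    refine Finset.sum_congr rfl fun p _ => ?_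
    rw [← smul_mul_assoc, succ_nsmul_divPow', neg_mul, neg_mul, mul_assoc]
  have h3 : ∑ p ∈ antidiagonal (k + 1), p.2 • (divPow (-Z) p.1 * δ (divPow Z p.2)) =
      conjCoeff δ Z k * Z + conjCoeff (AddMonoidHom.id S) Z k * v := by
    rw [Finset.Nat.sum_antidiagonal_succ', zero_smul, zero_add, conjCoeff, conjCoeff,
      Finset.sum_mul, Finset.sum_mul, ← Finset.sum_add_distrib]
    refine Finset.sum_congr rfl fun p _ => ?_
    rw [← mul_smul_comm, ← map_nsmul, succ_nsmul_divPow, h, mul_add, AddMonoidHom.id_apply,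
      mul_assoc, mul_assoc]
  rw [h1, h2, h3]
  abel

theorem conjCoeff_id (Z : S) (k : ℕ) :
    conjCoeff (AddMonoidHom.id S) Z k = if k = 0 then 1 else 0 := by
  induction k with
  | zero => simp [conjCoeff_zero]
  | succ k ih =>
    refine succ_nsmul_cancel (k := k) ?_
    rw [succ_nsmul_conjCoeff_aux _ Z 0 (fun a => by simp), ih]
    split_ifs <;> simp_all

/-- Beyond the initial value `δ 1`, the recursion uses only the commutator with `Z` and the element
`v`, operations that a Lie homomorphism respects. The rule imposed on `δ` covers a derivation (`v =
δ Z`) and a left multiplication (`v = 0`). -/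
theorem succ_nsmul_conjCoeff (δ : S →+ S) (Z v : S) (h : ∀ a, δ (a * Z) = δ a * Z + a * v)
    (k : ℕ) : (k + 1) • conjCoeff δ Z (k + 1) = conjCoeff δ Z k * Z - Z * conjCoeff δ Z k +
      if k = 0 then v else 0 := by
  rw [succ_nsmul_conjCoeff_aux δ Z v h, conjCoeff_id]
  split_ifs <;> simp

end DividedPowers

section Exp

variable {σ τ A B : Type*} [Ring A] [Algebra ℚ A] [Ring B] [Algebra ℚ B]

theorem hasFormalSum_expSeries {Z : MvPowerSeries σ A} (hZ : constantCoeff Z = 0) :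
    HasFormalSum (divPow Z) (expSeries Z) :=
  (formallySummable_smul_pow _ Z hZ).hasFormalSum

theorem hasFormalSum_conjCoeff {Z : MvPowerSeries σ A} (hZ : constantCoeff Z = 0)
    {δ : MvPowerSeries σ A →+ MvPowerSeries σ A} (hδ : CoeffFinite δ) :
    HasFormalSum (conjCoeff δ Z) (expSeries (-Z) * δ (expSeries Z)) := by
  have h1 : HasFormalSum (divPow (-Z)) (expSeries (-Z)) := hasFormalSum_expSeries (by simp [hZ])
  have h2 : HasFormalSum (fun k => δ (divPow Z k)) (δ (expSeries Z)) :=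
    (hasFormalSum_expSeries hZ).map hδ
  have h3 := h1.antidiagonal h2
  unfold conjCoeff
  exact h3

theorem coeffFinite_id : CoeffFinite (AddMonoidHom.id (MvPowerSeries σ A)) :=
  fun n => ⟨{n}, fun f hf => hf n (by simp)⟩

theorem expSeries_neg_mul {Z : MvPowerSeries σ A} (hZ : constantCoeff Z = 0) :
    expSeries (-Z) * expSeries Z = 1 := by
  have h := hasFormalSum_conjCoeff hZ (coeffFinite_id (σ := σ) (A := A))
  rw [AddMonoidHom.id_apply] at h
  refine h.unique ?_
  have := hasFormalSum_single (f := conjCoeff (AddMonoidHom.id _) Z) 0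
    fun i hi => by rw [conjCoeff_id, if_neg hi]
  rwa [conjCoeff_id, if_pos rfl] at this

theorem expSeries_mul_neg {Z : MvPowerSeries σ A} (hZ : constantCoeff Z = 0) :
    expSeries Z * expSeries (-Z) = 1 := by
  simpa using expSeries_neg_mul (Z := -Z) (by simp [hZ])

theorem constantCoeff_formalSum_smul_pow {f : MvPowerSeries σ A} (hf : constantCoeff f = 0)
    (c : ℕ → ℚ) : constantCoeff (formalSum fun k : ℕ => c k • f ^ k) = algebraMap ℚ A (c 0) := by
  rw [← coeff_zero_eq_constantCoeff_apply, coeff_formalSum, finsum_eq_single _ 0]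
  · show c 0 • coeff 0 (f ^ 0) = _
    rw [pow_zero, coeff_zero_one, Algebra.smul_def, mul_one]
  · intro k hk
    show c k • coeff 0 (f ^ k) = 0
    rw [coeff_zero_eq_constantCoeff_apply, map_pow, hf, zero_pow hk, smul_zero]

theorem constantCoeff_expSeries {Z : MvPowerSeries σ A} (hZ : constantCoeff Z = 0) :
    constantCoeff (expSeries Z) = 1 := by
  rw [expSeries, constantCoeff_formalSum_smul_pow hZ]
  simp

theorem constantCoeff_logSeries {x : MvPowerSeries σ A} (hx : constantCoeff x = 1) :
    constantCoeff (logSeries x) = 0 := by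
  rw [logSeries, constantCoeff_formalSum_smul_pow (by simp [hx])]
  simp

theorem map_expSeries {F : Type*}
    [FunLike F (MvPowerSeries σ A) (MvPowerSeries τ B)]
    [RingHomClass F (MvPowerSeries σ A) (MvPowerSeries τ B)] {φ : F} (hφ : CoeffFinite φ)
    {Z : MvPowerSeries σ A} (hZ : constantCoeff Z = 0) :
    φ (expSeries Z) = expSeries (φ Z) := by
  rw [expSeries, hφ.map_formalSum (formallySummable_smul_pow _ Z hZ), expSeries]
  simp only [map_rat_smul, map_pow]

theorem map_logSeries {F : Type*}
    [FunLike F (MvPowerSeries σ A) (MvPowerSeries τ B)]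
    [RingHomClass F (MvPowerSeries σ A) (MvPowerSeries τ B)] {φ : F} (hφ : CoeffFinite φ)
    {x : MvPowerSeries σ A} (hx : constantCoeff x = 1) :
    φ (logSeries x) = logSeries (φ x) := by
  rw [logSeries, hφ.map_formalSum (formallySummable_smul_pow _ _ (by simp [hx])), logSeries]
  simp only [map_rat_smul, map_pow, map_sub, map_one]

/-- A coefficientwise additive map. -/
def mapCoeffHom (T : A →+ B) : MvPowerSeries σ A →+ MvPowerSeries σ B where
  toFun := mapCoeff T
  map_zero' := funext fun _ => map_zero T
  map_add' _ _ := funext fun _ => map_add T _ _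

theorem coeff_mapCoeffHom (T : A →+ B) (f : MvPowerSeries σ A) (m : σ →₀ ℕ) :
    coeff m (mapCoeffHom T f) = T (coeff m f) := rfl

theorem coeffFinite_mapCoeffHom (T : A →+ B) :
    CoeffFinite (mapCoeffHom T : MvPowerSeries σ A →+ MvPowerSeries σ B) :=
  fun n => ⟨{n}, fun f hf => by rw [coeff_mapCoeffHom, hf n (by simp), map_zero]⟩

theorem constantCoeff_mapCoeffHom {T : A →+ B} {f : MvPowerSeries σ A}
    (hf : constantCoeff f = 0) : constantCoeff (mapCoeffHom T f) = 0 := by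
  rw [← coeff_zero_eq_constantCoeff_apply, coeff_mapCoeffHom, coeff_zero_eq_constantCoeff_apply,
    hf, map_zero]

/-- An additive map is a Lie homomorphism for the commutator brackets. -/
def PreservesCommutator (T : A →+ B) : Prop := ∀ a b, T (a * b - b * a) = T a * T b - T b * T a

/-- The variables are central, so a commutator of series only involves commutators of coefficients.
This is why a Lie homomorphism may be applied coefficientwise. -/
theorem coeff_commutator [DecidableEq σ] (u v : MvPowerSeries σ A) (m : σ →₀ ℕ) :
    coeff m (u * v - v * u) =
      ∑ p ∈ antidiagonal m, (coeff p.1 u * coeff p.2 v - coeff p.2 v * coeff p.1 u) := by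
  rw [map_sub, coeff_mul, coeff_mul, Finset.sum_sub_distrib]
  congr 1
  refine Finset.sum_equiv (Equiv.prodComm _ _) (fun p => ?_) fun p _ => rfl
  simp [add_comm]

theorem PreservesCommutator.mapCoeffHom {T : A →+ B} (hT : PreservesCommutator T) :
    PreservesCommutator (mapCoeffHom T : MvPowerSeries σ A →+ MvPowerSeries σ B) := by
  classical
  intro f g
  refine MvPowerSeries.ext fun m => ?_
  rw [coeff_mapCoeffHom, coeff_commutator, coeff_commutator, map_sum]
  exact Finset.sum_congr rfl fun p _ => hT _ _

/-- Lie homomorphisms commute with `Z ↦ exp(-Z) δ(exp Z)`. -/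
theorem mapCoeffHom_exp_conj {T : A →+ B} (hT : PreservesCommutator T)
    {Z vA : MvPowerSeries σ A} (hZ : constantCoeff Z = 0)
    {δA : MvPowerSeries σ A →+ MvPowerSeries σ A} {δB : MvPowerSeries σ B →+ MvPowerSeries σ B}
    (hcA : CoeffFinite δA) (hcB : CoeffFinite δB)
    (hA : ∀ a, δA (a * Z) = δA a * Z + a * vA)
    (hB : ∀ a, δB (a * mapCoeffHom T Z) = δB a * mapCoeffHom T Z + a * mapCoeffHom T vA)
    (h1 : mapCoeffHom T (δA 1) = δB 1) :
    mapCoeffHom T (expSeries (-Z) * δA (expSeries Z)) =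
      expSeries (-mapCoeffHom T Z) * δB (expSeries (mapCoeffHom T Z)) := by
  have key : ∀ k, mapCoeffHom T (conjCoeff δA Z k) = conjCoeff δB (mapCoeffHom T Z) k := by
    intro k
    induction k with
    | zero => rw [conjCoeff_zero, conjCoeff_zero, h1]
    | succ k ih =>
      refine succ_nsmul_cancel (k := k) ?_
      rw [← map_nsmul, succ_nsmul_conjCoeff δA Z vA hA, succ_nsmul_conjCoeff δB _ _ hB, map_add,
        hT.mapCoeffHom, ih]
      congr 1
      split_ifs <;> simp
  refine ((hasFormalSum_conjCoeff hZ hcA).map (coeffFinite_mapCoeffHom T)).unique ?_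
  simp only [key]
  exact hasFormalSum_conjCoeff (constantCoeff_mapCoeffHom hZ) hcB

/-! ### The Euler derivation -/

/-- The Euler derivation, multiplying a monomial by its degree. -/
def euler : MvPowerSeries σ A →+ MvPowerSeries σ A where
  toFun f := fun m => m.degree • coeff m f
  map_zero' := funext fun _ => by rw [map_zero, smul_zero]; rfl
  map_add' f g := funext fun _ => by rw [map_add, smul_add]; rfl

theorem coeff_euler (f : MvPowerSeries σ A) (m : σ →₀ ℕ) :
    coeff m (euler f) = m.degree • coeff m f := rfl

theorem coeffFinite_euler : CoeffFinite (euler : MvPowerSeries σ A →+ MvPowerSeries σ A) :=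
  fun n => ⟨{n}, fun f hf => by rw [coeff_euler, hf n (by simp), smul_zero]⟩

theorem euler_mul (f g : MvPowerSeries σ A) : euler (f * g) = euler f * g + f * euler g := by
  classical
  refine MvPowerSeries.ext fun m => ?_
  rw [coeff_euler, map_add, coeff_mul, coeff_mul, coeff_mul, Finset.smul_sum,
    ← Finset.sum_add_distrib]
  refine Finset.sum_congr rfl fun p hp => ?_
  rw [coeff_euler, coeff_euler, ← mem_antidiagonal.1 hp, map_add, add_smul, smul_mul_assoc,
    mul_smul_comm]

theorem euler_one : euler (1 : MvPowerSeries σ A) = 0 := by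
  classical
  refine MvPowerSeries.ext fun m => ?_
  rw [coeff_euler, coeff_one]
  split_ifs with h <;> simp [h]

theorem mapCoeffHom_euler (T : A →+ B) (f : MvPowerSeries σ A) :
    mapCoeffHom T (euler f) = euler (mapCoeffHom T f) :=
  MvPowerSeries.ext fun m => by
    rw [coeff_mapCoeffHom, coeff_euler, coeff_euler, coeff_mapCoeffHom, map_nsmul]

theorem constantCoeff_euler (f : MvPowerSeries σ A) : constantCoeff (euler f) = 0 := by
  rw [← coeff_zero_eq_constantCoeff_apply, coeff_euler, map_zero, zero_smul]

/-- A solution of `E F = F a` is determined by its constant coefficient. -/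
theorem eq_of_euler_eq {F G a : MvPowerSeries σ A} (ha : constantCoeff a = 0)
    (hF : euler F = F * a) (hG : euler G = G * a) (h0 : constantCoeff F = constantCoeff G) :
    F = G := by
  classical
  rw [← sub_eq_zero]
  set H := F - G with hH
  have hE : euler H = H * a := by rw [hH, map_sub, hF, hG, sub_mul]
  have key : ∀ k, ∀ m : σ →₀ ℕ, m.degree = k → coeff m H = 0 := by
    intro k
    induction k using Nat.strong_induction_on with
    | _ k ih =>
      intro m hm
      rcases Nat.eq_zero_or_pos k with rfl | hk
      · rw [Finsupp.degree_eq_zero_iff] at hm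
        rw [hm, coeff_zero_eq_constantCoeff_apply, hH, map_sub, h0, sub_self]
      · have h := congrArg (coeff m) hE
        rw [coeff_euler, coeff_mul, Finset.sum_eq_zero, hm] at h
        · obtain ⟨k, rfl⟩ := Nat.exists_eq_succ_of_ne_zero hk.ne'
          exact succ_nsmul_cancel (k := k) (h.trans (smul_zero _).symm)
        -- Since `a` has no constant term, only `p.2 ≠ 0` matters; then `p.1` has smaller degree and
        -- induction applies.
        · intro p hp
          rw [mem_antidiagonal] at hp
          by_cases h2 : p.2 = 0
          · rw [h2, coeff_zero_eq_constantCoeff_apply, ha, mul_zero]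
          · rw [ih p.1.degree _ p.1 rfl, zero_mul]
            rw [← hm, ← hp, map_add]
            have : p.2.degree ≠ 0 := fun h => h2 (Finsupp.degree_eq_zero_iff _ |>.1 h)
            omega
  exact MvPowerSeries.ext fun m => (key _ m rfl).trans (map_zero _).symm

end Exp

/-! ### Evaluation of power series -/

section Eval

variable {σ τ A A' : Type*} [Ring A] [Ring A']

/-- The evaluation homomorphism sending the monomial with exponent `m` to `g m` and applying `j`
to the coefficients. -/
def evalHom (j : A' →+* A) (g : (τ →₀ ℕ) → MvPowerSeries σ A) (hg : FormallySummable g)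
    (h0 : g 0 = 1) (hadd : ∀ m n, g (m + n) = g m * g n)
    (hcomm : ∀ a m, Commute (C (j a)) (g m)) : MvPowerSeries τ A' →+* MvPowerSeries σ A :=
  have hs : ∀ c : (τ →₀ ℕ) → A, FormallySummable fun m => g m * C (c m) := fun c n =>
    (hg n).subset fun m hm h => hm (by rw [coeff_mul_C, h, zero_mul])
  let φ : MvPowerSeries τ A' →+ MvPowerSeries σ A :=
    { toFun := fun f => formalSum fun m => g m * C (j (coeff m f))
      map_zero' := by
        refine MvPowerSeries.ext fun n => ?_
        rw [coeff_formalSum]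
        simp
      map_add' := fun f f' => by
        simp only [map_add, mul_add]
        exact ((hs _).hasFormalSum.add (hs _).hasFormalSum).formalSum_eq }
  have hφ : CoeffFinite φ := fun n => ⟨(hg n).toFinset, fun f hf => by
    show coeff n (formalSum fun m => g m * C (j (coeff m f))) = 0
    rw [coeff_formalSum]
    refine finsum_eq_zero_of_forall_eq_zero fun m => ?_
    rw [coeff_mul_C]
    by_cases hm : coeff n (g m) = 0
    · rw [hm, zero_mul]
    · rw [hf m ((Set.Finite.mem_toFinset _).2 hm), map_zero, mul_zero]⟩
  have hmon : ∀ m a, φ (monomial m a) = g m * C (j a) := fun m a => by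
    classical
    have h := (hasFormalSum_single (f := fun n => g n * C (j (coeff n (monomial m a)))) m
      fun n hn => by rw [coeff_monomial_ne hn, map_zero, map_zero, mul_zero]).formalSum_eq
    rw [coeff_monomial_same] at h
    exact h
  { φ with
    map_one' := by
      show φ 1 = 1
      have : (1 : MvPowerSeries τ A') = monomial 0 1 := rfl
      rw [this, hmon, h0, map_one, map_one, mul_one]
    map_mul' := fun f f' => by
      show φ (f * f') = φ f * φ f'
      have h := ((hasFormalSum_monomial f).mul (hasFormalSum_monomial f')).map hφ
      have h' := ((hasFormalSum_monomial f).map hφ).mul ((hasFormalSum_monomial f').map hφ)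
      refine h.unique ?_
      convert h' using 2 with p
      -- The coefficient of the first monomial has to move past the value of the second one; this is
      -- the only use of `hcomm`.
      rw [monomial_mul_monomial, hmon, hmon, hmon, hadd, map_mul, map_mul, mul_assoc, mul_assoc,
        ← mul_assoc (g p.2), ← mul_assoc (C _) (g p.2), (hcomm _ _).eq] }

variable {j : A' →+* A} {g : (τ →₀ ℕ) → MvPowerSeries σ A} {hg : FormallySummable g}
  {h0 : g 0 = 1} {hadd : ∀ m n, g (m + n) = g m * g n} {hcomm : ∀ a m, Commute (C (j a)) (g m)}

theorem hasFormalSum_evalHom (f : MvPowerSeries τ A') :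
    HasFormalSum (fun m => g m * C (j (coeff m f))) (evalHom j g hg h0 hadd hcomm f) :=
  ⟨fun n => (hg n).subset fun m hm h => hm (by rw [coeff_mul_C, h, zero_mul]), rfl⟩

theorem coeffFinite_evalHom : CoeffFinite (evalHom j g hg h0 hadd hcomm) :=
  fun n => ⟨(hg n).toFinset, fun f hf => by
    rw [← (hasFormalSum_evalHom f).formalSum_eq, coeff_formalSum]
    refine finsum_eq_zero_of_forall_eq_zero fun m => ?_
    rw [coeff_mul_C]
    by_cases hm : coeff n (g m) = 0
    · rw [hm, zero_mul]
    · rw [hf m ((Set.Finite.mem_toFinset _).2 hm), map_zero, mul_zero]⟩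

theorem evalHom_monomial (m : τ →₀ ℕ) (a : A') :
    evalHom j g hg h0 hadd hcomm (monomial m a) = g m * C (j a) := by
  classical
  have h := (hasFormalSum_single (f := fun n => g n * C (j (coeff n (monomial m a)))) m
      fun n hn => by rw [coeff_monomial_ne hn, map_zero, map_zero, mul_zero]).formalSum_eq
  rw [coeff_monomial_same] at h
  exact h

end Eval

end

section

open MvPowerSeries
open Finset.HasAntidiagonal (antidiagonal mem_antidiagonal)


/-! ### Exponential, logarithm and multiplicativity of `exp ∘ T ∘ log` -/

section ExpLog

/-- With commuting coefficients the commutator in the recursion vanishes, and `exp(-Z) E(exp Z)`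
reduces to its degree one part `E Z`. -/
theorem euler_expSeries_of_comm {σ A : Type*} [CommRing A] [Algebra ℚ A] {Z : MvPowerSeries σ A}
    (hZ : constantCoeff Z = 0) : euler (expSeries Z) = expSeries Z * euler Z := by
  have hδ : ∀ a, euler (a * Z) = euler a * Z + a * euler Z := fun a => euler_mul a Z
  have hc : ∀ k, conjCoeff euler Z k = if k = 1 then euler Z else 0 := by
    intro k
    induction k with
    | zero => rw [conjCoeff_zero, euler_one]; rfl
    | succ k ih =>
      refine succ_nsmul_cancel (k := k) ?_
      rw [succ_nsmul_conjCoeff _ _ _ hδ, mul_comm, sub_self, zero_add]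
      by_cases hk : k = 0 <;> simp [hk]
  have h := hasFormalSum_conjCoeff hZ (coeffFinite_euler (σ := σ) (A := A))
  have h' := hasFormalSum_single (f := conjCoeff euler Z) 1
    fun i hi => by rw [hc, if_neg hi]
  rw [hc, if_pos rfl] at h'
  rw [← h.unique h', ← mul_assoc, expSeries_mul_neg hZ, one_mul]

theorem coeff_logSeries_X (n : ℕ) :
    PowerSeries.coeff n (logSeries (1 + X () : MvPowerSeries Unit ℚ)) = (-1) ^ (n + 1) / (n : ℚ) := by
  have h : ∀ k : ℕ, coeff (Finsupp.single () n) (((-1) ^ (k + 1) / (k : ℚ)) •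
      (1 + X () - 1 : MvPowerSeries Unit ℚ) ^ k) =
      if k = n then (-1) ^ (n + 1) / (n : ℚ) else 0 := by
    intro k
    rw [add_sub_cancel_left]
    show ((-1) ^ (k + 1) / (k : ℚ)) • PowerSeries.coeff n ((PowerSeries.X : PowerSeries ℚ) ^ k) = _
    rw [PowerSeries.coeff_X_pow]
    by_cases hk : k = n
    · simp [hk]
    · simp [hk, Ne.symm hk]
  show ∑ᶠ k : ℕ, coeff (Finsupp.single () n) (((-1) ^ (k + 1) / (k : ℚ)) •
      (1 + X () - 1 : MvPowerSeries Unit ℚ) ^ k) = _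
  simp only [h]
  rw [finsum_eq_single _ n fun k hk => if_neg hk, if_pos rfl]

theorem coeff_euler_powerSeries (f : MvPowerSeries Unit ℚ) (n : ℕ) :
    PowerSeries.coeff n (euler f) = n * PowerSeries.coeff n f := by
  show (Finsupp.single () n).degree • PowerSeries.coeff n f = _
  rw [Finsupp.degree_single, nsmul_eq_mul]

/-- Both sides have constant term `1` and solve `E F = F · E(log(1 + X))`. For the right side this
says `(1 + X) E(log(1 + X)) = X`, which is checked on coefficients. -/
theorem expSeries_logSeries_X :
    expSeries (logSeries (1 + X () : MvPowerSeries Unit ℚ)) = 1 + X () := by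
  have h1 : constantCoeff (1 + X () : MvPowerSeries Unit ℚ) = 1 := by simp
  have hL := constantCoeff_logSeries h1
  refine eq_of_euler_eq (constantCoeff_euler _) (euler_expSeries_of_comm hL) ?_
    ((constantCoeff_expSeries hL).trans h1.symm)
  rw [map_add, euler_one, zero_add]
  refine PowerSeries.ext fun n => ?_
  have hX : PowerSeries.coeff n (euler (X () : MvPowerSeries Unit ℚ)) = if n = 1 then 1 else 0 := by
    rw [coeff_euler_powerSeries]
    show (n : ℚ) * PowerSeries.coeff n PowerSeries.X = _
    rw [PowerSeries.coeff_X]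
    split_ifs with h <;> simp [h]
  rw [hX]
  change _ = PowerSeries.coeff n ((1 + PowerSeries.X) * (euler (logSeries (1 + X ())) : PowerSeries ℚ))
  rw [add_mul, one_mul, map_add, coeff_euler_powerSeries, coeff_logSeries_X]
  rcases n with _ | n
  · simp
  · rw [PowerSeries.coeff_succ_X_mul, coeff_euler_powerSeries, coeff_logSeries_X]
    rcases n with _ | n
    · simp
    · have h2 : ((n + 1 : ℕ) : ℚ) ≠ 0 := Nat.cast_ne_zero.2 n.succ_ne_zero
      have h3 : ((n + 1 + 1 : ℕ) : ℚ) ≠ 0 := Nat.cast_ne_zero.2 (n + 1).succ_ne_zero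
      rw [mul_div_cancel₀ _ h2, mul_div_cancel₀ _ h3, if_neg (by omega)]
      ring

variable {σ A B : Type*} [Ring A] [Algebra ℚ A] [Ring B] [Algebra ℚ B]

/-- Only powers of `x - 1` with rational coefficients occur, so the identity is the image of the
one-variable case under `X ↦ x - 1`, despite the noncommutative coefficients. -/
theorem expSeries_logSeries {x : MvPowerSeries σ A} (hx : constantCoeff x = 1) :
    expSeries (logSeries x) = x := by
  have hf : constantCoeff (x - 1) = 0 := by simp [hx]
  have hg : FormallySummable fun m : Unit →₀ ℕ => (x - 1) ^ m () := by
    intro n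
    refine ((formallySummable_smul_pow (fun _ => 1) (x - 1) hf n).preimage
      (f := fun m : Unit →₀ ℕ => m ()) fun m _ m' _ h => Finsupp.ext fun _ => h).subset fun m hm => ?_
    simpa using hm
  set φ := evalHom (algebraMap ℚ A) (fun m : Unit →₀ ℕ => (x - 1) ^ m ()) hg (by simp)
    (fun m n => by rw [Finsupp.add_apply, pow_add]) (fun a m => by
      have : C (algebraMap ℚ A a) = algebraMap ℚ (MvPowerSeries σ A) a := by
        rw [MvPowerSeries.algebraMap_apply]
      rw [this]
      exact Algebra.commutes _ _) with hφ
  have hc : CoeffFinite φ := coeffFinite_evalHom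
  have hX : φ (X ()) = x - 1 := by
    rw [X_def, hφ, evalHom_monomial, Finsupp.single_eq_same, pow_one, map_one (algebraMap ℚ A),
      map_one C, mul_one]
  have h1 : constantCoeff (1 + X () : MvPowerSeries Unit ℚ) = 1 := by simp
  have h := congrArg φ expSeries_logSeries_X
  rwa [map_expSeries hc (constantCoeff_logSeries h1), map_logSeries hc h1, map_add, map_one, hX,
    add_sub_cancel] at h

/-- `exp(T(log x))`. -/
def lieTheta (T : A →+ B) (x : MvPowerSeries σ A) : MvPowerSeries σ B :=
  expSeries (mapCoeffHom T (logSeries x))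

/-- The logarithmic derivative `x⁻¹ E x`, written as `exp(-Z) E(exp Z)` with `Z = log x`, is
transported by the Lie homomorphism. -/
theorem euler_lieTheta {T : A →+ B} (hT : PreservesCommutator T) {x y : MvPowerSeries σ A}
    (hx : constantCoeff x = 1) (hy : y * x = 1) :
    euler (lieTheta T x) = lieTheta T x * mapCoeffHom T (y * euler x) := by
  have hL := constantCoeff_logSeries hx
  have hT0 := constantCoeff_mapCoeffHom (T := T) hL
  have h := mapCoeffHom_exp_conj hT hL coeffFinite_euler coeffFinite_euler
    (fun a => euler_mul a _) (fun a => by rw [mapCoeffHom_euler, euler_mul])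
    (by rw [euler_one, euler_one, map_zero])
  -- A left inverse and a right inverse of `x` coincide.
  have hinv : expSeries (-logSeries x) = y := by
    have := expSeries_mul_neg hL
    rw [expSeries_logSeries hx] at this
    exact (left_inv_eq_right_inv hy this).symm
  rw [expSeries_logSeries hx, hinv] at h
  rw [h, ← mul_assoc, lieTheta, expSeries_mul_neg hT0, one_mul]

/-- The transport argument again, now with `δ` the left multiplication by `u`, so that `exp(-Z)
δ(exp Z)` is a conjugate of `u`. -/
theorem mapCoeffHom_conj {T : A →+ B} (hT : PreservesCommutator T) {x y u : MvPowerSeries σ A}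
    (hx : constantCoeff x = 1) (hy : y * x = 1) :
    mapCoeffHom T u * lieTheta T x = lieTheta T x * mapCoeffHom T (y * (u * x)) := by
  have hL := constantCoeff_logSeries hx
  have hT0 := constantCoeff_mapCoeffHom (T := T) hL
  have h := mapCoeffHom_exp_conj hT (vA := 0) hL (coeffFinite_mulLeft u)
    (coeffFinite_mulLeft (mapCoeffHom T u)) (fun a => by simp [mul_assoc])
    (fun a => by simp [mul_assoc]) (by simp)
  have hinv : expSeries (-logSeries x) = y := by
    have := expSeries_mul_neg hL
    rw [expSeries_logSeries hx] at this
    exact (left_inv_eq_right_inv hy this).symm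
  rw [expSeries_logSeries hx, hinv, AddMonoidHom.coe_mulLeft, AddMonoidHom.coe_mulLeft] at h
  rw [h, ← mul_assoc, lieTheta, expSeries_mul_neg hT0, one_mul]

theorem constantCoeff_lieTheta {T : A →+ B} {x : MvPowerSeries σ A} (hx : constantCoeff x = 1) :
    constantCoeff (lieTheta T x) = 1 :=
  constantCoeff_expSeries (constantCoeff_mapCoeffHom (constantCoeff_logSeries hx))

/-- Multiplicativity of `x ↦ exp(T(log x))` for a Lie homomorphism `T`. -/
theorem lieTheta_mul {T : A →+ B} (hT : PreservesCommutator T) {x y : MvPowerSeries σ A}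
    (hx : constantCoeff x = 1) (hy : constantCoeff y = 1) :
    lieTheta T (x * y) = lieTheta T x * lieTheta T y := by
  have hxy : constantCoeff (x * y) = 1 := by rw [map_mul, hx, hy, one_mul]
  have inv : ∀ {z : MvPowerSeries σ A}, constantCoeff z = 1 → ∃ z', z' * z = 1 := fun hz =>
    ⟨_, by simpa [expSeries_logSeries hz] using expSeries_neg_mul (constantCoeff_logSeries hz)⟩
  obtain ⟨x', hx'⟩ := inv hx
  obtain ⟨y', hy'⟩ := inv hy
  have hxy' : y' * x' * (x * y) = 1 := by
    rw [mul_assoc, ← mul_assoc x', hx', one_mul, hy']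
  refine eq_of_euler_eq (a := mapCoeffHom T (y' * x' * euler (x * y)))
    (constantCoeff_mapCoeffHom (by rw [map_mul, constantCoeff_euler, mul_zero]))
    (euler_lieTheta hT hxy hxy') ?_ ?_
  -- The logarithmic derivative of `xy` is that of `y` plus the conjugate by `y` of that of `x`; the
  -- conjugation is what moves `T(x⁻¹ E x)` past `Θ(y)`.
  · have h1 : y' * x' * euler (x * y) = y' * (x' * euler x * y) + y' * euler y := by
      rw [euler_mul, mul_add, mul_assoc y' x' (x * euler y), ← mul_assoc x' x, hx', one_mul]
      simp only [mul_assoc]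
    rw [h1, map_add, mul_add, euler_mul, euler_lieTheta hT hx hx', euler_lieTheta hT hy hy',
      mul_assoc, mapCoeffHom_conj hT hy hy', ← mul_assoc, ← mul_assoc, ← mul_assoc,
      ← mul_assoc (lieTheta T x) (lieTheta T y) (mapCoeffHom T (y' * euler y))]
  · rw [map_mul, constantCoeff_lieTheta hx, constantCoeff_lieTheta hy,
      constantCoeff_lieTheta hxy, one_mul]

end ExpLog

end

section

open MvPowerSeries
open Finset.HasAntidiagonal (antidiagonal mem_antidiagonal)


/-! ### Truncation and commutation properties of `exp ∘ T ∘ log` -/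

section Continuity

variable {σ τ A B : Type*} [Ring A] [Algebra ℚ A] [Ring B] [Algebra ℚ B]

theorem EqUpTo.rat_smul {m : σ →₀ ℕ} {f g : MvPowerSeries σ A} (h : EqUpTo m f g) (c : ℚ) :
    EqUpTo m (c • f) (c • g) := fun n hn => by
  show c • coeff n f = c • coeff n g
  rw [h n hn]

theorem EqUpTo.sub {m : σ →₀ ℕ} {f f' g g' : MvPowerSeries σ A} (h : EqUpTo m f f')
    (h' : EqUpTo m g g') : EqUpTo m (f - g) (f' - g') :=
  fun n hn => by rw [map_sub, map_sub, h n hn, h' n hn]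

theorem EqUpTo.lieTheta {m : σ →₀ ℕ} {x y : MvPowerSeries σ A} (h : EqUpTo m x y) (T : A →+ B) :
    EqUpTo m (lieTheta T x) (lieTheta T y) := by
  have hl : EqUpTo m (logSeries x) (logSeries y) :=
    EqUpTo.formalSum fun k => ((h.sub (EqUpTo.refl m 1)).pow k).rat_smul _
  have hT : EqUpTo m (mapCoeffHom T (logSeries x)) (mapCoeffHom T (logSeries y)) :=
    fun n hn => by rw [coeff_mapCoeffHom, coeff_mapCoeffHom, hl n hn]
  exact EqUpTo.formalSum fun k => (hT.pow k).rat_smul _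

theorem lieTheta_one (T : A →+ B) : lieTheta T (1 : MvPowerSeries σ A) = 1 := by
  have h1 : logSeries (1 : MvPowerSeries σ A) = 0 := by
    have h := hasFormalSum_single (A := A) (σ := σ)
      (f := fun k : ℕ => ((-1) ^ (k + 1) / (k : ℚ)) • (1 - 1 : MvPowerSeries σ A) ^ k) 0
      fun k hk => by rw [sub_self, zero_pow hk, smul_zero]
    exact h.formalSum_eq.trans (by simp)
  have h2 := hasFormalSum_single (A := B) (σ := σ)
      (f := fun k : ℕ => ((k.factorial : ℚ)⁻¹) • (0 : MvPowerSeries σ B) ^ k) 0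
      fun k hk => by rw [zero_pow hk, smul_zero]
  rw [lieTheta, h1, map_zero]
  exact h2.formalSum_eq.trans (by simp)

theorem commute_expSeries {Z W : MvPowerSeries σ A} (hZ : constantCoeff Z = 0)
    (h : Commute Z W) : Commute (expSeries Z) W := by
  have h1 := (hasFormalSum_expSeries hZ).map (coeffFinite_mulRight W)
  have h2 := (hasFormalSum_expSeries hZ).map (coeffFinite_mulLeft W)
  refine h1.unique ?_
  have e : (fun k => AddMonoidHom.mulRight W (divPow Z k)) =
      fun k => AddMonoidHom.mulLeft W (divPow Z k) :=
    funext fun k => ((h.pow_left k).smul_left _).eq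
  rw [e]
  exact h2

theorem commute_of_coeff {f g : MvPowerSeries σ A}
    (h : ∀ i j, Commute (coeff i f) (coeff j g)) : Commute f g := by
  classical
  refine sub_eq_zero.1 (MvPowerSeries.ext fun m => ?_)
  rw [coeff_commutator, map_zero]
  exact Finset.sum_eq_zero fun p _ => sub_eq_zero.2 (h _ _).eq

theorem commute_lieTheta {T T' : A →+ B} (h : ∀ a b, Commute (T a) (T' b))
    {x y : MvPowerSeries σ A} (hx : constantCoeff x = 1) (hy : constantCoeff y = 1) :
    Commute (lieTheta T x) (lieTheta T' y) := by
  refine commute_expSeries (constantCoeff_mapCoeffHom (constantCoeff_logSeries hx)) ?_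
  refine (commute_expSeries (constantCoeff_mapCoeffHom (constantCoeff_logSeries hy)) ?_).symm
  exact commute_of_coeff fun i j => (h _ _).symm

end Continuity

/-! ### Tensors of rational power series with algebra elements -/

section Tens

variable {σ A : Type*} [Ring A] [Algebra ℚ A]

theorem coeff_tens (s : MvPowerSeries σ ℚ) (z : A) (m : σ →₀ ℕ) :
    coeff m (tens s z) = coeff m s • z := rfl

theorem tens_eq (s : MvPowerSeries σ ℚ) (z : A) :
    tens s z = MvPowerSeries.map (algebraMap ℚ A) s * C z := by
  refine MvPowerSeries.ext fun m => ?_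
  rw [coeff_tens, coeff_mul_C, coeff_map, Algebra.smul_def]

theorem commute_C_map_algebraMap (s : MvPowerSeries σ ℚ) (z : A) :
    Commute (C z) (MvPowerSeries.map (algebraMap ℚ A) s) := by
  refine MvPowerSeries.ext fun m => ?_
  rw [coeff_mul_C, coeff_C_mul, coeff_map]
  exact (Algebra.commutes _ _).symm

theorem tens_mul_tens (s t : MvPowerSeries σ ℚ) (z w : A) :
    tens s z * tens t w = tens (s * t) (z * w) := by
  rw [tens_eq, tens_eq, tens_eq, map_mul, map_mul, mul_assoc, mul_assoc, ← mul_assoc (C z),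
    (commute_C_map_algebraMap t z).eq, mul_assoc]

theorem FormallySummable.tens {ι : Type*} {f : ι → MvPowerSeries σ ℚ} (hf : FormallySummable f)
    (z : ι → A) : FormallySummable fun i => tens (f i) (z i) :=
  fun m => (hf m).subset fun i hi h => hi (by rw [coeff_tens, h, zero_smul])

/-- `s ↦ s ⊗ z`, as an additive map. -/
def tensHom (z : A) : MvPowerSeries σ ℚ →+ MvPowerSeries σ A where
  toFun s := tens s z
  map_zero' := MvPowerSeries.ext fun m => by rw [coeff_tens, map_zero, zero_smul, map_zero]
  map_add' s t := MvPowerSeries.ext fun m => by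
    rw [coeff_tens, map_add, add_smul, map_add, coeff_tens, coeff_tens]

theorem tensHom_apply (z : A) (s : MvPowerSeries σ ℚ) : tensHom z s = tens s z := rfl

theorem coeffFinite_tensHom (z : A) :
    CoeffFinite (tensHom z : MvPowerSeries σ ℚ →+ MvPowerSeries σ A) :=
  fun n => ⟨{n}, fun f hf => by rw [tensHom_apply, coeff_tens, hf n (by simp), zero_smul]⟩

end Tens

/-! ### Substitution of rational power series -/

section Subst

variable {σ τ A B : Type*} [Ring A] [Algebra ℚ A] [Ring B] [Algebra ℚ B]

/-- The product `a ^ m` attached to an exponent `m`. -/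
def monomialProd (a : τ → MvPowerSeries σ ℚ) (m : τ →₀ ℕ) : MvPowerSeries σ ℚ :=
  m.prod fun t e => a t ^ e

theorem formallySummable_monomialProd {a : τ → MvPowerSeries σ ℚ} (ha : HasSubst a) :
    FormallySummable (monomialProd a) := fun n => by
  -- The series with all coefficients `1` serves as a test series: finiteness for it concerns every
  -- exponent at once.
  have h := coeff_subst_finite (R := ℚ) ha (fun _ => 1 : MvPowerSeries τ ℚ) n
  refine h.subset fun m hm => ?_
  show coeff m (fun _ => 1 : MvPowerSeries τ ℚ) • coeff n (m.prod fun t e => a t ^ e) ≠ 0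
  have h1 : coeff m (fun _ => 1 : MvPowerSeries τ ℚ) = 1 := rfl
  rw [h1, one_smul]
  exact hm

/-- Substitution of the rational power series `a t` for the variables `t`. -/
def substHom (A : Type*) [Ring A] [Algebra ℚ A] {a : τ → MvPowerSeries σ ℚ} (ha : HasSubst a) :
    MvPowerSeries τ A →+* MvPowerSeries σ A :=
  evalHom (RingHom.id A) (fun m => MvPowerSeries.map (algebraMap ℚ A) (monomialProd a m))
    (fun n => (formallySummable_monomialProd ha n).subset fun m hm h =>
      hm (by rw [coeff_map, h, map_zero]))
    (by rw [monomialProd, Finsupp.prod_zero_index, map_one])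
    (fun m n => by
      classical
      rw [← map_mul]
      congr 1
      exact Finsupp.prod_add_index' (fun _ => pow_zero _) fun _ _ _ => pow_add _ _ _)
    (fun z m => commute_C_map_algebraMap _ _)

variable {a : τ → MvPowerSeries σ ℚ} (ha : HasSubst a)

theorem coeffFinite_substHom : CoeffFinite (substHom A ha) := coeffFinite_evalHom

theorem hasFormalSum_substHom (f : MvPowerSeries τ A) :
    HasFormalSum (fun m => tens (monomialProd a m) (coeff m f)) (substHom A ha f) := by
  have h : HasFormalSum (fun m => MvPowerSeries.map (algebraMap ℚ A) (monomialProd a m) *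
      C (RingHom.id A (coeff m f))) (substHom A ha f) := hasFormalSum_evalHom f
  simpa only [RingHom.id_apply, ← tens_eq] using h

theorem substHom_monomial (m : τ →₀ ℕ) (z : A) :
    substHom A ha (monomial m z) = tens (monomialProd a m) z := by
  rw [tens_eq]
  exact evalHom_monomial m z

theorem tens_X (t : τ) (z : A) : tens (X t : MvPowerSeries τ ℚ) z = monomial (Finsupp.single t 1) z := by
  classical
  refine MvPowerSeries.ext fun m => ?_
  rw [coeff_tens, coeff_X, coeff_monomial]
  split_ifs <;> simp

theorem substHom_tens_X (t : τ) (z : A) : substHom A ha (tens (X t) z) = tens (a t) z := by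
  rw [tens_X, substHom_monomial, monomialProd, Finsupp.prod_single_index (by rw [pow_zero]), pow_one]

theorem substHom_mapCoeffHom (T : A →+ B) (f : MvPowerSeries τ A) :
    substHom B ha (mapCoeffHom T f) = mapCoeffHom T (substHom A ha f) := by
  refine (hasFormalSum_substHom ha (mapCoeffHom T f)).unique ?_
  convert (hasFormalSum_substHom ha f).map (coeffFinite_mapCoeffHom T) using 2 with m
  refine MvPowerSeries.ext fun n => ?_
  rw [coeff_tens, coeff_mapCoeffHom, coeff_mapCoeffHom, coeff_tens, map_rat_smul]

theorem substHom_lieTheta (T : A →+ B) {x : MvPowerSeries τ A} (hx : constantCoeff x = 1) :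
    substHom B ha (lieTheta T x) = lieTheta T (substHom A ha x) := by
  rw [lieTheta, map_expSeries (coeffFinite_substHom ha)
    (constantCoeff_mapCoeffHom (constantCoeff_logSeries hx)), substHom_mapCoeffHom,
    map_logSeries (coeffFinite_substHom ha) hx, lieTheta]

end Subst

/-! ### The maps `T_l` -/

section LimitAlgebra

variable {R : Type*} [Ring R]

/-- `T_l`, as an additive map. -/
def THom (l : ℕ+) : RatRing R →+ LimitAlgebra R :=
  AddMonoidHom.mk' (T l) fun r s => Subtype.ext (by
    show PiTensorProduct.tprod ℚ (Function.update 1 l _) =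
      PiTensorProduct.tprod ℚ (Function.update 1 l _) +
      PiTensorProduct.tprod ℚ (Function.update 1 l _)
    rw [map_add, MultilinearMap.map_update_add])

theorem T_mul_T_of_ne {l k : ℕ+} (h : l ≠ k) (r s : RatRing R) : Commute (T l r) (T k s) :=
  Subtype.ext ((Pi.mulSingle_commute h _ _).tprod)

/-- The map into the enveloping algebra turns the bracket into a commutator, and the inclusion of
the `l`-th slot is additive and multiplicative. -/
theorem preservesCommutator_THom (l : ℕ+) : PreservesCommutator (THom l : RatRing R →+ _) := by
  intro r s
  have hb : r * s - s * r = ⁅r, s⁆ := rfl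
  have key : ∀ u v : Env R, PiTensorProduct.tprod ℚ (Pi.mulSingle (M := fun _ : ℕ+ => Env R) l u) *
      PiTensorProduct.tprod ℚ (Pi.mulSingle l v) = PiTensorProduct.tprod ℚ (Pi.mulSingle l (u * v)) := by
    intro u v
    rw [PiTensorProduct.tprod_mul_tprod, ← Pi.mulSingle_mul]
  refine Subtype.ext ?_
  show PiTensorProduct.tprod ℚ (Pi.mulSingle l _) =
    PiTensorProduct.tprod ℚ (Pi.mulSingle l _) * PiTensorProduct.tprod ℚ (Pi.mulSingle l _) -
    PiTensorProduct.tprod ℚ (Pi.mulSingle l _) * PiTensorProduct.tprod ℚ (Pi.mulSingle l _)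
  have hι : UniversalEnvelopingAlgebra.ι ℚ ⁅r, s⁆ =
      UniversalEnvelopingAlgebra.ι ℚ r * UniversalEnvelopingAlgebra.ι ℚ s -
      UniversalEnvelopingAlgebra.ι ℚ s * UniversalEnvelopingAlgebra.ι ℚ r :=
    letI : LieRing (Env R) := LieRing.ofAssociativeRing
    LieHom.map_lie (UniversalEnvelopingAlgebra.ι ℚ) r s
  rw [key, key, hb, hι]
  show PiTensorProduct.tprod ℚ (Function.update 1 l _) =
      PiTensorProduct.tprod ℚ (Function.update 1 l _) -
      PiTensorProduct.tprod ℚ (Function.update 1 l _)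
  rw [MultilinearMap.map_update_sub]

variable {I : Type*} {σ τ : Type*} (b : Module.Basis I ℤ R)

/-- The series `1 + ∑_U a_U U`. -/
def linSeries (a : I → MvPowerSeries σ ℚ) : MvPowerSeries σ (RatRing R) :=
  1 + formalSum fun U : I => tens (a U) (toRat R (b U))

theorem constantCoeff_linSeries {a : I → MvPowerSeries σ ℚ} (ha : ∀ U, constantCoeff (a U) = 0) :
    constantCoeff (linSeries b a) = 1 := by
  rw [linSeries, map_add, map_one, ← coeff_zero_eq_constantCoeff_apply, coeff_formalSum,
    finsum_eq_zero_of_forall_eq_zero, add_zero]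
  intro U
  rw [coeff_tens, coeff_zero_eq_constantCoeff_apply, ha, zero_smul]

theorem substHom_linSeries_X {a : I × ℕ → MvPowerSeries σ ℚ} (ha : HasSubst a) (k : ℕ) :
    substHom (RatRing R) ha (linSeries b fun U => X (U, k)) = linSeries b fun U => a (U, k) := by
  have hs : FormallySummable fun U : I => (X (U, k) : MvPowerSeries (I × ℕ) ℚ) := by
    classical
    intro n
    refine (n.support.finite_toSet.preimage (f := fun U => (U, k))
      (Prod.mk_left_injective k).injOn).subset fun U hU => ?_
    rw [Set.mem_ofPred_eq, coeff_X] at hU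
    split_ifs at hU with h
    · simp [h]
    · exact absurd rfl hU
  rw [linSeries, map_add, map_one, (coeffFinite_substHom ha).map_formalSum (hs.tens _), linSeries]
  simp only [substHom_tens_X]

/-- The factors of the universal product, in independent variables `(U, k)` standing for the power
sums `p_{k+1}(𝐱_U)`. -/
def universalFactor (k : ℕ) : MvPowerSeries (I × ℕ) (LimitAlgebra R) :=
  lieTheta (THom k.succPNat) (linSeries b fun U => X (U, k))

/-- The factor with index `k` involves only variables `(U, k)`, so it is `1` up to `m` once `k`
exceeds every second index occurring in `m`. -/
theorem exists_universalProd : ∃ P, HasFormalProd (universalFactor b) P := by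
  classical
  refine exists_hasFormalProd fun m => ⟨m.support.sup Prod.snd + 1, fun k hk => ?_⟩
  have h : EqUpTo m (linSeries b fun U => X (U, k)) 1 := by
    have : EqUpTo m (formalSum fun U : I => tens (X (U, k)) (toRat R (b U))) 0 := by
      intro n hn
      rw [coeff_formalSum, map_zero]
      refine finsum_eq_zero_of_forall_eq_zero fun U => ?_
      rw [coeff_tens, coeff_X, if_neg, zero_smul]
      rintro rfl
      have h1 : m (U, k) ≠ 0 := by
        have := hn (U, k)
        rw [Finsupp.single_eq_same] at this
        omega
      have := Finset.le_sup (f := Prod.snd) (Finsupp.mem_support_iff.2 h1)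
      simp only at this
      omega
    simpa [linSeries] using (EqUpTo.refl m 1).add this
  have := h.lieTheta (THom k.succPNat)
  rwa [lieTheta_one] at this

/-- The universal product. -/
def universalProd : MvPowerSeries (I × ℕ) (LimitAlgebra R) := (exists_universalProd b).choose

theorem hasFormalProd_universalProd : HasFormalProd (universalFactor b) (universalProd b) :=
  (exists_universalProd b).choose_spec

theorem hasFormalProd_substHom_universalProd {a : I × ℕ → MvPowerSeries σ ℚ} (ha : HasSubst a) :
    HasFormalProd (fun k => lieTheta (THom k.succPNat) (linSeries b fun U => a (U, k)))
      (substHom (LimitAlgebra R) ha (universalProd b)) := by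
  convert (hasFormalProd_universalProd b).map (coeffFinite_substHom ha) using 2 with k
  rw [universalFactor, substHom_lieTheta ha _ (constantCoeff_linSeries b fun U => constantCoeff_X _),
    substHom_linSeries_X]

end LimitAlgebra

end

section

open Finset.HasAntidiagonal (antidiagonal mem_antidiagonal)


/-! ## Symmetric functions as polynomials in the power sums -/

section Newton

variable {S S' : Type*} [CommRing S] [Algebra ℚ S] [CommRing S'] [Algebra ℚ S']

/-- The complete symmetric functions attached to the power sums `p_{r+1} = p r`. -/
def newtonH (p : ℕ → S) : ℕ → S
  | 0 => 1
  | n + 1 => ((n + 1 : ℕ) : ℚ)⁻¹ • ∑ r : Fin (n + 1), p r * newtonH p (n - r)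
  decreasing_by omega

theorem newtonH_zero (p : ℕ → S) : newtonH p 0 = 1 := by rw [newtonH]

theorem succ_nsmul_newtonH (p : ℕ → S) (n : ℕ) :
    (n + 1) • newtonH p (n + 1) = ∑ q ∈ antidiagonal n, p q.1 * newtonH p q.2 := by
  have h0 : ((n + 1 : ℕ) : ℚ) ≠ 0 := Nat.cast_ne_zero.2 n.succ_ne_zero
  rw [newtonH, ← Nat.cast_smul_eq_nsmul ℚ, smul_smul, mul_inv_cancel₀ h0, one_smul,
    Finset.Nat.sum_antidiagonal_eq_sum_range_succ (fun i j => p i * newtonH p j),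
    ← Fin.sum_univ_eq_sum_range (fun r => p r * newtonH p (n - r))]

/-- Newton's recursion has a unique solution over `ℚ`; evaluations of the complete symmetric
functions are identified by verifying it. -/
theorem eq_newtonH {p g : ℕ → S} (h0 : g 0 = 1)
    (h : ∀ n, (n + 1) • g (n + 1) = ∑ q ∈ antidiagonal n, p q.1 * g q.2) (n : ℕ) :
    g n = newtonH p n := by
  induction n using Nat.strong_induction_on with
  | _ n ih =>
    rcases n with _ | n
    · rw [h0, newtonH_zero]
    · refine succ_nsmul_cancel (k := n) ?_
      rw [h, succ_nsmul_newtonH]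
      refine Finset.sum_congr rfl fun q hq => ?_
      rw [mem_antidiagonal] at hq
      rw [ih q.2 (by omega)]

theorem map_newtonH (φ : S →+* S') (p : ℕ → S) (n : ℕ) :
    φ (newtonH p n) = newtonH (fun r => φ (p r)) n := by
  refine eq_newtonH (g := fun n => φ (newtonH p n)) (by rw [newtonH_zero, map_one])
    (fun n => ?_) n
  rw [← map_nsmul, succ_nsmul_newtonH, map_sum]
  simp only [map_mul]

/-- The generating series satisfies `H' = P H`. By the Leibniz rule the product of the solutions for
`p` and `q` solves the equation for `p + q`. -/
theorem newtonH_add (p q : ℕ → S) (n : ℕ) :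
    newtonH (fun r => p r + q r) n = ∑ i ∈ antidiagonal n, newtonH p i.1 * newtonH q i.2 := by
  have hd : ∀ u : ℕ → S, PowerSeries.derivative S (PowerSeries.mk (newtonH u)) =
      PowerSeries.mk u * PowerSeries.mk (newtonH u) := by
    intro u
    refine PowerSeries.ext fun n => ?_
    rw [PowerSeries.coeff_derivative, PowerSeries.coeff_mk,
      PowerSeries.coeff_mul]
    simp only [PowerSeries.coeff_mk]
    rw [← succ_nsmul_newtonH, nsmul_eq_mul, mul_comm]
    push_cast
    rfl
  set H := PowerSeries.mk (newtonH p) * PowerSeries.mk (newtonH q) with hH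
  have hcoeff : ∀ n, PowerSeries.coeff n H =
      ∑ i ∈ antidiagonal n, newtonH p i.1 * newtonH q i.2 := fun n => by
    rw [hH, PowerSeries.coeff_mul]
    simp only [PowerSeries.coeff_mk]
  have hdH : PowerSeries.derivative S H = PowerSeries.mk (fun r => p r + q r) * H := by
    have : (PowerSeries.mk fun r => p r + q r) = PowerSeries.mk p + PowerSeries.mk q :=
      PowerSeries.ext fun n => by simp
    rw [hH, Derivation.leibniz, hd, hd, this, smul_eq_mul, smul_eq_mul]
    ring
  rw [← hcoeff]
  clear_value H
  refine (eq_newtonH (g := fun n => PowerSeries.coeff n H) ?_ (fun n => ?_) n).symm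
  · simp only [hcoeff, Finset.HasAntidiagonal.antidiagonal_zero, Finset.sum_singleton, newtonH_zero, mul_one]
  · have h := congrArg (PowerSeries.coeff n) hdH
    rw [PowerSeries.coeff_derivative, PowerSeries.coeff_mul] at h
    simp only [PowerSeries.coeff_mk] at h
    rw [← h, nsmul_eq_mul, mul_comm]
    push_cast
    rfl

theorem newtonH_of_eq_zero (n : ℕ) : newtonH (fun _ => (0 : S)) n = if n = 0 then 1 else 0 := by
  refine (eq_newtonH (g := fun n => if n = 0 then (1 : S) else 0) (by simp) (fun n => ?_) n).symm
  simp

theorem sum_newtonH_neg_mul (p : ℕ → S) (n : ℕ) :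
    ∑ i ∈ antidiagonal n, newtonH (fun r => -p r) i.1 * newtonH p i.2 = if n = 0 then 1 else 0 := by
  rw [← newtonH_add, ← newtonH_of_eq_zero (S := S)]
  simp only [neg_add_cancel]

/-- The elementary symmetric functions attached to the power sums `p_{r+1} = p r`. -/
def newtonE (p : ℕ → S) (n : ℕ) : S := (-1) ^ n * newtonH (fun r => -p r) n

end Newton

/-! ### Jacobi–Trudi determinants -/

section JacobiTrudi

variable {S S' : Type*} [CommRing S] [CommRing S']

/-- The determinant `det (h_{μ_i - i + j})`. -/
def jacobiTrudi (h : ℕ → S) (μ : YoungDiagram) : S :=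
  Matrix.det (Matrix.of fun i j : Fin (μ.colLen 0) =>
    if (i : ℕ) ≤ μ.rowLen i + j then h (μ.rowLen i + j - i) else 0)

theorem map_jacobiTrudi (φ : S →+* S') (h : ℕ → S) (μ : YoungDiagram) :
    φ (jacobiTrudi h μ) = jacobiTrudi (fun n => φ (h n)) μ := by
  rw [jacobiTrudi, RingHom.map_det, jacobiTrudi]
  congr 1
  ext i j
  simp only [RingHom.mapMatrix_apply, Matrix.map_apply, Matrix.of_apply]
  split_ifs
  · rfl
  · exact map_zero φ

theorem jacobiTrudi_eq_sum (h : ℕ → S) (μ : YoungDiagram) :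
    jacobiTrudi h μ = ∑ τ : Equiv.Perm (Fin (μ.colLen 0)), (Equiv.Perm.sign τ : ℤ) •
      ∏ i : Fin (μ.colLen 0), if (i : ℕ) ≤ μ.rowLen i + τ i then h (μ.rowLen i + τ i - i) else 0 := by
  -- Transposing makes the permutation act on the column index, so each row length stays attached to
  -- its own row.
  rw [jacobiTrudi, ← Matrix.det_transpose, Matrix.det_apply]
  rfl

theorem colLen_bot (j : ℕ) : (⊥ : YoungDiagram).colLen j = 0 := by
  rw [YoungDiagram.colLen_eq_card, Finset.card_eq_zero, Finset.eq_empty_iff_forall_notMem]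
  intro c hc
  exact YoungDiagram.notMem_bot c (YoungDiagram.mem_col_iff.1 hc).1

theorem jacobiTrudi_bot (h : ℕ → S) : jacobiTrudi h ⊥ = 1 := by
  have : IsEmpty (Fin ((⊥ : YoungDiagram).colLen 0)) := by
    rw [colLen_bot]
    infer_instance
  exact Matrix.det_isEmpty

theorem card_eq_sum_rowLen (μ : YoungDiagram) : μ.card = ∑ i : Fin (μ.colLen 0), μ.rowLen i := by
  rw [Fin.sum_univ_eq_sum_range (fun i => μ.rowLen i)]
  have : ∀ c ∈ μ.cells, c.1 ∈ Finset.range (μ.colLen 0) := by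
    intro c hc
    rw [Finset.mem_range, ← YoungDiagram.mem_iff_lt_colLen]
    exact μ.up_left_mem le_rfl (Nat.zero_le _) ((YoungDiagram.mem_cells _).1 hc)
  rw [YoungDiagram.card, Finset.card_eq_sum_card_fiberwise this]
  refine Finset.sum_congr rfl fun i _ => ?_
  rw [YoungDiagram.rowLen_eq_card]
  rfl

/-- The multiset of row lengths. -/
def rowMultiset (μ : YoungDiagram) : Multiset ℕ :=
  (Finset.univ : Finset (Fin (μ.colLen 0))).val.map fun i : Fin (μ.colLen 0) => μ.rowLen i

theorem exists_rowMultiset_eq {α : Multiset ℕ} (h : ∀ x ∈ α, 0 < x) :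
    ∃ μ : YoungDiagram, rowMultiset μ = α := by
  have hs : (α.sort (· ≥ ·)).SortedGE := (α.pairwise_sort (· ≥ ·)).sortedGE
  have hpos : ∀ x ∈ α.sort (· ≥ ·), 0 < x := fun x hx => h x ((Multiset.mem_sort _).1 hx)
  refine ⟨YoungDiagram.ofRowLens _ hs, ?_⟩
  have h1 := YoungDiagram.rowLens_ofRowLens_eq_self (hw := hs) hpos
  have h2 : ∀ μ : YoungDiagram, rowMultiset μ = (μ.rowLens : Multiset ℕ) := by
    intro μ
    have : (Multiset.range (μ.colLen 0)) = (Finset.univ : Finset (Fin (μ.colLen 0))).val.map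
        (fun i : Fin (μ.colLen 0) => (i : ℕ)) := by
      have := Fin.map_valEmbedding_univ (n := μ.colLen 0)
      have h3 := congrArg Finset.val this
      rw [Finset.map_val] at h3
      exact (h3.trans (by rw [Nat.Iio_eq_range, Finset.range_val])).symm
    rw [YoungDiagram.rowLens, ← Multiset.map_coe, ← Multiset.range, this, Multiset.map_map]
    rfl
  rw [h2, h1, Multiset.sort_eq]

/-- The span of the products of `h`'s of total degree `n`. -/
def hSpan (h : ℕ → S) (n : ℕ) : Submodule ℤ S :=
  Submodule.span ℤ {x | ∃ α : Multiset ℕ, α.sum = n ∧ (α.map h).prod = x}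

/-- The span of the Jacobi–Trudi determinants of degree `n`. -/
def jtSpan (h : ℕ → S) (n : ℕ) : Submodule ℤ S :=
  Submodule.span ℤ {x | ∃ μ : YoungDiagram, μ.card = n ∧ jacobiTrudi h μ = x}

theorem prod_map_mem_hSpan (h : ℕ → S) (α : Multiset ℕ) : (α.map h).prod ∈ hSpan h α.sum :=
  Submodule.subset_span ⟨α, rfl, rfl⟩

theorem mem_hSpan_self (h : ℕ → S) (n : ℕ) : h n ∈ hSpan h n := by
  simpa using prod_map_mem_hSpan h {n}

theorem one_mem_hSpan (h : ℕ → S) : (1 : S) ∈ hSpan h 0 := by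
  simpa using prod_map_mem_hSpan h 0

theorem mul_mem_hSpan {h : ℕ → S} {m n : ℕ} {x y : S} (hx : x ∈ hSpan h m) (hy : y ∈ hSpan h n) :
    x * y ∈ hSpan h (m + n) := by
  have : hSpan h m * hSpan h n ≤ hSpan h (m + n) := by
    rw [hSpan, hSpan, Submodule.span_mul_span, Submodule.span_le]
    rintro _ ⟨_, ⟨α, rfl, rfl⟩, _, ⟨β, rfl, rfl⟩, rfl⟩
    have := prod_map_mem_hSpan h (α + β)
    rwa [Multiset.map_add, Multiset.prod_add, Multiset.sum_add] at this
  exact this (Submodule.mul_mem_mul hx hy)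

theorem prod_mem_hSpan {ι : Type*} {h : ℕ → S} (s : Finset ι) {g : ι → S} {d : ι → ℕ}
    (hg : ∀ i ∈ s, g i ∈ hSpan h (d i)) : ∏ i ∈ s, g i ∈ hSpan h (∑ i ∈ s, d i) := by
  classical
  induction s using Finset.induction_on with
  | empty => simpa using one_mem_hSpan h
  | insert a s ha ih =>
    rw [Finset.prod_insert ha, Finset.sum_insert ha]
    exact mul_mem_hSpan (hg a (Finset.mem_insert_self a s))
      (ih fun i hi => hg i (Finset.mem_insert_of_mem hi))

/-- A permutation does not change the sum of the indices, so every nonzero term of the determinant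
has degree `|μ|`. -/
theorem sum_shift {μ : YoungDiagram} {τ : Equiv.Perm (Fin (μ.colLen 0))}
    (hτ : ∀ i : Fin (μ.colLen 0), (i : ℕ) ≤ μ.rowLen i + τ i) : ∑ i : Fin (μ.colLen 0), (μ.rowLen i + τ i - i) = μ.card := by
  have h : ∑ i : Fin (μ.colLen 0), (μ.rowLen i + τ i - i) + ∑ i : Fin (μ.colLen 0), (i : ℕ) =
      μ.card + ∑ i : Fin (μ.colLen 0), (i : ℕ) := by
    rw [← Finset.sum_add_distrib, card_eq_sum_rowLen]
    simp only [Nat.sub_add_cancel (hτ _)]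
    rw [Finset.sum_add_distrib, Equiv.sum_comp τ fun i : Fin (μ.colLen 0) => (i : ℕ)]
  omega

theorem jacobiTrudi_mem_hSpan (h : ℕ → S) (μ : YoungDiagram) : jacobiTrudi h μ ∈ hSpan h μ.card := by
  rw [jacobiTrudi_eq_sum]
  refine Submodule.sum_mem _ fun τ _ => Submodule.smul_mem _ _ ?_
  by_cases hτ : ∀ i : Fin (μ.colLen 0), (i : ℕ) ≤ μ.rowLen i + τ i
  · simp only [hτ, if_true]
    rw [← sum_shift hτ]
    exact prod_mem_hSpan _ fun i _ => mem_hSpan_self h _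
  · push Not at hτ
    obtain ⟨i, hi⟩ := hτ
    rw [Finset.prod_eq_zero (Finset.mem_univ i) (if_neg (by omega))]
    exact Submodule.zero_mem _

/-- This is the rearrangement inequality. With `f i = μ_i - i` strictly decreasing and `g i = i`
increasing, the squares of `f + g ∘ τ` differ from those of `f + g` in total only through the cross
term, which is smallest for the identity. -/
theorem sum_sq_lt_of_ne_one {μ : YoungDiagram} {τ : Equiv.Perm (Fin (μ.colLen 0))}
    (hτ : ∀ i : Fin (μ.colLen 0), (i : ℕ) ≤ μ.rowLen i + τ i) (h1 : τ ≠ 1) :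
    ∑ i : Fin (μ.colLen 0), μ.rowLen i ^ 2 < ∑ i : Fin (μ.colLen 0), (μ.rowLen i + τ i - i) ^ 2 := by
  set f : Fin (μ.colLen 0) → ℤ := fun i => (μ.rowLen i : ℤ) - i with hf
  set g : Fin (μ.colLen 0) → ℤ := fun i => (i : ℤ) with hg
  have hanti : ∀ i j, i < j → f j < f i := by
    intro i j hij
    have := μ.rowLen_anti i j hij.le
    have : (i : ℕ) < j := hij
    simp only [hf]
    omega
  have hfg : Antivary f g := by
    intro i j hij
    exact (hanti i j (by simpa [hg] using hij)).le
  have hlt : ∑ i, f i * g i < ∑ i, f i * g (τ i) := by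
    refine lt_of_le_of_ne (by simpa using hfg.sum_smul_le_sum_smul_comp_perm (σ := τ)) fun he => h1 ?_
    -- Equality makes `f` and `g ∘ τ` oppositely ordered; as `f` is strictly decreasing, `τ` is
    -- increasing and hence the identity.
    have hanti' := (hfg.sum_smul_comp_perm_eq_sum_smul_iff (σ := τ)).1 (by simpa using he.symm)
    have hmono : StrictMono τ := by
      intro i j hij
      refine lt_of_le_of_ne (not_lt.1 fun hlt => ?_) (τ.injective.ne hij.ne)
      have := hanti' (i := j) (j := i) (by simpa [hg] using hlt)
      exact absurd (hanti i j hij) (not_lt.2 this)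
    have := (StrictMono.range_inj hmono strictMono_id).1 (by
      rw [τ.surjective.range_eq, Set.range_id])
    exact Equiv.ext fun i => congrFun this i
  have hsq : ∑ i, g (τ i) ^ 2 = ∑ i, g i ^ 2 := Equiv.sum_comp τ fun i => g i ^ 2
  have key : ∀ ρ : Equiv.Perm (Fin (μ.colLen 0)), ∑ i, (f i + g (ρ i)) ^ 2 =
      ∑ i, f i ^ 2 + 2 * ∑ i, f i * g (ρ i) + ∑ i, g (ρ i) ^ 2 := by
    intro ρ
    rw [Finset.mul_sum, ← Finset.sum_add_distrib, ← Finset.sum_add_distrib]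
    exact Finset.sum_congr rfl fun i _ => by ring
  have e1 : ((∑ i : Fin (μ.colLen 0), μ.rowLen i ^ 2 : ℕ) : ℤ) = ∑ i, (f i + g i) ^ 2 := by
    push_cast
    exact Finset.sum_congr rfl fun i _ => by simp [hf, hg]
  have e2 : ((∑ i : Fin (μ.colLen 0), (μ.rowLen i + τ i - i) ^ 2 : ℕ) : ℤ) = ∑ i, (f i + g (τ i)) ^ 2 := by
    push_cast
    refine Finset.sum_congr rfl fun i _ => ?_
    rw [Nat.cast_sub (hτ i)]
    simp only [hf, hg]
    push_cast
    ring
  have k1 := key 1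
  have k2 := key τ
  simp only [Equiv.Perm.coe_one, id_eq] at k1
  zify
  zify at e1 e2
  linarith

theorem sum_map_sq_le (α : Multiset ℕ) : (α.map (· ^ 2)).sum ≤ α.sum ^ 2 := by
  induction α using Multiset.induction_on with
  | empty => simp
  | cons a α ih =>
    rw [Multiset.map_cons, Multiset.sum_cons, Multiset.sum_cons]
    nlinarith [Nat.zero_le (a * α.sum)]

/-- Zero parts contribute `u 0 = 1` and can be dropped. The target is a general commutative monoid
so that sums are covered too, through `Multiplicative ℕ`. -/
theorem prod_map_eq_prod_rowLen {α : Multiset ℕ} {μ : YoungDiagram}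
    (hμ : rowMultiset μ = α.filter (0 < ·)) {M : Type*} [CommMonoid M] (u : ℕ → M) (hu : u 0 = 1) :
    (α.map u).prod = ∏ i : Fin (μ.colLen 0), u (μ.rowLen i) := by
  have h2 : ((α.filter (0 < ·)).map u).prod = ∏ i : Fin (μ.colLen 0), u (μ.rowLen i) := by
    rw [← hμ, rowMultiset, Multiset.map_map]
    rfl
  have h3 : ((α.filter fun x => ¬ 0 < x).map u).prod = 1 := by
    refine Multiset.prod_eq_one fun x hx => ?_
    obtain ⟨y, hy, rfl⟩ := Multiset.mem_map.1 hx
    have := (Multiset.mem_filter.1 hy).2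
    rw [show y = 0 by omega, hu]
  conv_lhs => rw [← Multiset.filter_add_not (0 < ·) α]
  rw [Multiset.map_add, Multiset.prod_add, h2, h3, mul_one]

/-- Unitriangularity of the Jacobi–Trudi determinants. -/
theorem hSpan_le_jtSpan {h : ℕ → S} (h0 : h 0 = 1) (n : ℕ) : hSpan h n ≤ jtSpan h n := by
  -- Induction on `n ^ 2 - ∑ α_i ^ 2`: the identity term of the determinant of `μ` is the product
  -- over `α`, and every other nonzero term has a larger sum of squares. The bound `∑ α_i ^ 2 ≤ n ^
  -- 2` makes the natural subtraction decrease strictly.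
  have key : ∀ k, ∀ α : Multiset ℕ, α.sum = n → n ^ 2 - (α.map (· ^ 2)).sum = k →
      (α.map h).prod ∈ jtSpan h n := by
    intro k
    induction k using Nat.strong_induction_on with
    | _ k ih =>
      intro α hα hk
      obtain ⟨μ, hμ⟩ := exists_rowMultiset_eq (α := α.filter (0 < ·))
        fun x hx => (Multiset.mem_filter.1 hx).2
      have hcard : μ.card = n := by
        rw [card_eq_sum_rowLen, ← hα]
        have := prod_map_eq_prod_rowLen hμ (M := Multiplicative ℕ) Multiplicative.ofAdd rfl
        simpa using (congrArg Multiplicative.toAdd this).symm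
      have hsq : (α.map (· ^ 2)).sum = ∑ i : Fin (μ.colLen 0), μ.rowLen i ^ 2 := by
        have := prod_map_eq_prod_rowLen hμ (M := Multiplicative ℕ) (fun n => Multiplicative.ofAdd (n ^ 2)) rfl
        simpa using (congrArg Multiplicative.toAdd this)
      have hjt : jacobiTrudi h μ ∈ jtSpan h n := Submodule.subset_span ⟨μ, hcard, rfl⟩
      rw [jacobiTrudi_eq_sum, ← Finset.add_sum_erase _ _ (Finset.mem_univ 1)] at hjt
      have hrest : ∑ τ ∈ Finset.univ.erase (1 : Equiv.Perm (Fin (μ.colLen 0))),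
          (Equiv.Perm.sign τ : ℤ) • (∏ i : Fin (μ.colLen 0), if (i : ℕ) ≤ μ.rowLen i + τ i
            then h (μ.rowLen i + τ i - i) else 0) ∈ jtSpan h n := by
        refine Submodule.sum_mem _ fun τ hτ1 => Submodule.smul_mem _ _ ?_
        by_cases hτ : ∀ i : Fin (μ.colLen 0), (i : ℕ) ≤ μ.rowLen i + τ i
        · simp only [hτ, if_true]
          set β : Multiset ℕ := Finset.univ.val.map fun i : Fin (μ.colLen 0) => μ.rowLen i + τ i - i with hβ
          have hβs : β.sum = n := (sum_shift hτ).trans hcard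
          have hβq : (β.map (· ^ 2)).sum = ∑ i : Fin (μ.colLen 0), (μ.rowLen i + τ i - i) ^ 2 := by
            rw [hβ, Multiset.map_map]
            rfl
          have hlt := sum_sq_lt_of_ne_one hτ (Finset.ne_of_mem_erase hτ1)
          have hle := sum_map_sq_le β
          rw [hβs] at hle
          have := ih (n ^ 2 - (β.map (· ^ 2)).sum) (by omega) β hβs rfl
          rw [hβ, Multiset.map_map] at this
          exact this
        · push Not at hτ
          obtain ⟨i, hi⟩ := hτ
          rw [Finset.prod_eq_zero (Finset.mem_univ i) (if_neg (by omega))]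
          exact Submodule.zero_mem _
      have hfirst := (Submodule.add_mem_iff_left _ hrest).1 hjt
      simpa [prod_map_eq_prod_rowLen hμ h h0] using hfirst
  rw [hSpan, Submodule.span_le]
  rintro _ ⟨α, hα, rfl⟩
  exact key _ α hα rfl

end JacobiTrudi

/-! ### Integrality of power sums and elementary functions over complete ones -/

section NewtonSpan

variable {S : Type*} [CommRing S] [Algebra ℚ S]

/-- Newton's recursion contains the top power sum with coefficient `h_0 = 1` and can be solved for
it without division. -/
theorem powerSum_mem_hSpan (p : ℕ → S) (n : ℕ) : p n ∈ hSpan (newtonH p) (n + 1) := by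
  induction n using Nat.strong_induction_on with
  | _ n ih =>
    have h := succ_nsmul_newtonH p n
    rw [← Finset.add_sum_erase _ _ (show (n, 0) ∈ antidiagonal n by simp), newtonH_zero,
      mul_one] at h
    have hrest : ∑ q ∈ (antidiagonal n).erase (n, 0), p q.1 * newtonH p q.2 ∈
        hSpan (newtonH p) (n + 1) := by
      refine Submodule.sum_mem _ fun q hq => ?_
      rw [Finset.mem_erase, mem_antidiagonal] at hq
      have hlt : q.1 < n := by
        by_contra hlt
        exact hq.1 (Prod.ext (by omega) (by omega))
      have := mul_mem_hSpan (ih q.1 hlt) (mem_hSpan_self (newtonH p) q.2)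
      rwa [show q.1 + 1 + q.2 = n + 1 by omega] at this
    refine (Submodule.add_mem_iff_left _ hrest).1 ?_
    rw [← h]
    exact Submodule.smul_of_tower_mem _ _ (mem_hSpan_self _ _)

/-- The relation between the series of `p` and `-p`, whose product is `1`, is solved for its top
term in the same way. -/
theorem newtonE_mem_hSpan (p : ℕ → S) (n : ℕ) : newtonE p n ∈ hSpan (newtonH p) n := by
  have key : newtonH (fun r => -p r) n ∈ hSpan (newtonH p) n := by
    induction n using Nat.strong_induction_on with
    | _ n ih =>
      have h := sum_newtonH_neg_mul p n
      rw [← Finset.add_sum_erase _ _ (show (n, 0) ∈ antidiagonal n by simp), newtonH_zero,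
        mul_one] at h
      have hrest : ∑ q ∈ (antidiagonal n).erase (n, 0), newtonH (fun r => -p r) q.1 *
          newtonH p q.2 ∈ hSpan (newtonH p) n := by
        refine Submodule.sum_mem _ fun q hq => ?_
        rw [Finset.mem_erase, mem_antidiagonal] at hq
        have hlt : q.1 < n := by
          by_contra hlt
          exact hq.1 (Prod.ext (by omega) (by omega))
        have := mul_mem_hSpan (ih q.1 hlt) (mem_hSpan_self (newtonH p) q.2)
        rwa [hq.2] at this
      refine (Submodule.add_mem_iff_left _ hrest).1 ?_
      rw [h]
      split_ifs with hn
      · rw [hn]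
        exact one_mem_hSpan _
      · exact Submodule.zero_mem _
  have : newtonE p n = ((-1) ^ n : ℤ) • newtonH (fun r => -p r) n := by
    rw [newtonE, zsmul_eq_mul]
    push_cast
    rfl
  rw [this]
  exact Submodule.smul_mem _ _ key

end NewtonSpan

end

section

open Finset.HasAntidiagonal (antidiagonal mem_antidiagonal)


/-! ### Multipartitions -/

section MultiPartition

variable {J : Type*}

theorem MultiPartition.ext_part {lam mu : MultiPartition J} (h : lam.part = mu.part) : lam = mu := by
  cases lam
  cases mu
  cases h
  rfl

/-- The indices with nonempty partition. -/
def MultiPartition.supp (lam : MultiPartition J) : Finset J := lam.finite_support.toFinset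

theorem MultiPartition.mem_supp {lam : MultiPartition J} {U : J} :
    U ∈ lam.supp ↔ lam.part U ≠ ⊥ := Set.Finite.mem_toFinset _

theorem card_bot : (⊥ : YoungDiagram).card = 0 := rfl

/-- The multidegree `U ↦ |λ(U)|`. -/
def MultiPartition.mdeg (lam : MultiPartition J) : J →₀ ℕ :=
  Finsupp.onFinset lam.supp (fun U => (lam.part U).card) fun U hU => by
    rw [MultiPartition.mem_supp]
    rintro h
    exact hU (by rw [h, card_bot])

theorem MultiPartition.mdeg_apply (lam : MultiPartition J) (U : J) :
    lam.mdeg U = (lam.part U).card := rfl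

theorem rowLen_le_card (μ : YoungDiagram) (i : ℕ) : μ.rowLen i ≤ μ.card := by
  rw [YoungDiagram.rowLen_eq_card]
  exact Finset.card_le_card (Finset.filter_subset _ _)

theorem lt_card_of_rowLen_ne_zero {μ : YoungDiagram} {i : ℕ} (h : μ.rowLen i ≠ 0) : i < μ.card := by
  have h1 : (i, 0) ∈ μ := YoungDiagram.mem_iff_lt_rowLen.2 (Nat.pos_of_ne_zero h)
  have h2 : μ.colLen 0 ≤ μ.card := by
    rw [YoungDiagram.colLen_eq_card]
    exact Finset.card_le_card (Finset.filter_subset _ _)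
  exact lt_of_lt_of_le (YoungDiagram.mem_iff_lt_colLen.1 h1) h2

/-- The exponent `x^λ`: the variable `(U, i)` has exponent `λ(U)_i`. -/
def MultiPartition.expo (lam : MultiPartition J) : J × ℕ →₀ ℕ :=
  Finsupp.onFinset (lam.supp ×ˢ Finset.range (lam.supp.sup fun U => (lam.part U).card))
    (fun t => (lam.part t.1).rowLen t.2) fun t ht => by
      have h1 := lt_card_of_rowLen_ne_zero ht
      have h2 : t.1 ∈ lam.supp := by
        rw [MultiPartition.mem_supp]
        intro h
        rw [h, card_bot] at h1
        exact absurd h1 (Nat.not_lt_zero _)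
      rw [Finset.mem_product, Finset.mem_range]
      exact ⟨h2, h1.trans_le (Finset.le_sup (f := fun U => (lam.part U).card) h2)⟩

theorem MultiPartition.expo_apply (lam : MultiPartition J) (t : J × ℕ) :
    lam.expo t = (lam.part t.1).rowLen t.2 := rfl

theorem youngDiagram_ext_rowLen {μ ν : YoungDiagram} (h : ∀ i, μ.rowLen i = ν.rowLen i) : μ = ν := by
  refine SetLike.ext fun c => ?_
  obtain ⟨i, j⟩ := c
  rw [YoungDiagram.mem_iff_lt_rowLen, YoungDiagram.mem_iff_lt_rowLen, h]

theorem MultiPartition.expo_injective :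
    Function.Injective (MultiPartition.expo : MultiPartition J → J × ℕ →₀ ℕ) := by
  intro lam mu h
  refine MultiPartition.ext_part (funext fun U => youngDiagram_ext_rowLen fun i => ?_)
  exact DFunLike.congr_fun h (U, i)

/-- All these exponents lie below a single finitely supported one. Both finiteness statements below,
for multipartitions and for monomials in power sums, embed into this box. -/
theorem finite_bounded_exponents (d : J →₀ ℕ) :
    {m : J × ℕ →₀ ℕ | ∀ U i, m (U, i) ≤ d U ∧ (m (U, i) ≠ 0 → i < d U)}.Finite := by
  classical
  set M : J × ℕ →₀ ℕ := Finsupp.onFinset (d.support ×ˢ Finset.range (d.support.sup d))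
    (fun t => if t.2 < d t.1 then d t.1 else 0) (fun t ht => by
      rw [ne_eq, ite_eq_right_iff, Classical.not_imp] at ht
      rw [Finset.mem_product, Finset.mem_range]
      have h2 := Finsupp.mem_support_iff.2 ht.2
      exact ⟨h2, ht.1.trans_le (Finset.le_sup h2)⟩) with hM
  refine (Set.finite_Iic M).subset fun m hm => ?_
  rw [Set.mem_Iic]
  intro t
  have h := hm t.1 t.2
  show m t ≤ if t.2 < d t.1 then d t.1 else 0
  split_ifs with ht
  · exact h.1
  · exact (not_imp_comm.1 h.2 ht).le

theorem finite_mdeg_eq (d : J →₀ ℕ) : {lam : MultiPartition J | lam.mdeg = d}.Finite := by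
  refine Set.Finite.of_finite_image ((finite_bounded_exponents d).subset ?_)
    MultiPartition.expo_injective.injOn
  rintro _ ⟨lam, rfl, rfl⟩ U i
  exact ⟨rowLen_le_card _ _, fun h => lt_card_of_rowLen_ne_zero h⟩

/-- The multidegree of the variable `(U, k)` standing for `p_{k+1}(𝐱_U)`. -/
def pWeight (t : J × ℕ) : J →₀ ℕ := Finsupp.single t.1 (t.2 + 1)

theorem finite_weight_eq (d : J →₀ ℕ) :
    {m : J × ℕ →₀ ℕ | Finsupp.weight pWeight m = d}.Finite := by
  refine (finite_bounded_exponents d).subset ?_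
  rintro m rfl U i
  by_cases hm : m (U, i) = 0
  · simp [hm]
  · have h1 : m (U, i) • pWeight (U, i) ≤ Finsupp.weight pWeight m := by
      rw [Finsupp.weight_apply]
      exact Finset.single_le_sum (f := fun t => m t • pWeight t) (fun _ _ => zero_le)
        (Finsupp.mem_support_iff.2 hm)
    have h2 := h1 U
    rw [Finsupp.smul_apply, pWeight, Finsupp.single_eq_same, smul_eq_mul] at h2
    have h3 : 1 ≤ m (U, i) := Nat.one_le_iff_ne_zero.2 hm
    rw [show ((U, i).2 : ℕ) = i from rfl] at h2
    exact ⟨by nlinarith, fun _ => by nlinarith⟩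

end MultiPartition

/-! ### Schur polynomials in the power sums -/

section SchurPoly

open MvPolynomial

variable {J : Type*}

/-- The complete symmetric functions in the power sums `(U, k)`. -/
def hVar (U : J) : ℕ → MvPolynomial (J × ℕ) ℚ := newtonH fun k => X (U, k)

/-- The product of Schur functions attached to a multipartition, as a polynomial in the power
sums. -/
def schurPoly (lam : MultiPartition J) : MvPolynomial (J × ℕ) ℚ :=
  ∏ U ∈ lam.supp, jacobiTrudi (hVar U) (lam.part U)

theorem schurPoly_eq_prod {lam : MultiPartition J} {s : Finset J} (hs : lam.supp ⊆ s) :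
    schurPoly lam = ∏ U ∈ s, jacobiTrudi (hVar U) (lam.part U) := by
  refine Finset.prod_subset hs fun U _ hU => ?_
  rw [MultiPartition.mem_supp, not_not] at hU
  rw [hU, jacobiTrudi_bot]

/-- The integral span of the Schur polynomials of multidegree `d`. -/
def schurSpan (d : J →₀ ℕ) : Submodule ℤ (MvPolynomial (J × ℕ) ℚ) :=
  Submodule.span ℤ (schurPoly '' {lam | lam.mdeg = d})

/-- Each factor is an integral combination of Jacobi–Trudi determinants, and a product of spans is
the span of the products. A choice of one diagram for each `U ∈ s` is a multipartition; `hs` ensures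
that `d` is zero where the diagram is set to be empty. -/
theorem prod_mem_schurSpan {d : J →₀ ℕ} {s : Finset J} (hs : d.support ⊆ s)
    {g : J → MvPolynomial (J × ℕ) ℚ} (hg : ∀ U ∈ s, g U ∈ hSpan (hVar U) (d U)) :
    ∏ U ∈ s, g U ∈ schurSpan d := by
  classical
  have h1 : ∏ U ∈ s, g U ∈ ∏ U ∈ s, jtSpan (hVar U) (d U) := by
    have : ∀ t ⊆ s, ∏ U ∈ t, g U ∈ ∏ U ∈ t, jtSpan (hVar U) (d U) := by
      intro t
      induction t using Finset.induction_on with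
      | empty => intro _; simp [Submodule.one_le.1]
      | insert a t ha ih =>
        intro ht
        rw [Finset.prod_insert ha, Finset.prod_insert ha]
        exact Submodule.mul_mem_mul (hSpan_le_jtSpan (newtonH_zero _) _
          (hg a (ht (Finset.mem_insert_self a t))))
          (ih ((Finset.subset_insert a t).trans ht))
    exact this s subset_rfl
  simp only [jtSpan] at h1
  rw [Submodule.prod_span] at h1
  refine Submodule.span_le.2 ?_ h1
  intro x hx
  obtain ⟨f, hf, rfl⟩ := (Set.mem_finsetProd _ _ _).1 hx
  have hf' : ∀ U, U ∈ s → ∃ μ : YoungDiagram, μ.card = d U ∧ jacobiTrudi (hVar U) μ = f U :=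
    fun U hU => hf hU
  choose! μ hμ hμ' using hf'
  set lam : MultiPartition J := ⟨fun U => if U ∈ s then μ U else ⊥,
    s.finite_toSet.subset fun U hU => by
      by_contra h
      exact hU (if_neg h)⟩ with hlam
  have hsub : lam.supp ⊆ s := fun U hU => by
    rw [MultiPartition.mem_supp] at hU
    by_contra h
    exact hU (if_neg h)
  refine Submodule.subset_span ⟨lam, ?_, ?_⟩
  · refine Finsupp.ext fun U => ?_
    rw [MultiPartition.mdeg_apply]
    show YoungDiagram.card (if U ∈ s then μ U else ⊥) = d U
    split_ifs with h
    · exact hμ U h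
    · rw [card_bot]
      exact (Finsupp.notMem_support_iff.1 fun h' => h (hs h')).symm
  · rw [schurPoly_eq_prod hsub]
    refine Finset.prod_congr rfl fun U hU => ?_
    rw [← hμ' U hU]
    show jacobiTrudi _ (if U ∈ s then μ U else ⊥) = _
    rw [if_pos hU]

/-- The product is regrouped index by index, and there only closure of the `h`-span under
multiplication is needed; no explicit Littlewood–Richardson rule enters. -/
theorem mul_mem_schurSpan {d e : J →₀ ℕ} {x y : MvPolynomial (J × ℕ) ℚ} (hx : x ∈ schurSpan d)
    (hy : y ∈ schurSpan e) : x * y ∈ schurSpan (d + e) := by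
  classical
  have : schurSpan d * schurSpan e ≤ schurSpan (d + e) := by
    rw [schurSpan, schurSpan, Submodule.span_mul_span, Submodule.span_le]
    rintro _ ⟨_, ⟨lam, rfl, rfl⟩, _, ⟨mu, rfl, rfl⟩, rfl⟩
    show schurPoly lam * schurPoly mu ∈ _
    rw [schurPoly_eq_prod (s := lam.supp ∪ mu.supp) Finset.subset_union_left,
      schurPoly_eq_prod (s := lam.supp ∪ mu.supp) Finset.subset_union_right,
      ← Finset.prod_mul_distrib]
    refine prod_mem_schurSpan (fun U hU => ?_) fun U _ => ?_
    · rw [Finset.mem_union, MultiPartition.mem_supp, MultiPartition.mem_supp]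
      by_contra h
      rw [not_or, not_not, not_not] at h
      refine Finsupp.mem_support_iff.1 hU ?_
      rw [Finsupp.add_apply, MultiPartition.mdeg_apply, MultiPartition.mdeg_apply, h.1, h.2,
        card_bot, add_zero]
    · exact mul_mem_hSpan (jacobiTrudi_mem_hSpan _ _) (jacobiTrudi_mem_hSpan _ _)
  exact this (Submodule.mul_mem_mul hx hy)

theorem mem_schurSpan_single {U : J} {n : ℕ} {x : MvPolynomial (J × ℕ) ℚ}
    (hx : x ∈ hSpan (hVar U) n) : x ∈ schurSpan (Finsupp.single U n) := by
  have := prod_mem_schurSpan (d := Finsupp.single U n) (s := {U}) (g := fun _ => x)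
    Finsupp.support_single_subset (fun V hV => by
      rw [Finset.mem_singleton] at hV
      subst hV
      simpa using hx)
  simpa using this

theorem one_mem_schurSpan : (1 : MvPolynomial (J × ℕ) ℚ) ∈ schurSpan 0 := by
  simpa using prod_mem_schurSpan (d := (0 : J →₀ ℕ)) (s := ∅) (g := fun _ => 1) (by simp) (by simp)

/-- This lets power series in the power sums be rewritten in Schur functions. The preserved
multidegree leaves finitely many power-sum monomials for each Schur function. -/
theorem monomial_mem_schurSpan (ρ : J × ℕ →₀ ℕ) :
    monomial ρ (1 : ℚ) ∈ schurSpan (Finsupp.weight pWeight ρ) := by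
  classical
  have hX : ∀ t : J × ℕ, ∀ n : ℕ, monomial (Finsupp.single t n) (1 : ℚ) ∈
      schurSpan (n • pWeight t) := by
    intro t n
    induction n with
    | zero => simpa using one_mem_schurSpan
    | succ n ih =>
      have := mul_mem_schurSpan ih (mem_schurSpan_single (powerSum_mem_hSpan
        (fun k => (X (t.1, k) : MvPolynomial (J × ℕ) ℚ)) t.2))
      rwa [X, monomial_mul, ← Finsupp.single_add, mul_one, ← pWeight, ← succ_nsmul] at this
  induction ρ using Finsupp.induction with
  | zero => simpa using one_mem_schurSpan
  | single_add t n ρ _ _ ih =>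
    have := mul_mem_schurSpan (hX t n) ih
    rwa [monomial_mul, mul_one, ← Finsupp.weight_single, ← map_add] at this

theorem exists_schurPoly_expansion {d : J →₀ ℕ} {x : MvPolynomial (J × ℕ) ℚ}
    (hx : x ∈ schurSpan d) : ∃ c : MultiPartition J →₀ ℤ, (∀ lam, c lam ≠ 0 → lam.mdeg = d) ∧
      x = c.sum fun lam z => z • schurPoly lam := by
  rw [schurSpan, Finsupp.mem_span_image_iff_linearCombination] at hx
  obtain ⟨c, hc, rfl⟩ := hx
  refine ⟨c, fun lam h => ?_, Finsupp.linearCombination_apply _ _⟩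
  exact (Finsupp.mem_supported _ _).1 hc (Finsupp.mem_support_iff.2 h)

theorem isWeightedHomogeneous_hVar (U : J) (n : ℕ) :
    IsWeightedHomogeneous pWeight (hVar U n) (Finsupp.single U n) := by
  induction n using Nat.strong_induction_on with
  | _ n ih =>
    rcases n with _ | n
    · rw [hVar, newtonH_zero, Finsupp.single_zero]
      exact isWeightedHomogeneous_one _ _
    · rw [hVar, newtonH, ← mem_weightedHomogeneousSubmodule]
      refine Submodule.smul_mem _ _ (Submodule.sum_mem _ fun r _ => ?_)
      rw [mem_weightedHomogeneousSubmodule]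
      have h := (isWeightedHomogeneous_X ℚ pWeight (U, (r : ℕ))).mul (ih (n - r) (by omega))
      rw [pWeight, ← Finsupp.single_add] at h
      rwa [show (r : ℕ) + 1 + (n - r) = n + 1 by omega] at h

theorem isWeightedHomogeneous_of_mem_hSpan {U : J} {n : ℕ} {x : MvPolynomial (J × ℕ) ℚ}
    (hx : x ∈ hSpan (hVar U) n) : IsWeightedHomogeneous pWeight x (Finsupp.single U n) := by
  have : hSpan (hVar U) n ≤
      (weightedHomogeneousSubmodule ℚ pWeight (Finsupp.single U n)).restrictScalars ℤ := by
    rw [hSpan, Submodule.span_le]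
    rintro _ ⟨α, rfl, rfl⟩
    show IsWeightedHomogeneous pWeight _ _
    clear hx
    induction α using Multiset.induction_on with
    | empty =>
      simpa using isWeightedHomogeneous_one ℚ (pWeight (J := J))
    | cons a α ih =>
      rw [Multiset.map_cons, Multiset.prod_cons, Multiset.sum_cons, Finsupp.single_add]
      exact (isWeightedHomogeneous_hVar U a).mul ih
  exact this hx

theorem isWeightedHomogeneous_schurPoly (lam : MultiPartition J) :
    IsWeightedHomogeneous pWeight (schurPoly lam) lam.mdeg := by
  have h := IsWeightedHomogeneous.prod lam.supp (fun U => jacobiTrudi (hVar U) (lam.part U))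
    (fun U => Finsupp.single U (lam.part U).card) (w := pWeight)
    fun U _ => isWeightedHomogeneous_of_mem_hSpan (jacobiTrudi_mem_hSpan _ _)
  suffices hm : lam.mdeg = ∑ U ∈ lam.supp, Finsupp.single U (lam.part U).card by
    rw [hm]
    exact h
  refine Finsupp.ext fun U => ?_
  rw [Finsupp.finsetSum_apply, MultiPartition.mdeg_apply]
  by_cases hU : U ∈ lam.supp
  · have hz : ∀ V ∈ lam.supp, V ≠ U → Finsupp.single V (lam.part V).card U = 0 := fun V _ hV =>
      Finsupp.single_eq_of_ne hV.symm
    rw [Finset.sum_eq_single_of_mem U hU hz, Finsupp.single_eq_same]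
  · have hz : ∀ V ∈ lam.supp, Finsupp.single V (lam.part V).card U = 0 := fun V hV =>
      Finsupp.single_eq_of_ne fun h => hU (h ▸ hV)
    rw [Finset.sum_eq_zero hz]
    rw [MultiPartition.mem_supp, not_not] at hU
    rw [hU, card_bot]

end SchurPoly

/-! ### Power sums of variable sets -/

section PowerSums

open MvPowerSeries

variable {σ J : Type*}

/-- The `l`-th power sum as a ring homomorphism. -/
def powerSumHom (l : ℕ) (hl : l ≠ 0) : MvPowerSeries σ ℤ →+* MvPowerSeries σ ℚ :=
  (MvPowerSeries.map (Int.castRingHom ℚ)).comp (expand l hl).toRingHom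

theorem coeff_powerSumHom_smul {l : ℕ} (hl : l ≠ 0) (X : MvPowerSeries σ ℤ) (m : σ →₀ ℕ) :
    coeff (l • m) (powerSumHom l hl X) = (coeff m X : ℤ) := by
  show coeff (l • m) (MvPowerSeries.map (Int.castRingHom ℚ) (expand l hl X)) = _
  rw [coeff_map, coeff_expand_smul]
  rfl

theorem coeff_powerSumHom_of_ne {l : ℕ} (hl : l ≠ 0) (X : MvPowerSeries σ ℤ) {n : σ →₀ ℕ}
    (h : ∀ m : σ →₀ ℕ, l • m ≠ n) : coeff n (powerSumHom l hl X) = 0 := by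
  show coeff n (MvPowerSeries.map (Int.castRingHom ℚ) (expand l hl X)) = _
  rw [coeff_map]
  have : ∃ i, ¬ l ∣ n i := by
    by_contra hcon
    push Not at hcon
    refine h (Finsupp.mapRange (· / l) (Nat.zero_div l) n) (Finsupp.ext fun i => ?_)
    rw [Finsupp.smul_apply, Finsupp.mapRange_apply, smul_eq_mul, Nat.mul_div_cancel' (hcon i)]
  obtain ⟨i, hi⟩ := this
  rw [coeff_expand_of_not_dvd l hl X hi, map_zero]

theorem smul_exponent_injective {l : ℕ} (hl : l ≠ 0) :
    Function.Injective fun m : σ →₀ ℕ => l • m := fun _ _ h => Finsupp.ext fun i =>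
  Nat.eq_of_mul_eq_mul_left (Nat.pos_of_ne_zero hl) (DFunLike.congr_fun h i)

theorem hasFormalSum_powerSum {l : ℕ} (hl : l ≠ 0) (X : MvPowerSeries σ ℤ) :
    HasFormalSum (fun m : σ →₀ ℕ => monomial (l • m) ((coeff m X : ℤ) : ℚ))
      (powerSumHom l hl X) := by
  classical
  have hne : ∀ n m : σ →₀ ℕ, l • m ≠ n → coeff n (monomial (l • m) ((coeff m X : ℤ) : ℚ)) = 0 :=
    fun n m h => coeff_monomial_ne h.symm _
  refine hasFormalSum_iff.2 ⟨fun n => ?_, fun n => ?_⟩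
  · refine Set.Subsingleton.finite fun _ hm _ hm' => smul_exponent_injective hl ?_
    have h1 := not_imp_comm.1 (hne n _) hm
    have h2 := not_imp_comm.1 (hne n _) hm'
    exact h1.trans h2.symm
  · by_cases h : ∃ m : σ →₀ ℕ, l • m = n
    · obtain ⟨m, rfl⟩ := h
      rw [finsum_eq_single _ m fun m' hm' => hne _ _ ((smul_exponent_injective hl).ne hm'),
        coeff_monomial_same, coeff_powerSumHom_smul]
    · push Not at h
      rw [finsum_eq_zero_of_forall_eq_zero fun m => hne n m (h m), coeff_powerSumHom_of_ne hl X h]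

/-- As a ring homomorphism, the power sum turns unions, products and integer multiples of variable
sets into sums, products and multiples. -/
theorem powerSum_eq {l : ℕ} (hl : l ≠ 0) (X : MvPowerSeries σ ℤ) :
    powerSum l X = powerSumHom l hl X := (hasFormalSum_powerSum hl X).formalSum_eq

theorem exists_of_coeff_powerSumHom_ne_zero {l : ℕ} {hl : l ≠ 0} {X : MvPowerSeries σ ℤ}
    {n : σ →₀ ℕ} (h : coeff n (powerSumHom l hl X) ≠ 0) :
    ∃ m : σ →₀ ℕ, l • m = n ∧ coeff m X ≠ 0 := by
  by_cases h' : ∃ m : σ →₀ ℕ, l • m = n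
  · obtain ⟨m, rfl⟩ := h'
    refine ⟨m, rfl, fun h0 => h ?_⟩
    rw [coeff_powerSumHom_smul, h0, Int.cast_zero]
  · push Not at h'
    exact absurd (coeff_powerSumHom_of_ne hl X h') h

theorem le_nsmul_exponent {l : ℕ} (hl : l ≠ 0) (m : σ →₀ ℕ) : m ≤ l • m := fun i => by
  rw [Finsupp.smul_apply, smul_eq_mul]
  exact Nat.le_mul_of_pos_left _ (Nat.pos_of_ne_zero hl)

theorem coeffFinite_powerSumHom {l : ℕ} (hl : l ≠ 0) :
    CoeffFinite (powerSumHom l hl : MvPowerSeries σ ℤ →+* MvPowerSeries σ ℚ) := by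
  classical
  intro n
  refine ⟨(Set.finite_Iic n).toFinset, fun f hf => ?_⟩
  by_contra h
  obtain ⟨m, rfl, hm⟩ := exists_of_coeff_powerSumHom_ne_zero h
  exact hm (hf m (by simpa using le_nsmul_exponent hl m))

theorem EqUpTo.powerSumHom {m : σ →₀ ℕ} {X Y : MvPowerSeries σ ℤ} (h : EqUpTo m X Y) {l : ℕ}
    (hl : l ≠ 0) : EqUpTo m (powerSumHom l hl X) (powerSumHom l hl Y) := by
  intro n hn
  by_cases h' : ∃ k : σ →₀ ℕ, l • k = n
  · obtain ⟨k, rfl⟩ := h'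
    rw [coeff_powerSumHom_smul, coeff_powerSumHom_smul, h k ((le_nsmul_exponent hl k).trans hn)]
  · push Not at h'
    rw [coeff_powerSumHom_of_ne hl X h', coeff_powerSumHom_of_ne hl Y h']

/-- The power sums of a family of variable sets. -/
def pFamily (X : J → MvPowerSeries σ ℤ) (t : J × ℕ) : MvPowerSeries σ ℚ :=
  powerSum (t.2 + 1) (X t.1)

theorem pFamily_apply (X : J → MvPowerSeries σ ℤ) (U : J) (k : ℕ) :
    pFamily X (U, k) = powerSumHom (k + 1) k.succ_ne_zero (X U) := powerSum_eq _ _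

/-- A monomial `n` of `p_{k+1}(X_U)` is `(k+1) • m` for a letter `m ≠ 0` of `X_U`. Thus `m` divides
`n` and `k < deg n`, leaving finitely many `U` and `k`. -/
theorem hasSubst_pFamily {X : J → MvPowerSeries σ ℤ} (h0 : ∀ U, constantCoeff (X U) = 0)
    (hX : ∀ m, {U | coeff m (X U) ≠ 0}.Finite) : HasSubst (pFamily X) := by
  classical
  have hdeg : ∀ n U k, coeff n (pFamily X (U, k)) ≠ 0 →
      ∃ m : σ →₀ ℕ, (k + 1) • m = n ∧ m ≠ 0 ∧ coeff m (X U) ≠ 0 := by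
    intro n U k h
    rw [pFamily_apply] at h
    obtain ⟨m, rfl, hm⟩ := exists_of_coeff_powerSumHom_ne_zero h
    refine ⟨m, rfl, ?_, hm⟩
    rintro rfl
    exact hm (by rw [coeff_zero_eq_constantCoeff_apply, h0])
  refine ⟨fun t => ?_, fun n => ?_⟩
  · have : constantCoeff (pFamily X t) = 0 := by
      by_contra h
      rw [← coeff_zero_eq_constantCoeff_apply] at h
      obtain ⟨m, hm, hm0, -⟩ := hdeg 0 t.1 t.2 h
      exact hm0 (smul_exponent_injective t.2.succ_ne_zero (hm.trans (smul_zero _).symm))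
    rw [this]
    exact IsNilpotent.zero
  · refine (((Set.finite_Iic n).biUnion fun m _ => hX m).prod
      (Set.finite_Iio n.degree)).subset ?_
    rintro ⟨U, k⟩ h
    obtain ⟨m, rfl, hm0, hm⟩ := hdeg n U k h
    refine ⟨Set.mem_biUnion (Set.mem_Iic.2 (le_nsmul_exponent k.succ_ne_zero m)) hm, ?_⟩
    rw [Set.mem_Iio, map_nsmul, smul_eq_mul]
    have : m.degree ≠ 0 := fun h => hm0 ((Finsupp.degree_eq_zero_iff _).1 h)
    have := Nat.pos_of_ne_zero this
    nlinarith

theorem completeSymm_eq (X : MvPowerSeries σ ℤ) (n : ℕ) :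
    completeSymm X n = newtonH (fun r => powerSum (r + 1) X) n := by
  induction n using Nat.strong_induction_on with
  | _ n ih =>
    rcases n with _ | n
    · rw [completeSymm, newtonH_zero]
    · rw [completeSymm, newtonH]
      congr 1
      exact Finset.sum_congr rfl fun r _ => by rw [ih _ (by omega)]

/-- Evaluation of polynomials in the power sums. -/
def evalPoly (X : J → MvPowerSeries σ ℤ) : MvPolynomial (J × ℕ) ℚ →ₐ[ℚ] MvPowerSeries σ ℚ :=
  MvPolynomial.aeval (pFamily X)

theorem evalPoly_X (X : J → MvPowerSeries σ ℤ) (t : J × ℕ) :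
    evalPoly X (MvPolynomial.X t) = pFamily X t := MvPolynomial.aeval_X _ _

theorem evalPoly_hVar (X : J → MvPowerSeries σ ℤ) (U : J) (n : ℕ) :
    evalPoly X (hVar U n) = completeSymm (X U) n := by
  have := map_newtonH (evalPoly X).toRingHom (fun k => MvPolynomial.X (U, k)) n
  rw [completeSymm_eq]
  refine this.trans ?_
  congr 1
  funext k
  exact evalPoly_X X (U, k)

theorem evalPoly_schurPoly (X : J → MvPowerSeries σ ℤ) (lam : MultiPartition J) :
    evalPoly X (schurPoly lam) = schurProd lam X := by
  rw [schurPoly, map_prod, schurProd]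
  refine Finset.prod_congr rfl fun U _ => ?_
  have := map_jacobiTrudi (evalPoly X).toRingHom (hVar U) (lam.part U)
  refine this.trans ?_
  show _ = jacobiTrudi (completeSymm (X U)) (lam.part U)
  congr 1
  funext n
  exact evalPoly_hVar X U n

theorem evalPoly_monomial (X : J → MvPowerSeries σ ℤ) (ρ : J × ℕ →₀ ℕ) (c : ℚ) :
    evalPoly X (MvPolynomial.monomial ρ c) = c • monomialProd (pFamily X) ρ := by
  rw [evalPoly, MvPolynomial.aeval_monomial, Algebra.smul_def]
  rfl

theorem schurProd_eq_sum (X : J → MvPowerSeries σ ℤ) (lam : MultiPartition J) :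
    schurProd lam X = ∑ ρ ∈ (schurPoly lam).support,
      (schurPoly lam).coeff ρ • monomialProd (pFamily X) ρ := by
  rw [← evalPoly_schurPoly]
  conv_lhs => rw [(schurPoly lam).as_sum, map_sum]
  simp only [evalPoly_monomial]

/-- A monomial occurs in finitely many products of power sums, each of a definite multidegree, and
only finitely many multipartitions share a multidegree. -/
theorem formallySummable_schurProd {X : J → MvPowerSeries σ ℤ} (hX : HasSubst (pFamily X)) :
    FormallySummable fun lam : MultiPartition J => schurProd lam X := by
  intro n
  refine ((formallySummable_monomialProd hX n).biUnion
    fun ρ _ => finite_mdeg_eq (Finsupp.weight pWeight ρ)).subset fun lam hlam => ?_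
  have h : ∃ ρ ∈ (schurPoly lam).support,
      coeff n ((schurPoly lam).coeff ρ • monomialProd (pFamily X) ρ) ≠ 0 := by
    by_contra hcon
    push Not at hcon
    refine hlam ?_
    show coeff n (schurProd lam X) = 0
    rw [schurProd_eq_sum, map_sum]
    exact Finset.sum_eq_zero hcon
  obtain ⟨ρ, hρ, hne⟩ := h
  refine Set.mem_biUnion (x := ρ) (fun h0 => hne ?_) ?_
  · rw [coeff_smul, h0, mul_zero]
  · exact (isWeightedHomogeneous_schurPoly lam (MvPolynomial.mem_support_iff.1 hρ)).symm

end PowerSums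

end

section

open MvPowerSeries
open Finset.HasAntidiagonal (antidiagonal mem_antidiagonal)


/-! ## The generating function -/

section GeneratingFunction

variable {A : Type*} [Ring A] [Algebra ℚ A] {R : Type*} [Ring R] {I σ : Type*} (b : Module.Basis I ℤ R)

/-- The coefficients of a product of power sums in terms of Schur functions. -/
def powerExpansion (ρ : I × ℕ →₀ ℕ) : MultiPartition I →₀ ℤ :=
  (exists_schurPoly_expansion (monomial_mem_schurSpan ρ)).choose

theorem mdeg_eq_of_powerExpansion_ne_zero {ρ : I × ℕ →₀ ℕ} {lam : MultiPartition I}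
    (h : powerExpansion ρ lam ≠ 0) : lam.mdeg = Finsupp.weight pWeight ρ :=
  (exists_schurPoly_expansion (monomial_mem_schurSpan ρ)).choose_spec.1 lam h

theorem monomialProd_eq_sum (X : I → MvPowerSeries σ ℤ) (ρ : I × ℕ →₀ ℕ) :
    monomialProd (pFamily X) ρ =
      ∑ lam ∈ (powerExpansion ρ).support, powerExpansion ρ lam • schurProd lam X := by
  have h := (exists_schurPoly_expansion (monomial_mem_schurSpan ρ)).choose_spec.2
  have h' := congrArg (evalPoly X) h
  rw [evalPoly_monomial, one_smul, Finsupp.sum, map_sum] at h'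
  simp only [map_zsmul, evalPoly_schurPoly] at h'
  exact h'

/-- The coefficients, in terms of Schur functions, of a power series in the power sums. -/
def schurCoeff (f : MvPowerSeries (I × ℕ) A) (lam : MultiPartition I) : A :=
  ∑ ρ ∈ (finite_weight_eq lam.mdeg).toFinset, powerExpansion ρ lam • coeff ρ f

variable {X : I → MvPowerSeries σ ℤ}

/-- The double family over power-sum monomials `ρ` and multipartitions `λ` is summed in both orders:
over `λ` first it gives the substitution, over `ρ` first the Schur coefficients. The algebra is left
general since `LimitAlgebra R` is needed for the `Z_λ` and `ℚ` for the structure constants. -/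
theorem hasFormalSum_schurCoeff (hX : HasSubst (pFamily X)) (f : MvPowerSeries (I × ℕ) A) :
    HasFormalSum (fun lam => tens (schurProd lam X) (schurCoeff f lam))
      (substHom (A) hX f) := by
  classical
  set w : (I × ℕ →₀ ℕ) → A := fun ρ => coeff ρ f with hw
  set F : (I × ℕ →₀ ℕ) × MultiPartition I → MvPowerSeries σ (A) :=
    fun p => tens (schurProd p.2 X) (powerExpansion p.1 p.2 • w p.1) with hF
  have hFs : FormallySummable F := by
    intro n
    refine ((formallySummable_schurProd hX n).biUnion fun lam _ =>
      (finite_weight_eq lam.mdeg).prod (Set.finite_singleton lam)).subset ?_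
    rintro ⟨ρ, lam⟩ h
    have h1 : coeff n (schurProd lam X) • (powerExpansion ρ lam • w ρ) ≠ 0 := h
    refine Set.mem_biUnion (x := lam) (left_ne_zero_of_smul h1) ⟨?_, rfl⟩
    exact (mdeg_eq_of_powerExpansion_ne_zero
      (left_ne_zero_of_smul (right_ne_zero_of_smul h1))).symm
  have hρ : ∀ ρ, (formalSum fun lam => F (ρ, lam)) = tens (monomialProd (pFamily X) ρ) (w ρ) := by
    intro ρ
    refine (hFs.slice ρ).hasFormalSum.unique ?_
    have h := hasFormalSum_of_finset (f := fun lam => F (ρ, lam)) (powerExpansion ρ).support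
      fun lam hlam => by
        rw [Finsupp.notMem_support_iff] at hlam
        refine MvPowerSeries.ext fun n => ?_
        rw [hF, coeff_tens]
        simp only [hlam, zero_smul, smul_zero, map_zero]
    convert h using 1
    rw [monomialProd_eq_sum]
    refine MvPowerSeries.ext fun n => ?_
    rw [coeff_tens, map_sum, map_sum, Finset.sum_smul]
    refine Finset.sum_congr rfl fun lam _ => ?_
    rw [hF, coeff_tens, map_zsmul, smul_assoc, smul_comm]
  have hlam : ∀ lam, (formalSum fun ρ => F (ρ, lam)) = tens (schurProd lam X) (schurCoeff f lam) := by
    intro lam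
    refine FormallySummable.hasFormalSum
      (fun n => (hFs n).preimage (Prod.mk_left_injective lam).injOn) |>.unique ?_
    have h := hasFormalSum_of_finset (f := fun ρ => F (ρ, lam))
      (finite_weight_eq lam.mdeg).toFinset fun ρ hρ => by
        have h0 : powerExpansion ρ lam = 0 := by
          by_contra hne
          exact hρ ((Set.Finite.mem_toFinset _).2 (mdeg_eq_of_powerExpansion_ne_zero hne).symm)
        refine MvPowerSeries.ext fun n => ?_
        rw [hF, coeff_tens]
        simp only [h0, zero_smul, smul_zero, map_zero]
    convert h using 1
    refine MvPowerSeries.ext fun n => ?_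
    rw [coeff_tens, map_sum, schurCoeff, Finset.smul_sum]
    rfl
  have h1 : formalSum F = substHom (A) hX f := by
    refine hFs.hasFormalSum.curry.unique ?_
    simp only [hρ]
    exact hasFormalSum_substHom hX f
  have h2 := (hFs.hasFormalSum.comp_equiv (Equiv.prodComm _ _)).curry
  rw [h1] at h2
  simpa only [Equiv.prodComm_apply, Prod.swap_prod_mk, hlam] using h2

/-- The coefficients of the universal generating function in terms of Schur functions. -/
def zFam : MultiPartition I → LimitAlgebra R := schurCoeff (universalProd b)

theorem hasFormalSum_zFam (hX : HasSubst (pFamily X)) :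
    HasFormalSum (fun lam => tens (schurProd lam X) (zFam b lam))
      (substHom (LimitAlgebra R) hX (universalProd b)) :=
  hasFormalSum_schurCoeff hX _

theorem Theta_powerSumSeries (k : ℕ) : Theta k.succPNat (powerSumSeries b X k.succPNat) =
    lieTheta (THom k.succPNat) (linSeries b fun U => pFamily X (U, k)) := rfl

theorem hasFormalProd_Theta (hX : HasSubst (pFamily X)) :
    HasFormalProd (fun k => Theta k.succPNat (powerSumSeries b X k.succPNat))
      (substHom (LimitAlgebra R) hX (universalProd b)) :=
  hasFormalProd_substHom_universalProd b hX

end GeneratingFunction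

/-! ### The variable sets -/

section VarSets

variable {σ J : Type*}

theorem hasFormalSum_varSet {v : ℕ → σ} (hv : Function.Injective v) :
    HasFormalSum (fun n => (X (v n) : MvPowerSeries σ ℤ)) (varSet v) := by
  classical
  refine FormallySummable.hasFormalSum fun m => Set.Subsingleton.finite fun i hi j hj => ?_
  rw [Set.mem_ofPred_eq, coeff_X, ite_ne_right_iff] at hi hj
  exact hv (Finsupp.single_left_injective one_ne_zero (hi.1.symm.trans hj.1))

theorem exists_of_coeff_varSet_ne_zero {v : ℕ → σ} {m : σ →₀ ℕ} (h : coeff m (varSet v) ≠ 0) :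
    ∃ n, m = Finsupp.single (v n) 1 := by
  classical
  by_contra hcon
  push Not at hcon
  refine h (finsum_eq_zero_of_forall_eq_zero fun n => ?_)
  rw [coeff_X, if_neg (hcon n)]

theorem constantCoeff_varSet (v : ℕ → σ) : constantCoeff (varSet v) = 0 := by
  by_contra h
  rw [← coeff_zero_eq_constantCoeff_apply] at h
  obtain ⟨n, hn⟩ := exists_of_coeff_varSet_ne_zero h
  exact one_ne_zero (Finsupp.single_eq_zero.1 hn.symm)

theorem hasSubst_pFamily_varSet {v : J → ℕ → σ} (hv : Function.Injective (Function.uncurry v)) :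
    HasSubst (pFamily fun U => varSet (v U)) := by
  refine hasSubst_pFamily (fun U => constantCoeff_varSet _) fun m =>
    Set.Subsingleton.finite fun U hU V hV => ?_
  obtain ⟨i, hi⟩ := exists_of_coeff_varSet_ne_zero hU
  obtain ⟨j, hj⟩ := exists_of_coeff_varSet_ne_zero hV
  have h := Finsupp.single_left_injective one_ne_zero (hi.symm.trans hj)
  exact congrArg Prod.fst (@hv (U, i) (V, j) h)

variable {R : Type*} [Ring R] {I : Type*} (b : Module.Basis I ℤ R)

theorem exists_of_coeff_xSet_mul_ySet_ne_zero {V W : I} {m : Vars I →₀ ℕ}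
    (h : coeff m (xSet V * ySet W) ≠ 0) :
    ∃ i j, m = Finsupp.single (Sum.inl (V, i)) 1 + Finsupp.single (Sum.inr (W, j)) 1 := by
  classical
  rw [coeff_mul] at h
  obtain ⟨p, hp, hne⟩ := Finset.exists_ne_zero_of_sum_ne_zero h
  obtain ⟨i, hi⟩ := exists_of_coeff_varSet_ne_zero (left_ne_zero_of_mul hne)
  obtain ⟨j, hj⟩ := exists_of_coeff_varSet_ne_zero (right_ne_zero_of_mul hne)
  exact ⟨i, j, by rw [← mem_antidiagonal.1 hp, hi, hj]⟩

/-- A letter `x_{V,i} y_{W,j}` determines `V` and `W`. The sum over all pairs in the product set is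
therefore a disjoint one. -/
theorem eq_of_coeff_xSet_mul_ySet_ne_zero {p q : I × I} {m : Vars I →₀ ℕ}
    (hp : coeff m (xSet p.1 * ySet p.2) ≠ 0) (hq : coeff m (xSet q.1 * ySet q.2) ≠ 0) : p = q := by
  obtain ⟨i, j, h⟩ := exists_of_coeff_xSet_mul_ySet_ne_zero hp
  obtain ⟨i', j', h'⟩ := exists_of_coeff_xSet_mul_ySet_ne_zero hq
  rw [h] at h'
  have h1 := DFunLike.congr_fun h' (Sum.inl (p.1, i))
  have h2 := DFunLike.congr_fun h' (Sum.inr (p.2, j))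
  classical
  simp only [Finsupp.add_apply, Finsupp.single_apply, Sum.inl.injEq, Sum.inr.injEq, if_true,
    reduceCtorEq, if_false, add_zero, zero_add] at h1 h2
  have h1' : (q.1, i') = (p.1, i) := by
    by_contra h
    rw [if_neg h] at h1
    exact one_ne_zero h1
  have h2' : (q.2, j') = (p.2, j) := by
    by_contra h
    rw [if_neg h] at h2
    exact one_ne_zero h2
  exact Prod.ext (congrArg Prod.fst h1').symm (congrArg Prod.fst h2').symm

theorem formallySummable_productSet (U : I) :
    FormallySummable fun p : I × I => structTensor b p.1 p.2 U • (xSet p.1 * ySet p.2) := by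
  intro m
  refine Set.Subsingleton.finite fun p hp q hq => ?_
  rw [Set.mem_ofPred_eq, map_zsmul] at hp hq
  exact eq_of_coeff_xSet_mul_ySet_ne_zero (right_ne_zero_of_smul hp) (right_ne_zero_of_smul hq)

theorem hasSubst_pFamily_xSet : HasSubst (pFamily (xSet : I → MvPowerSeries (Vars I) ℤ)) :=
  hasSubst_pFamily_varSet (v := fun U n => Sum.inl (U, n)) fun _ _ h => Sum.inl_injective h

theorem hasSubst_pFamily_ySet : HasSubst (pFamily (ySet : I → MvPowerSeries (Vars I) ℤ)) :=
  hasSubst_pFamily_varSet (v := fun U n => Sum.inr (U, n)) fun _ _ h => Sum.inr_injective h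

theorem finite_coeff_varSet_ne_zero {v : J → ℕ → σ} (hv : Function.Injective (Function.uncurry v))
    (m : σ →₀ ℕ) : {U | coeff m (varSet (v U)) ≠ 0}.Finite := by
  refine Set.Subsingleton.finite fun U hU V hV => ?_
  obtain ⟨i, hi⟩ := exists_of_coeff_varSet_ne_zero hU
  obtain ⟨j, hj⟩ := exists_of_coeff_varSet_ne_zero hV
  have h := Finsupp.single_left_injective one_ne_zero (hi.symm.trans hj)
  exact congrArg Prod.fst (@hv (U, i) (V, j) h)

/-- Even for infinite `I`, a letter `x_{V,i} y_{W,j}` lies in the sets of finitely many `U`, namely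
those occurring in the expansion of `VW`. -/
theorem hasSubst_pFamily_productSet : HasSubst (pFamily (productSet b)) := by
  refine hasSubst_pFamily (fun U => ?_) fun m => ?_
  · rw [productSet, map_add, map_add, xSet, ySet, constantCoeff_varSet, constantCoeff_varSet,
      zero_add, zero_add, ← coeff_zero_eq_constantCoeff_apply, coeff_formalSum]
    refine finsum_eq_zero_of_forall_eq_zero fun p => ?_
    rw [map_zsmul, coeff_zero_eq_constantCoeff_apply, map_mul, xSet, constantCoeff_varSet,
      zero_mul, smul_zero]
  · have hx := finite_coeff_varSet_ne_zero (v := fun (U : I) n => (Sum.inl (U, n) : Vars I))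
      (fun _ _ h => Sum.inl_injective h) m
    have hy := finite_coeff_varSet_ne_zero (v := fun (U : I) n => (Sum.inr (U, n) : Vars I))
      (fun _ _ h => Sum.inr_injective h) m
    have hxy : {U | coeff m (formalSum fun p : I × I =>
        structTensor b p.1 p.2 U • (xSet p.1 * ySet p.2)) ≠ 0}.Finite := by
      by_cases hp : ∃ p : I × I, coeff m (xSet p.1 * ySet p.2) ≠ 0
      · obtain ⟨p, hp⟩ := hp
        refine (b.repr (b p.1 * b p.2)).support.finite_toSet.subset fun U hU => ?_
        by_contra hN
        refine hU (finsum_eq_zero_of_forall_eq_zero fun q => ?_)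
        rw [map_zsmul]
        by_cases hq : coeff m (xSet q.1 * ySet q.2) = 0
        · rw [hq, smul_zero]
        · rw [← eq_of_coeff_xSet_mul_ySet_ne_zero hp hq, structTensor,
            Finsupp.notMem_support_iff.1 hN, zero_smul]
      · push Not at hp
        convert Set.finite_empty
        refine Set.eq_empty_of_forall_notMem fun U hU =>
          hU (finsum_eq_zero_of_forall_eq_zero fun q => ?_)
        rw [map_zsmul, hp, smul_zero]
    refine ((hx.union hy).union hxy).subset fun U hU => ?_
    by_contra h
    simp only [Set.mem_union, Set.mem_ofPred_eq, not_or, not_not] at h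
    refine hU ?_
    rw [productSet, map_add, map_add, h.2]
    have h1 := h.1.1
    have h2 := h.1.2
    rw [xSet, ySet, h1, h2]
    rfl

end VarSets

/-! ### Multiplicativity of the generating function -/

section Multiplicativity

variable {R : Type*} [Ring R] {I σ : Type*} (b : Module.Basis I ℤ R)

theorem toRat_add (r s : R) : toRat R (r + s) = toRat R r + toRat R s := TensorProduct.tmul_add _ _ _

/-- `toRat`, as an additive map. -/
def toRatHom : R →+ RatRing R := AddMonoidHom.mk' (toRat R) toRat_add

theorem toRat_mul (r s : R) : toRat R (r * s) = toRat R r * toRat R s := by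
  have : (1 : ℚ) ⊗ₜ[ℤ] r * (1 : ℚ) ⊗ₜ[ℤ] s = (1 : ℚ) ⊗ₜ[ℤ] (r * s) := by
    rw [Algebra.TensorProduct.tmul_mul_tmul, one_mul]
  exact this.symm

theorem toRat_mul_basis (V W : I) : toRat R (b V) * toRat R (b W) =
    ∑ U ∈ (b.repr (b V * b W)).support, structTensor b V W U • toRat R (b U) := by
  rw [← toRat_mul]
  conv_lhs => rw [← b.linearCombination_repr (b V * b W), Finsupp.linearCombination_apply,
    Finsupp.sum]
  exact (map_sum toRatHom _ _).trans (Finset.sum_congr rfl fun U _ => map_zsmul toRatHom _ _)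

theorem formallySummable_powerSumHom {X : I → MvPowerSeries σ ℤ} (hX : HasSubst (pFamily X))
    (k : ℕ) : FormallySummable fun U => powerSumHom (k + 1) k.succ_ne_zero (X U) := by
  intro n
  refine ((hX.coeff_zero n).preimage (f := fun U => (U, k))
    (Prod.mk_left_injective k).injOn).subset fun U hU => ?_
  rw [Set.mem_preimage, Set.mem_ofPred_eq, pFamily_apply]
  exact hU

theorem hasFormalSum_linSeries {X : I → MvPowerSeries σ ℤ} (hX : HasSubst (pFamily X)) (k : ℕ) :
    HasFormalSum (fun U => tens (powerSumHom (k + 1) k.succ_ne_zero (X U)) (toRat R (b U)))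
      (linSeries b (fun U => pFamily X (U, k)) - 1) := by
  rw [linSeries, add_sub_cancel_left]
  simp only [pFamily_apply]
  exact ((formallySummable_powerSumHom hX k).tens _).hasFormalSum

/-- The product of the two series has linear terms from `𝐱` and `𝐲` and a bilinear term. Expanding
`VW` by the structure tensor turns the latter into the contribution of the letters `𝐱_V 𝐲_W`, by
multiplicativity of power sums. -/
theorem linSeries_productSet (k : ℕ) :
    linSeries b (fun U => pFamily (productSet b) (U, k)) =
      linSeries b (fun U => pFamily xSet (U, k)) * linSeries b (fun U => pFamily ySet (U, k)) := by
  classical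
  set φ : MvPowerSeries (Vars I) ℤ →+* MvPowerSeries (Vars I) ℚ :=
    powerSumHom (k + 1) k.succ_ne_zero with hφ
  have hx := hasFormalSum_linSeries b (hasSubst_pFamily_xSet (I := I)) k
  have hy := hasFormalSum_linSeries b (hasSubst_pFamily_ySet (I := I)) k
  have hp := hasFormalSum_linSeries b (hasSubst_pFamily_productSet b) k
  rw [← hφ] at hx hy hp
  -- Summing over `(V, W)` first gives the `𝐱𝐲`-part of the product set at `U`; summing over `U`
  -- first gives the product of the terms for `V` and `W`.
  set F : I × (I × I) → MvPowerSeries (Vars I) (RatRing R) := fun q =>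
    tens (φ (xSet q.2.1) * φ (ySet q.2.2)) (structTensor b q.2.1 q.2.2 q.1 • toRat R (b q.1))
    with hF
  have hxy := hx.mul hy
  have hsum : FormallySummable fun p : I × I => φ (xSet p.1) * φ (ySet p.2) :=
    ((formallySummable_powerSumHom (hasSubst_pFamily_xSet (I := I)) k).hasFormalSum.mul
      (formallySummable_powerSumHom (hasSubst_pFamily_ySet (I := I)) k).hasFormalSum).summable
  have hFs : FormallySummable F := by
    intro n
    refine ((hsum n).biUnion fun p _ =>
      (b.repr (b p.1 * b p.2)).support.finite_toSet.prod (Set.finite_singleton p)).subset ?_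
    rintro ⟨U, p⟩ h
    have h1 : coeff n (φ (xSet p.1) * φ (ySet p.2)) •
      (structTensor b p.1 p.2 U • toRat R (b U)) ≠ 0 := h
    refine Set.mem_biUnion (x := p) (left_ne_zero_of_smul h1) ⟨?_, rfl⟩
    exact Finsupp.mem_support_iff.2 (left_ne_zero_of_smul (right_ne_zero_of_smul h1))
  have hU : ∀ U, (formalSum fun p => F (U, p)) = tens (φ (formalSum fun p : I × I =>
      structTensor b p.1 p.2 U • (xSet p.1 * ySet p.2))) (toRat R (b U)) := by
    intro U
    have h := ((formallySummable_productSet b U).hasFormalSum.map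
      (coeffFinite_powerSumHom k.succ_ne_zero)).map (coeffFinite_tensHom (toRat R (b U)))
    refine Eq.trans ?_ h.formalSum_eq
    congr 1
    funext p
    refine MvPowerSeries.ext fun n => ?_
    rw [tensHom_apply, hF, coeff_tens, coeff_tens, map_zsmul, map_zsmul,
      map_mul (powerSumHom _ k.succ_ne_zero), smul_assoc]
    exact smul_comm _ _ _
  have hVW : ∀ p, (formalSum fun U => F (U, p)) = tens (φ (xSet p.1)) (toRat R (b p.1)) *
      tens (φ (ySet p.2)) (toRat R (b p.2)) := by
    intro p
    have h := hasFormalSum_of_finset (f := fun U => F (U, p)) (b.repr (b p.1 * b p.2)).support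
      fun U hU => by
        refine MvPowerSeries.ext fun n => ?_
        rw [hF, coeff_tens]
        simp only [structTensor, Finsupp.notMem_support_iff.1 hU, zero_smul, smul_zero, map_zero]
    rw [h.formalSum_eq, tens_mul_tens, toRat_mul_basis]
    refine MvPowerSeries.ext fun n => ?_
    rw [map_sum, coeff_tens, Finset.smul_sum]
    rfl
  have h1 := hFs.hasFormalSum.curry
  have h2 := (hFs.hasFormalSum.comp_equiv (Equiv.prodComm _ _)).curry
  simp only [Equiv.prodComm_apply, Prod.swap_prod_mk, hVW] at h2
  simp only [hU] at h1
  have h3 := (hx.add hy).add h1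
  have h4 : HasFormalSum (fun U => tens (φ (productSet b U)) (toRat R (b U)))
      (linSeries b (fun U => pFamily xSet (U, k)) - 1 +
        (linSeries b (fun U => pFamily ySet (U, k)) - 1) + formalSum F) := by
    convert h3 using 2 with U
    rw [productSet, map_add, map_add, ← tensHom_apply, map_add, map_add]
    rfl
  have h5 := hp.unique h4
  rw [h2.unique hxy, sub_eq_iff_eq_add] at h5
  rw [h5]
  noncomm_ring

theorem constantCoeff_pFamily {X : I → MvPowerSeries σ ℤ} (hX : HasSubst (pFamily X)) (t : I × ℕ) :
    constantCoeff (pFamily X t) = 0 := (hX.const_coeff t).eq_zero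

/-- The generating functions multiply as the variable sets do. -/
theorem generatingFunction_mul :
    substHom (LimitAlgebra R) hasSubst_pFamily_xSet (universalProd b) *
      substHom (LimitAlgebra R) hasSubst_pFamily_ySet (universalProd b) =
    substHom (LimitAlgebra R) (hasSubst_pFamily_productSet b) (universalProd b) := by
  have hx1 : ∀ k, constantCoeff (linSeries b fun U => pFamily (xSet (I := I)) (U, k)) = 1 :=
    fun k => constantCoeff_linSeries b fun U => constantCoeff_pFamily hasSubst_pFamily_xSet _
  have hy1 : ∀ k, constantCoeff (linSeries b fun U => pFamily (ySet (I := I)) (U, k)) = 1 :=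
    fun k => constantCoeff_linSeries b fun U => constantCoeff_pFamily hasSubst_pFamily_ySet _
  -- Factors of different index commute because they lie in different slots; those of equal index
  -- are merged by `lieTheta_mul`.
  have h := (hasFormalProd_Theta b hasSubst_pFamily_xSet).mul
    (hasFormalProd_Theta b hasSubst_pFamily_ySet) fun j k hjk => by
      rw [Theta_powerSumSeries, Theta_powerSumSeries]
      exact commute_lieTheta (fun r s => T_mul_T_of_ne (Nat.succPNat_injective.ne hjk) r s)
        (hx1 j) (hy1 k)
  refine h.unique ?_
  convert hasFormalProd_Theta b (hasSubst_pFamily_productSet b) using 2 with k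
  rw [Theta_powerSumSeries, Theta_powerSumSeries, Theta_powerSumSeries, linSeries_productSet,
    lieTheta_mul (preservesCommutator_THom _) (hx1 k) (hy1 k)]

end Multiplicativity

end

section

open MvPowerSeries
open Finset.HasAntidiagonal (antidiagonal mem_antidiagonal)


/-! ## Integrality -/

section NewtonPow

variable {S : Type*} [CommRing S] [Algebra ℚ S]

theorem newtonH_pow (x : S) (n : ℕ) : newtonH (fun r => x ^ (r + 1)) n = x ^ n := by
  refine (eq_newtonH (g := fun n => x ^ n) (pow_zero x) (fun n => ?_) n).symm
  have h : ∀ q ∈ antidiagonal n, x ^ (q.1 + 1) * x ^ q.2 = x ^ (n + 1) := fun q hq => by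
    rw [← mem_antidiagonal.1 hq, ← pow_add]
    congr 1
    omega
  rw [Finset.sum_congr rfl h, Finset.sum_const, Finset.Nat.card_antidiagonal]

/-- A single letter with multiplicity `-1` has generating series `1 - x t`, the inverse of the
geometric series. -/
theorem newtonH_neg_pow (x : S) (n : ℕ) : newtonH (fun r => -x ^ (r + 1)) n =
    if n = 0 then 1 else if n = 1 then -x else 0 := by
  refine (eq_newtonH (g := fun n => if n = 0 then 1 else if n = 1 then -x else 0) (if_pos rfl)
    (fun n => ?_) n).symm
  rcases n with _ | n
  · simp
  · rw [Finset.Nat.sum_antidiagonal_succ']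
    rcases n with _ | n
    · simp [pow_two]
    · rw [Finset.Nat.sum_antidiagonal_succ']
      simp [pow_succ]

theorem newtonE_zero (p : ℕ → S) : newtonE p 0 = 1 := by
  rw [newtonE, newtonH_zero, pow_zero, one_mul]

/-- Adjoining one letter multiplies the generating series of the elementary functions by `1 + x t`.
-/
theorem newtonE_add_pow (p : ℕ → S) (x : S) (n : ℕ) :
    newtonE (fun r => p r + x ^ (r + 1)) (n + 1) = newtonE p (n + 1) + x * newtonE p n := by
  have h := newtonH_add (fun r => -p r) (fun r => -x ^ (r + 1)) (n + 1)
  simp only [← neg_add] at h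
  rw [newtonE, h, Finset.Nat.sum_antidiagonal_succ']
  simp only [newtonH_neg_pow]
  rcases n with _ | n
  · simp [newtonE, newtonH_zero, mul_add]
  · rw [Finset.Nat.sum_antidiagonal_succ']
    simp [newtonE]
    ring

theorem newtonE_of_eq_zero (n : ℕ) : newtonE (fun _ => (0 : S)) (n + 1) = 0 := by
  have := newtonH_of_eq_zero (S := S) (n + 1)
  simp only [newtonE, neg_zero, this]
  simp

theorem map_newtonE {S' : Type*} [CommRing S'] [Algebra ℚ S'] (φ : S →+* S') (p : ℕ → S) (n : ℕ) :
    φ (newtonE p n) = newtonE (fun r => φ (p r)) n := by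
  rw [newtonE, map_mul, map_newtonH]
  simp [newtonE]

end NewtonPow

/-! ### Integer coefficients of Schur functions of variable sets -/

section Integrality

variable {σ J : Type*}

theorem EqUpTo.newtonH {m : σ →₀ ℕ} {p q : ℕ → MvPowerSeries σ ℚ} (h : ∀ r, EqUpTo m (p r) (q r))
    (n : ℕ) : EqUpTo m (newtonH p n) (newtonH q n) := by
  induction n using Nat.strong_induction_on with
  | _ n ih =>
    rcases n with _ | n
    · rw [newtonH_zero, newtonH_zero]
      exact EqUpTo.refl _ _
    · rw [WreathLimit.newtonH, WreathLimit.newtonH]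
      exact (EqUpTo.sum fun (r : Fin (n + 1)) _ => (h r).mul (ih (n - r) (by omega))).rat_smul _

theorem EqUpTo.newtonE {m : σ →₀ ℕ} {p q : ℕ → MvPowerSeries σ ℚ} (h : ∀ r, EqUpTo m (p r) (q r))
    (n : ℕ) : EqUpTo m (newtonE p n) (newtonE q n) :=
  (EqUpTo.refl _ _).mul (EqUpTo.newtonH (fun r k hk => by rw [map_neg, map_neg, h r k hk]) n)

/-- The power series with integer coefficients. -/
def intSeries (σ : Type*) : Subring (MvPowerSeries σ ℚ) :=
  (MvPowerSeries.map (σ := σ) (Int.castRingHom ℚ)).range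

theorem mem_intSeries {f : MvPowerSeries σ ℚ} :
    f ∈ intSeries σ ↔ ∀ m, ∃ z : ℤ, coeff m f = z := by
  constructor
  · rintro ⟨g, rfl⟩ m
    exact ⟨coeff m g, coeff_map _ _ _⟩
  · intro h
    choose z hz using h
    refine ⟨(z : MvPowerSeries σ ℤ), MvPowerSeries.ext fun m => ?_⟩
    rw [hz]
    rfl

/-- The power sums of a variable set. -/
def powerSums (X : MvPowerSeries σ ℤ) (r : ℕ) : MvPowerSeries σ ℚ :=
  powerSumHom (r + 1) r.succ_ne_zero X

theorem completeSymm_eq_powerSums (X : MvPowerSeries σ ℤ) (n : ℕ) :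
    completeSymm X n = newtonH (powerSums X) n := by
  rw [completeSymm_eq]
  congr 1
  funext r
  exact powerSum_eq r.succ_ne_zero X

theorem powerSumHom_monomial {l : ℕ} (hl : l ≠ 0) (m : σ →₀ ℕ) :
    powerSumHom l hl (monomial m 1) = monomial m (1 : ℚ) ^ l := by
  classical
  refine MvPowerSeries.ext fun n => ?_
  rw [monomial_pow, one_pow, coeff_monomial]
  by_cases h : ∃ k : σ →₀ ℕ, l • k = n
  · obtain ⟨k, rfl⟩ := h
    have : l • k = l • m ↔ k = m := (smul_exponent_injective hl).eq_iff
    simp only [coeff_powerSumHom_smul, coeff_monomial, this]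
    split_ifs <;> simp
  · push Not at h
    rw [coeff_powerSumHom_of_ne hl _ h, if_neg (h m).symm]

theorem EqUpTo.powerSums {m : σ →₀ ℕ} {X Y : MvPowerSeries σ ℤ} (h : EqUpTo m X Y) (r : ℕ) :
    EqUpTo m (powerSums X r) (powerSums Y r) := h.powerSumHom _

/-- The variable sets such that the complete symmetric functions of `X` and `-X` are integral. -/
def integralVarSets (σ : Type*) : AddSubgroup (MvPowerSeries σ ℤ) where
  carrier := {X | (∀ n, newtonH (powerSums X) n ∈ intSeries σ) ∧
    ∀ n, newtonH (powerSums (-X)) n ∈ intSeries σ}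
  zero_mem' := by
    have h : powerSums (0 : MvPowerSeries σ ℤ) = fun _ => 0 := funext fun r => map_zero _
    simp only [Set.mem_ofPred_eq, neg_zero, and_self, h, newtonH_of_eq_zero]
    intro n
    split_ifs
    · exact one_mem _
    · exact zero_mem _
  add_mem' := by
    intro X Y hX hY
    have h : ∀ X Y : MvPowerSeries σ ℤ, powerSums (X + Y) =
        fun r => powerSums X r + powerSums Y r := fun X Y => funext fun r => map_add _ _ _
    simp only [Set.mem_ofPred_eq, neg_add, h, newtonH_add]
    exact ⟨fun n => sum_mem fun i _ => mul_mem (hX.1 _) (hY.1 _),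
      fun n => sum_mem fun i _ => mul_mem (hX.2 _) (hY.2 _)⟩
  neg_mem' := by
    intro X hX
    simp only [Set.mem_ofPred_eq, neg_neg]
    exact hX.symm

theorem monomial_mem_intSeries (m : σ →₀ ℕ) : monomial m (1 : ℚ) ∈ intSeries σ :=
  ⟨monomial m 1, by rw [map_monomial, map_one]⟩

theorem monomial_mem_integralVarSets (m : σ →₀ ℕ) (z : ℤ) : monomial m z ∈ integralVarSets σ := by
  have h1 : powerSums (monomial m (1 : ℤ)) = fun r => monomial m (1 : ℚ) ^ (r + 1) :=
    funext fun r => powerSumHom_monomial _ m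
  have h2 : powerSums (-monomial m (1 : ℤ)) = fun r => -monomial m (1 : ℚ) ^ (r + 1) :=
    funext fun r => by rw [← congrFun h1 r]; exact map_neg _ _
  have h : monomial m (1 : ℤ) ∈ integralVarSets σ := by
    show (∀ n, newtonH (powerSums (monomial m (1 : ℤ))) n ∈ intSeries σ) ∧
      ∀ n, newtonH (powerSums (-monomial m (1 : ℤ))) n ∈ intSeries σ
    rw [h1, h2]
    simp only [newtonH_pow, newtonH_neg_pow]
    refine ⟨fun n => pow_mem (monomial_mem_intSeries m) n, fun n => ?_⟩
    split_ifs
    · exact one_mem _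
    · exact neg_mem (monomial_mem_intSeries m)
    · exact zero_mem _
  have := zsmul_mem h z
  rwa [← map_zsmul, smul_eq_mul, mul_one] at this

/-- A coefficient depends only on a finite part of `X`, a finite integer combination of letters.
Such combinations are handled by the subgroup `integralVarSets`, generality in the sign being built
into its definition. -/
theorem completeSymm_mem_intSeries (X : MvPowerSeries σ ℤ) (n : ℕ) :
    completeSymm X n ∈ intSeries σ := by
  rw [completeSymm_eq_powerSums, mem_intSeries]
  intro m
  obtain ⟨s, hs⟩ := (hasFormalSum_monomial X).summable.exists_finset m
  have h := eqUpTo_formalSum hs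
  rw [(hasFormalSum_monomial X).formalSum_eq] at h
  rw [(EqUpTo.newtonH h.powerSums n).coeff_eq]
  have hmem : ∑ k ∈ s, monomial k (coeff k X) ∈ integralVarSets σ :=
    sum_mem fun k _ => monomial_mem_integralVarSets k _
  exact mem_intSeries.1 (hmem.1 n) m

theorem schur_mem_intSeries (μ : YoungDiagram) (X : MvPowerSeries σ ℤ) :
    schur μ X ∈ intSeries σ := by
  have h : jacobiTrudi (completeSymm X) μ ∈ intSeries σ := by
    rw [jacobiTrudi_eq_sum]
    refine sum_mem fun τ _ => zsmul_mem (prod_mem fun i _ => ?_) _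
    split_ifs
    · exact completeSymm_mem_intSeries X _
    · exact zero_mem _
  exact h

theorem schurProd_mem_intSeries (lam : MultiPartition J) (X : J → MvPowerSeries σ ℤ) :
    schurProd lam X ∈ intSeries σ := prod_mem fun _ _ => schur_mem_intSeries _ _

end Integrality

end

section

open MvPowerSeries
open Finset.HasAntidiagonal (antidiagonal mem_antidiagonal)


/-! ## Leading monomials -/

section Lead

variable {σ ι : Type*}

/-- The coefficient of `f` at `m` is `1`, and all other monomials of `f` have larger weight. -/
def HasLead (w : (σ →₀ ℕ) →+ ℕ) (f : MvPowerSeries σ ℚ) (m : σ →₀ ℕ) : Prop :=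
  coeff m f = 1 ∧ ∀ n, coeff n f ≠ 0 → n = m ∨ w m < w n

variable {w : (σ →₀ ℕ) →+ ℕ} {f g : MvPowerSeries σ ℚ} {m n : σ →₀ ℕ}

theorem HasLead.le (h : HasLead w f m) {k : σ →₀ ℕ} (hk : coeff k f ≠ 0) : w m ≤ w k := by
  rcases h.2 k hk with rfl | h
  · exact le_rfl
  · exact h.le

theorem hasLead_one (w : (σ →₀ ℕ) →+ ℕ) : HasLead w 1 0 := by
  classical
  refine ⟨by simp, fun n hn => Or.inl ?_⟩
  by_contra h
  exact hn (by rw [coeff_one, if_neg h])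

theorem hasLead_X (w : (σ →₀ ℕ) →+ ℕ) (t : σ) : HasLead w (X t) (Finsupp.single t 1) := by
  classical
  refine ⟨by rw [coeff_X, if_pos rfl], fun n hn => Or.inl ?_⟩
  by_contra h
  exact hn (by rw [coeff_X, if_neg h])

/-- The weight is additive, so the minimum over products of terms is attained only at the pair of
leading terms, and no cancellation can occur there. -/
theorem HasLead.mul (hf : HasLead w f m) (hg : HasLead w g n) : HasLead w (f * g) (m + n) := by
  classical
  have key : ∀ p : (σ →₀ ℕ) × (σ →₀ ℕ), coeff p.1 f * coeff p.2 g ≠ 0 →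
      p = (m, n) ∨ w (m + n) < w (p.1 + p.2) := by
    intro p hp
    have h1 := left_ne_zero_of_mul hp
    have h2 := right_ne_zero_of_mul hp
    rw [map_add, map_add]
    have h3 := hf.le h1
    have h4 := hg.le h2
    rcases hf.2 _ h1 with h1 | h1
    · rcases hg.2 _ h2 with h2 | h2
      · exact Or.inl (Prod.ext h1 h2)
      · exact Or.inr (by omega)
    · exact Or.inr (by omega)
  refine ⟨?_, fun k hk => ?_⟩
  · have hmem : (m, n) ∈ antidiagonal (m + n) := by rw [mem_antidiagonal]
    have hz : ∀ p ∈ antidiagonal (m + n), p ≠ (m, n) → coeff p.1 f * coeff p.2 g = 0 := by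
      intro p hp hne
      by_contra h
      rcases key p h with h | h
      · exact hne h
      · rw [mem_antidiagonal.1 hp] at h
        exact lt_irrefl _ h
    rw [coeff_mul, Finset.sum_eq_single_of_mem _ hmem hz, hf.1, hg.1, mul_one]
  · rw [coeff_mul] at hk
    obtain ⟨p, hp, hne⟩ := Finset.exists_ne_zero_of_sum_ne_zero hk
    rw [← mem_antidiagonal.1 hp]
    rcases key p hne with h | h
    · exact Or.inl (by rw [h])
    · exact Or.inr h

theorem HasLead.prod {s : Finset ι} {f : ι → MvPowerSeries σ ℚ} {m : ι → σ →₀ ℕ}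
    (h : ∀ i ∈ s, HasLead w (f i) (m i)) : HasLead w (∏ i ∈ s, f i) (∑ i ∈ s, m i) := by
  classical
  induction s using Finset.induction_on with
  | empty => simpa using hasLead_one w
  | insert a s ha ih =>
    rw [Finset.prod_insert ha, Finset.sum_insert ha]
    exact (h a (Finset.mem_insert_self a s)).mul (ih fun i hi => h i (Finset.mem_insert_of_mem hi))

theorem HasLead.add (hf : HasLead w f m) (hg : ∀ n, coeff n g ≠ 0 → w m < w n) :
    HasLead w (f + g) m := by
  refine ⟨?_, fun n hn => ?_⟩
  · have h0 : coeff m g = 0 := by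
      by_contra h
      exact lt_irrefl _ (hg m h)
    rw [map_add, hf.1, h0, add_zero]
  · by_cases hg0 : coeff n g = 0
    · rw [map_add, hg0, add_zero] at hn
      exact hf.2 n hn
    · exact Or.inr (hg n hg0)

theorem hasLead_of_eqUpTo (h : ∀ n, ∃ g, EqUpTo n f g ∧ EqUpTo m f g ∧ HasLead w g m) :
    HasLead w f m := by
  refine ⟨?_, fun n hn => ?_⟩
  · obtain ⟨g, -, hg, h1⟩ := h m
    rw [hg.coeff_eq, h1.1]
  · obtain ⟨g, hg, -, h1⟩ := h n
    rw [hg.coeff_eq] at hn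
    exact h1.2 n hn

end Lead

/-! ### Leading monomials of elementary symmetric functions -/

section ElementaryLead

variable {σ : Type*} {w : (σ →₀ ℕ) →+ ℕ} {v : ℕ → σ}

/-- Induction on the number of letters through `e_{k+1} ↦ e_{k+1} + x_N e_k`. The lightest choice of
`k` distinct letters is the first `k`; the vanishing clause is needed when all letters are used. -/
theorem hasLead_newtonE_finset (hw : ∀ i, w (Finsupp.single (v i) 1) = i) (N k : ℕ) :
    (k ≤ N → HasLead w (newtonE (powerSums (∑ i ∈ Finset.range N, X (v i))) k)
      (∑ i ∈ Finset.range k, Finsupp.single (v i) 1)) ∧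
    (N < k → newtonE (powerSums (∑ i ∈ Finset.range N, X (v i))) k = 0) := by
  induction N generalizing k with
  | zero =>
    have h0 : powerSums (∑ i ∈ Finset.range 0, (X (v i) : MvPowerSeries σ ℤ)) = fun _ => 0 :=
      funext fun r => by rw [Finset.sum_range_zero]; exact map_zero _
    rw [h0]
    refine ⟨fun h => ?_, fun h => ?_⟩
    · obtain rfl : k = 0 := by omega
      rw [newtonE_zero, Finset.sum_range_zero]
      exact hasLead_one w
    · obtain ⟨k, rfl⟩ := Nat.exists_eq_succ_of_ne_zero h.ne'
      exact newtonE_of_eq_zero k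
  | succ N ih =>
    have hp : powerSums (∑ i ∈ Finset.range (N + 1), (X (v i) : MvPowerSeries σ ℤ)) = fun r =>
        powerSums (∑ i ∈ Finset.range N, X (v i)) r + (X (v N) : MvPowerSeries σ ℚ) ^ (r + 1) := by
      funext r
      rw [Finset.sum_range_succ]
      exact (map_add _ _ _).trans (congrArg _ (powerSumHom_monomial r.succ_ne_zero _))
    rw [hp]
    rcases k with _ | k
    · refine ⟨fun _ => ?_, fun h => absurd h (Nat.not_lt_zero _)⟩
      rw [newtonE_zero, Finset.sum_range_zero]
      exact hasLead_one w
    rw [newtonE_add_pow]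
    refine ⟨fun h => ?_, fun h => ?_⟩
    · have hX := (hasLead_X w (v N)).mul ((ih k).1 (by omega))
      -- For `k < N` the new term carries `x_N` in place of `x_k` and is heavier; for `k = N` the
      -- old term is zero and the new one supplies the lead.
      rcases (Nat.le_of_succ_le_succ h).lt_or_eq with hk | rfl
      · refine ((ih (k + 1)).1 hk).add fun n hn => ?_
        have := hX.le hn
        rw [map_add, hw] at this
        rw [Finset.sum_range_succ, map_add, hw]
        omega
      · rw [(ih (k + 1)).2 k.lt_succ_self, zero_add, Finset.sum_range_succ, add_comm]
        exact hX
    · rw [(ih (k + 1)).2 (by omega), (ih k).2 (by omega), mul_zero, add_zero]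

theorem hasLead_newtonE_varSet (hv : Function.Injective v)
    (hw : ∀ i, w (Finsupp.single (v i) 1) = i) (k : ℕ) :
    HasLead w (newtonE (powerSums (varSet v)) k) (∑ i ∈ Finset.range k, Finsupp.single (v i) 1) := by
  classical
  refine hasLead_of_eqUpTo fun n => ?_
  -- One truncation has to control both the tested monomial `n` and the leading monomial.
  set M := n + ∑ i ∈ Finset.range k, Finsupp.single (v i) 1 with hM
  obtain ⟨s, hs⟩ := (hasFormalSum_varSet hv).summable.exists_finset M
  set N := k + (s.sup id + 1) with hN
  have h := eqUpTo_formalSum (s := Finset.range N) (fun i hi => hs i fun his => hi (by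
    have := Finset.le_sup (f := id) his
    rw [Finset.mem_range]
    simp only [id_eq] at this
    omega))
  have h' := EqUpTo.newtonE h.powerSums k
  exact ⟨_, h'.mono le_self_add, h'.mono le_add_self, (hasLead_newtonE_finset hw N k).1 (by omega)⟩

end ElementaryLead

/-! ## Duality between Schur functions and monomials -/

section Letters

variable {σ J : Type*} (e : J × ℕ ≃ σ)

/-- The variable sets of independent variables `e (U, n)`. -/
def letters (U : J) : MvPowerSeries σ ℤ := varSet fun n => e (U, n)

theorem hasSubst_pFamily_letters : HasSubst (pFamily (letters e)) :=
  hasSubst_pFamily_varSet (v := fun U n => e (U, n)) e.injective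

/-- The multidegree of an exponent. -/
def expoDeg : (σ →₀ ℕ) →+ (J →₀ ℕ) := Finsupp.weight fun t => Finsupp.single (e.symm t).1 1

/-- The weight of an exponent for which `e (U, n)` has weight `n`. -/
def height : (σ →₀ ℕ) →+ ℕ := Finsupp.weight fun t => (e.symm t).2

/-- Every monomial of `f` has multidegree `d`. -/
def HasDegree (f : MvPowerSeries σ ℚ) (d : J →₀ ℕ) : Prop :=
  ∀ m, coeff m f ≠ 0 → expoDeg e m = d

variable {e}

theorem HasDegree.mul {f g : MvPowerSeries σ ℚ} {c d : J →₀ ℕ} (hf : HasDegree e f c)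
    (hg : HasDegree e g d) : HasDegree e (f * g) (c + d) := by
  classical
  intro m hm
  rw [coeff_mul] at hm
  obtain ⟨p, hp, hne⟩ := Finset.exists_ne_zero_of_sum_ne_zero hm
  rw [← mem_antidiagonal.1 hp, map_add, hf _ (left_ne_zero_of_mul hne),
    hg _ (right_ne_zero_of_mul hne)]

theorem hasDegree_one : HasDegree e 1 0 := by
  classical
  intro m hm
  rw [coeff_one, ite_ne_right_iff] at hm
  rw [hm.1, map_zero]

theorem HasDegree.pow {f : MvPowerSeries σ ℚ} {d : J →₀ ℕ} (hf : HasDegree e f d) (n : ℕ) :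
    HasDegree e (f ^ n) (n • d) := by
  induction n with
  | zero => simpa using hasDegree_one
  | succ n ih => simpa only [pow_succ, succ_nsmul] using ih.mul hf

theorem hasDegree_pFamily (t : J × ℕ) : HasDegree e (pFamily (letters e) t) (pWeight t) := by
  obtain ⟨U, k⟩ := t
  intro n hn
  rw [pFamily_apply] at hn
  obtain ⟨m, rfl, hm⟩ := exists_of_coeff_powerSumHom_ne_zero hn
  obtain ⟨i, rfl⟩ := exists_of_coeff_varSet_ne_zero hm
  rw [map_nsmul, expoDeg, Finsupp.weight_single, Equiv.symm_apply_apply, one_smul, pWeight,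
    Finsupp.smul_single, smul_eq_mul, mul_one]

theorem hasDegree_monomialProd (ρ : J × ℕ →₀ ℕ) :
    HasDegree e (monomialProd (pFamily (letters e)) ρ) (Finsupp.weight pWeight ρ) := by
  classical
  rw [Finsupp.weight_apply, monomialProd, Finsupp.prod, Finsupp.sum]
  induction ρ.support using Finset.induction_on with
  | empty => simpa using hasDegree_one
  | insert a s ha ih =>
    rw [Finset.prod_insert ha, Finset.sum_insert ha]
    exact ((hasDegree_pFamily a).pow _).mul ih

theorem hasDegree_schurProd (lam : MultiPartition J) :
    HasDegree e (schurProd lam (letters e)) lam.mdeg := by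
  intro m hm
  rw [schurProd_eq_sum, map_sum] at hm
  obtain ⟨ρ, hρ, hne⟩ := Finset.exists_ne_zero_of_sum_ne_zero hm
  rw [← isWeightedHomogeneous_schurPoly lam (MvPolynomial.mem_support_iff.1 hρ)]
  rw [coeff_smul] at hne
  exact hasDegree_monomialProd ρ m (right_ne_zero_of_mul hne)

/-- The product of elementary symmetric functions attached to the conjugates of the partitions. -/
def elemPoly (mu : MultiPartition J) : MvPolynomial (J × ℕ) ℚ :=
  ∏ U ∈ mu.supp, ∏ j ∈ Finset.range ((mu.part U).rowLen 0),
    newtonE (fun k => MvPolynomial.X (U, k)) ((mu.part U).colLen j)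

theorem card_eq_sum_colLen (μ : YoungDiagram) :
    μ.card = ∑ j ∈ Finset.range (μ.rowLen 0), μ.colLen j := by
  have h := card_eq_sum_rowLen μ.transpose
  rw [Fin.sum_univ_eq_sum_range (fun i => μ.transpose.rowLen i)] at h
  simp only [YoungDiagram.rowLen_transpose, YoungDiagram.colLen_transpose] at h
  rw [← h, YoungDiagram.card, YoungDiagram.card, YoungDiagram.transpose]
  simp

theorem elemPoly_mem_schurSpan (mu : MultiPartition J) : elemPoly mu ∈ schurSpan mu.mdeg := by
  refine prod_mem_schurSpan (s := mu.supp) (fun U hU => ?_) fun U _ => ?_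
  · rw [MultiPartition.mem_supp]
    intro h
    exact Finsupp.mem_support_iff.1 hU (by rw [MultiPartition.mdeg_apply, h, card_bot])
  · rw [MultiPartition.mdeg_apply, card_eq_sum_colLen]
    exact prod_mem_hSpan _ fun j _ => newtonE_mem_hSpan _ _

variable (e)

/-- The exponent attached to a multipartition. -/
def leadExpo (mu : MultiPartition J) : σ →₀ ℕ := mu.expo.equivMapDomain e

variable {e}

theorem leadExpo_injective : Function.Injective (leadExpo e) := fun _ _ h =>
  MultiPartition.expo_injective ((Finsupp.equivCongrLeft e).injective h)

/-- Row `i` of a diagram is counted by its columns: its length is the number of columns longer than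
`i`. -/
theorem leadExpo_eq_sum (mu : MultiPartition J) : leadExpo e mu = ∑ U ∈ mu.supp,
    ∑ j ∈ Finset.range ((mu.part U).rowLen 0), ∑ i ∈ Finset.range ((mu.part U).colLen j),
      Finsupp.single (e (U, i)) 1 := by
  classical
  refine Finsupp.ext fun t => ?_
  obtain ⟨⟨V, i⟩, rfl⟩ := e.surjective t
  rw [leadExpo, Finsupp.equivMapDomain_apply, Equiv.symm_apply_apply, MultiPartition.expo_apply]
  simp only [Finsupp.finsetSum_apply, Finsupp.single_apply, e.injective.eq_iff, Prod.mk.injEq]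
  have hin : ∀ U j, (∑ i' ∈ Finset.range ((mu.part U).colLen j), if U = V ∧ i' = i then 1 else 0) =
      if U = V ∧ j < (mu.part U).rowLen i then 1 else 0 := by
    intro U j
    simp only [ite_and]
    split_ifs with h1 h2
    · rw [Finset.sum_ite_eq', if_pos (Finset.mem_range.2
        (YoungDiagram.mem_iff_lt_colLen.1 (YoungDiagram.mem_iff_lt_rowLen.2 h2)))]
    · rw [Finset.sum_ite_eq', if_neg fun h => h2 (YoungDiagram.mem_iff_lt_rowLen.1
        (YoungDiagram.mem_iff_lt_colLen.2 (Finset.mem_range.1 h)))]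
    · simp
  simp only [hin]
  simp only [ite_and]
  by_cases hV : V ∈ mu.supp
  · rw [Finset.sum_eq_single_of_mem V hV (fun U _ hU => by simp [hU])]
    simp only [if_true]
    rw [← Finset.card_filter]
    have : (Finset.range ((mu.part V).rowLen 0)).filter (· < (mu.part V).rowLen i) =
        Finset.range ((mu.part V).rowLen i) := by
      ext j
      have := (mu.part V).rowLen_anti 0 i (Nat.zero_le _)
      rw [Finset.mem_filter, Finset.mem_range, Finset.mem_range]
      exact ⟨fun h => h.2, fun h => ⟨h.trans_le this, h⟩⟩
    rw [this, Finset.card_range]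
  · have hz : ∀ U ∈ mu.supp, U ≠ V := fun U hU h => hV (h ▸ hU)
    rw [Finset.sum_eq_zero fun U hU => by simp [hz U hU]]
    rw [MultiPartition.mem_supp, not_not] at hV
    by_contra h
    have := lt_card_of_rowLen_ne_zero h
    rw [hV, card_bot] at this
    exact absurd this (Nat.not_lt_zero _)

/-- A column of length `c` contributes the factor `e_c`, with lead `x_0 ⋯ x_{c-1}`; multiplying over
all columns gives the monomial whose exponents are the row lengths. -/
theorem hasLead_elemPoly (mu : MultiPartition J) :
    HasLead (height e) (evalPoly (letters e) (elemPoly mu)) (leadExpo e mu) := by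
  rw [elemPoly, leadExpo_eq_sum, map_prod]
  refine HasLead.prod fun U _ => ?_
  rw [map_prod]
  refine HasLead.prod fun j _ => ?_
  have h := map_newtonE (evalPoly (letters e)).toRingHom (fun k => MvPolynomial.X (U, k))
    ((mu.part U).colLen j)
  have h2 : (fun k => (evalPoly (letters e)).toRingHom (MvPolynomial.X (U, k))) =
      powerSums (letters e U) := funext fun k =>
    (evalPoly_X _ _).trans (pFamily_apply _ _ _)
  rw [h2] at h
  refine (congrArg (fun f => HasLead (height e) f _) h).mpr ?_
  refine hasLead_newtonE_varSet (v := fun n => e (U, n))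
    (fun i j h => (Prod.mk.inj (e.injective h)).2) (fun i => ?_) _
  rw [height, Finsupp.weight_single, Equiv.symm_apply_apply, one_smul]

theorem evalPoly_elemPoly (mu : MultiPartition J) : ∃ c : MultiPartition J →₀ ℤ,
    (∀ lam, c lam ≠ 0 → lam.mdeg = mu.mdeg) ∧
    evalPoly (letters e) (elemPoly mu) = ∑ lam ∈ c.support, c lam • schurProd lam (letters e) := by
  obtain ⟨c, hc, h⟩ := exists_schurPoly_expansion (elemPoly_mem_schurSpan mu)
  refine ⟨c, hc, ?_⟩
  rw [h, Finsupp.sum, map_sum]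
  simp only [map_zsmul, evalPoly_schurPoly]

/-- No computation is needed: the leading monomial occurs in a combination of Schur functions that
are homogeneous of this multidegree. -/
theorem expoDeg_leadExpo (mu : MultiPartition J) : expoDeg e (leadExpo e mu) = mu.mdeg := by
  obtain ⟨c, hc, h⟩ := evalPoly_elemPoly (e := e) mu
  have h1 := (hasLead_elemPoly (e := e) mu).1
  have h2 : coeff (leadExpo e mu) (evalPoly (letters e) (elemPoly mu)) ≠ 0 := by
    rw [h1]
    exact one_ne_zero
  rw [h, map_sum] at h2
  obtain ⟨lam, hlam, hne⟩ := Finset.exists_ne_zero_of_sum_ne_zero h2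
  rw [map_zsmul] at hne
  rw [hasDegree_schurProd lam _ (right_ne_zero_of_smul hne), hc lam (Finsupp.mem_support_iff.1 hlam)]

end Letters

end

section

open MvPowerSeries
open Finset.HasAntidiagonal (antidiagonal mem_antidiagonal)


/-! ### Integral functionals dual to the Schur functions -/

section Dual

variable {σ J : Type*} (e : J × ℕ ≃ σ)

/-- Indices with equal `b` are allowed: the matrix is block triangular, and the second condition
makes each diagonal block the identity. -/
theorem det_eq_one_of_triangular {Λ : Type*} [Fintype Λ] [DecidableEq Λ] (C : Matrix Λ Λ ℤ)
    (b : Λ → ℕ) (h1 : ∀ i, C i i = 1) (h2 : ∀ i j, C i j ≠ 0 → j = i ∨ b i < b j) : C.det = 1 := by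
  have hC : C.BlockTriangular b := by
    intro i j hij
    by_contra h
    rcases h2 i j h with h | h
    · rw [h] at hij
      exact lt_irrefl _ hij
    · exact lt_asymm hij h
  rw [hC.det]
  refine Finset.prod_eq_one fun a _ => ?_
  have : C.toSquareBlock b a = 1 := by
    ext i j
    rw [Matrix.toSquareBlock_def, Matrix.of_apply, Matrix.one_apply]
    split_ifs with hij
    · rw [hij, h1]
    · by_contra h
      rcases h2 _ _ h with h | h
      · exact hij (Subtype.ext h.symm)
      · rw [i.2, j.2] at h
        exact lt_irrefl _ h
  rw [this, Matrix.det_one]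

open Classical in
/-- The transition matrix from Schur functions to leading monomials is invertible over `ℤ`. -/
theorem exists_dual (lam : MultiPartition J) : ∃ L : (σ →₀ ℕ) →₀ ℤ, ∀ kap : MultiPartition J,
    Finsupp.linearCombination ℤ (fun m => coeff m (schurProd kap (letters e))) L =
      if kap = lam then 1 else 0 := by
  classical
  set d := lam.mdeg with hd
  let Λ := {mu : MultiPartition J // mu.mdeg = d}
  have : Fintype Λ := (finite_mdeg_eq d).fintype
  choose k hk using fun (kap : Λ) (nu : Λ) =>
    mem_intSeries.1 (schurProd_mem_intSeries kap.1 (letters e)) (leadExpo e nu.1)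
  choose c hc hc' using fun mu : Λ => evalPoly_elemPoly (e := e) mu.1
  let K : Matrix Λ Λ ℤ := Matrix.of k
  let A : Matrix Λ Λ ℤ := Matrix.of fun mu kap => c mu kap.1
  -- `A` expands elementary products in Schur functions and `K` lists Schur coefficients at leading
  -- monomials, so `A * K` lists those of the elementary products, which is unitriangular.
  have hAK : ∀ mu nu : Λ, ((A * K) mu nu : ℚ) =
      coeff (leadExpo e nu.1) (evalPoly (letters e) (elemPoly mu.1)) := by
    intro mu nu
    rw [hc', map_sum, Matrix.mul_apply, Int.cast_sum]
    have hinj : Set.InjOn (fun kap : Λ => kap.1) (Finset.univ : Finset Λ) :=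
      Subtype.val_injective.injOn
    rw [Finset.sum_subset (s₂ := Finset.univ.image fun kap : Λ => kap.1), Finset.sum_image hinj]
    · refine Finset.sum_congr rfl fun kap _ => ?_
      rw [map_zsmul, hk, zsmul_eq_mul, Int.cast_mul]
      rfl
    · intro kap hkap
      exact Finset.mem_image.2 ⟨⟨kap, (hc mu kap (Finsupp.mem_support_iff.1 hkap)).trans mu.2⟩,
        Finset.mem_univ _, rfl⟩
    · intro kap _ hkap
      rw [Finsupp.notMem_support_iff.1 hkap, zero_smul, map_zero]
  have hdet : (A * K).det = 1 := by
    refine det_eq_one_of_triangular _ (fun mu => height e (leadExpo e mu.1)) (fun mu => ?_)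
      fun mu nu h => ?_
    · have := hAK mu mu
      rw [(hasLead_elemPoly mu.1).1] at this
      exact_mod_cast this
    · have h' : ((A * K) mu nu : ℚ) ≠ 0 := Int.cast_ne_zero.2 h
      rw [hAK] at h'
      exact ((hasLead_elemPoly mu.1).2 _ h').imp_left
        fun h => Subtype.ext (leadExpo_injective h)
  rw [Matrix.det_mul] at hdet
  have hK : IsUnit K.det := IsUnit.of_mul_eq_one_right _ hdet
  -- The functional is the column of `K⁻¹` at `lam`, integral because `det K` is a unit of `ℤ`.
  refine ⟨∑ nu : Λ, Finsupp.single (leadExpo e nu.1) (K⁻¹ nu ⟨lam, rfl⟩), fun kap => ?_⟩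
  rw [map_sum]
  simp only [Finsupp.linearCombination_single]
  by_cases hkap : kap.mdeg = d
  · have h := congrFun (congrFun (Matrix.mul_nonsing_inv K hK) ⟨kap, hkap⟩) ⟨lam, rfl⟩
    rw [Matrix.mul_apply, Matrix.one_apply] at h
    have h' := congrArg (Int.cast : ℤ → ℚ) h
    rw [Int.cast_sum, Int.cast_ite, Int.cast_one, Int.cast_zero] at h'
    have hiff : ((⟨kap, hkap⟩ : Λ) = ⟨lam, rfl⟩) ↔ kap = lam := Subtype.ext_iff
    simp only [hiff] at h'
    rw [← h']
    refine Finset.sum_congr rfl fun nu _ => ?_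
    rw [hk ⟨kap, hkap⟩ nu, zsmul_eq_mul, mul_comm, Int.cast_mul]
    rfl
  -- A Schur product of another multidegree has no monomial of multidegree `d`, and all the chosen
  -- leading monomials have multidegree `d`.
  · rw [if_neg fun h : kap = lam => hkap (by rw [h])]
    refine Finset.sum_eq_zero fun nu _ => ?_
    have : coeff (leadExpo e nu.1) (schurProd kap (letters e)) = 0 := by
      by_contra h
      exact hkap ((hasDegree_schurProd kap _ h).symm.trans ((expoDeg_leadExpo _).trans nu.2))
    rw [this, smul_zero]

variable {A : Type*} [Ring A] [Algebra ℚ A]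

/-- The coefficient of the Schur function attached to `lam`, as a functional on power series. -/
def schurDual (lam : MultiPartition J) : MvPowerSeries σ A → A := fun f =>
  (exists_dual e lam).choose.sum fun m z => z • coeff m f

open Classical in
theorem schurDual_schurProd (lam kap : MultiPartition J) :
    schurDual e lam (schurProd kap (letters e)) = if kap = lam then 1 else 0 :=
  (exists_dual e lam).choose_spec kap

variable {e}

theorem schurDual_tens (lam : MultiPartition J) (s : MvPowerSeries σ ℚ) (z : A) :
    schurDual e lam (tens s z) = schurDual e lam s • z := by
  simp only [schurDual, Finsupp.sum, Finset.sum_smul, coeff_tens, smul_assoc]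

/-- The functional reads finitely many coefficients, so it commutes with formal sums and vanishes on
almost all terms. -/
theorem HasFormalSum.schurDual {ι : Type*} {F : ι → MvPowerSeries σ A} {f : MvPowerSeries σ A}
    (h : HasFormalSum F f) (lam : MultiPartition J) :
    {i | schurDual e lam (F i) ≠ 0}.Finite ∧ schurDual e lam f = ∑ᶠ i, schurDual e lam (F i) := by
  classical
  set L := (exists_dual e lam).choose with hL
  have hdual : ∀ g : MvPowerSeries σ A,
      WreathLimit.schurDual e lam g = ∑ m ∈ L.support, L m • coeff m g := fun _ => rfl
  have hfin : (⋃ m ∈ (L.support : Set (σ →₀ ℕ)), {i | coeff m (F i) ≠ 0}).Finite :=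
    L.support.finite_toSet.biUnion fun m _ => h.summable m
  have hz : ∀ i ∉ hfin.toFinset, ∀ m ∈ L.support, coeff m (F i) = 0 := by
    intro i hi m hm
    by_contra hne
    exact hi ((Set.Finite.mem_toFinset _).2 (Set.mem_biUnion (Finset.mem_coe.2 hm) hne))
  have hsub : {i | WreathLimit.schurDual e lam (F i) ≠ 0} ⊆ hfin.toFinset := by
    intro i hi
    by_contra hne
    refine hi ?_
    rw [hdual]
    exact Finset.sum_eq_zero fun m hm => by rw [hz i hne m hm, smul_zero]
  refine ⟨hfin.toFinset.finite_toSet.subset hsub, ?_⟩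
  rw [finsum_eq_sum_of_support_subset _ hsub]
  simp only [hdual]
  rw [Finset.sum_comm]
  refine Finset.sum_congr rfl fun m hm => ?_
  rw [← Finset.smul_sum, ← h.formalSum_eq, coeff_formalSum_eq_sum fun i hi => hz i hi m hm]

theorem HasFormalSum.schurDual_eq {c : MultiPartition J → A} {f : MvPowerSeries σ A}
    (h : HasFormalSum (fun lam => tens (schurProd lam (letters e)) (c lam)) f)
    (lam : MultiPartition J) : WreathLimit.schurDual e lam f = c lam := by
  rw [(h.schurDual (e := e) lam).2, finsum_eq_single _ lam]
  · rw [schurDual_tens, schurDual_schurProd, if_pos rfl, one_smul]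
  · intro kap hne
    rw [schurDual_tens, schurDual_schurProd, if_neg hne, zero_smul]

theorem exists_int_schurDual {f : MvPowerSeries σ ℚ} (hf : f ∈ intSeries σ)
    (lam : MultiPartition J) : ∃ z : ℤ, schurDual e lam f = z := by
  choose z hz using mem_intSeries.1 hf
  refine ⟨∑ m ∈ (exists_dual e lam).choose.support, (exists_dual e lam).choose m * z m, ?_⟩
  rw [schurDual, Finsupp.sum, Int.cast_sum]
  refine Finset.sum_congr rfl fun m _ => ?_
  rw [hz, zsmul_eq_mul, Int.cast_mul]

theorem tens_one_right (s : MvPowerSeries σ ℚ) (q : ℚ) : tens s q = q • s :=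
  MvPowerSeries.ext fun m => by
    rw [coeff_tens, coeff_smul, smul_eq_mul, mul_comm]

end Dual

end

section

open MvPowerSeries
open Finset.HasAntidiagonal (antidiagonal mem_antidiagonal)


/-! ## The family `Z` and its structure constants -/

section ZFamily

variable {R : Type*} [Ring R] {I : Type*} (b : Module.Basis I ℤ R)

theorem isZFamily_zFam : IsZFamily b (zFam b) :=
  -- For the identity equivalence, `letters` is by definition the variable set used in the defining
  -- property of the family.
  ⟨_, hasFormalProd_Theta b (hasSubst_pFamily_letters (Equiv.refl (I × ℕ))),
    hasFormalSum_zFam b (hasSubst_pFamily_letters (Equiv.refl (I × ℕ)))⟩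

-- The infinite product is unique, and the dual functionals recover each coefficient from it.
variable {b} in
theorem IsZFamily.eq {Z Z' : MultiPartition I → LimitAlgebra R} (h : IsZFamily b Z)
    (h' : IsZFamily b Z') : Z = Z' := by
  obtain ⟨P, hP, hZ⟩ := h
  obtain ⟨P', hP', hZ'⟩ := h'
  obtain rfl := hP.unique hP'
  funext lam
  exact (HasFormalSum.schurDual_eq (e := Equiv.refl (I × ℕ)) hZ lam).symm.trans
    (HasFormalSum.schurDual_eq (e := Equiv.refl (I × ℕ)) hZ' lam)

theorem isZFamily_Zelt : IsZFamily b (Zelt b) := Classical.epsilon_spec ⟨_, isZFamily_zFam b⟩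

theorem Zelt_eq : Zelt b = zFam b := (isZFamily_Zelt b).eq (isZFamily_zFam b)

theorem hasFormalSum_zTerm {σ : Type*} {X : I → MvPowerSeries σ ℤ} (hX : HasSubst (pFamily X)) :
    HasFormalSum (zTerm b X) (substHom (LimitAlgebra R) hX (universalProd b)) := by
  have h := hasFormalSum_zFam b hX
  rwa [← Zelt_eq] at h

end ZFamily

/-! ### Two sets of variables as one set over the doubled index set -/

section Pairs

variable {I : Type*}

/-- A multipartition indexed by a disjoint union is a pair of multipartitions. -/
def pairEquiv (I : Type*) :
    MultiPartition I × MultiPartition I ≃ MultiPartition (I ⊕ I) where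
  toFun p := ⟨Sum.elim p.1.part p.2.part,
    ((p.1.finite_support.image Sum.inl).union (p.2.finite_support.image Sum.inr)).subset (by
      rintro (U | U) hU
      · exact Or.inl ⟨U, hU, rfl⟩
      · exact Or.inr ⟨U, hU, rfl⟩)⟩
  invFun q := (⟨fun U => q.part (Sum.inl U), q.finite_support.preimage Sum.inl_injective.injOn⟩,
    ⟨fun U => q.part (Sum.inr U), q.finite_support.preimage Sum.inr_injective.injOn⟩)
  left_inv _ := rfl
  right_inv q := MultiPartition.ext_part (Sum.elim_comp_inl_inr q.part)

/-- The variables of `Vars I`, indexed by `I ⊕ I`. -/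
def varsEquiv (I : Type*) : (I ⊕ I) × ℕ ≃ Vars I := Equiv.sumProdDistrib I I ℕ

theorem letters_inl (U : I) : letters (varsEquiv I) (Sum.inl U) = xSet U := rfl

theorem letters_inr (U : I) : letters (varsEquiv I) (Sum.inr U) = ySet U := rfl

theorem schurProd_pairEquiv (p : MultiPartition I × MultiPartition I) :
    schurProd (pairEquiv I p) (letters (varsEquiv I)) = schurProd p.1 xSet * schurProd p.2 ySet := by
  have h : (pairEquiv I p).supp = p.1.supp.disjSum p.2.supp := by
    ext U
    rw [MultiPartition.mem_supp]
    rcases U with U | U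
    · simp only [Finset.inl_mem_disjSum, MultiPartition.mem_supp]
      rfl
    · simp only [Finset.inr_mem_disjSum, MultiPartition.mem_supp]
      rfl
  have h' : schurProd (pairEquiv I p) (letters (varsEquiv I)) = ∏ U ∈ (pairEquiv I p).supp,
    schur ((pairEquiv I p).part U) (letters (varsEquiv I) U) := rfl
  rw [h', h, Finset.prod_disjSum]
  rfl

theorem hasFormalSum_pairEquiv {A : Type*} [Ring A] [Algebra ℚ A]
    {c : MultiPartition I × MultiPartition I → A} {f : MvPowerSeries (Vars I) A} :
    HasFormalSum (fun p => tens (schurProd p.1 xSet * schurProd p.2 ySet) (c p)) f ↔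
      HasFormalSum (fun q => tens (schurProd q (letters (varsEquiv I)))
        (c ((pairEquiv I).symm q))) f := by
  constructor <;> intro h
  · have := h.comp_equiv (pairEquiv I).symm
    simpa only [← schurProd_pairEquiv, Prod.mk.eta, Equiv.apply_symm_apply] using this
  · have := h.comp_equiv (pairEquiv I)
    simpa only [schurProd_pairEquiv, Equiv.symm_apply_apply] using this

end Pairs

/-! ### Structure constants and the multiplication rule -/

section StructureConstants

variable {R : Type*} [Ring R] {I : Type*} (b : Module.Basis I ℤ R)

theorem hasSubst_pFamily_vars : HasSubst (pFamily (letters (varsEquiv I))) :=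
  hasSubst_pFamily_letters _

theorem substHom_X {σ τ : Type*} {a : τ → MvPowerSeries σ ℚ} (ha : HasSubst a) (t : τ) :
    substHom ℚ ha (X t) = a t := by
  have := substHom_tens_X (A := ℚ) ha t 1
  rwa [tens_one_right, tens_one_right, one_smul, one_smul] at this

theorem formallySummable_structTensor_X (U : I) (k : ℕ) :
    FormallySummable fun p : I × I => structTensor b p.1 p.2 U •
      ((X (Sum.inl p.1, k) : MvPowerSeries ((I ⊕ I) × ℕ) ℚ) * X (Sum.inr p.2, k)) := by
  classical
  intro m
  have key : ∀ p : I × I, coeff m (structTensor b p.1 p.2 U •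
      ((X (Sum.inl p.1, k) : MvPowerSeries ((I ⊕ I) × ℕ) ℚ) * X (Sum.inr p.2, k))) ≠ 0 →
      m = Finsupp.single (Sum.inl p.1, k) 1 + Finsupp.single (Sum.inr p.2, k) 1 := by
    intro p hp
    rw [map_zsmul, X, X, monomial_mul_monomial, coeff_monomial] at hp
    by_contra h
    rw [if_neg h, smul_zero] at hp
    exact hp rfl
  refine Set.Subsingleton.finite fun p hp q hq => ?_
  have h := (key p hp).symm.trans (key q hq)
  have h1 := DFunLike.congr_fun h (Sum.inl p.1, k)
  have h2 := DFunLike.congr_fun h (Sum.inr p.2, k)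
  simp only [Finsupp.add_apply, Finsupp.single_apply, Prod.mk.injEq, Sum.inl.injEq,
    Sum.inr.injEq, and_true, if_true, reduceCtorEq, if_false, add_zero, zero_add] at h1 h2
  refine Prod.ext ?_ ?_
  · by_contra hne
    rw [if_neg (Ne.symm hne)] at h1
    exact one_ne_zero h1
  · by_contra hne
    rw [if_neg (Ne.symm hne)] at h2
    exact one_ne_zero h2

/-- The power sums of the variable sets `productSet b U` in terms of those of `xSet` and `ySet`. -/
def productPower (t : I × ℕ) : MvPowerSeries ((I ⊕ I) × ℕ) ℚ :=
  X (Sum.inl t.1, t.2) + X (Sum.inr t.1, t.2) +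
    formalSum fun p : I × I => structTensor b p.1 p.2 t.1 •
      ((X (Sum.inl p.1, t.2) : MvPowerSeries ((I ⊕ I) × ℕ) ℚ) * X (Sum.inr p.2, t.2))

theorem substHom_productPower (t : I × ℕ) :
    substHom ℚ hasSubst_pFamily_vars (productPower b t) = pFamily (productSet b) t := by
  obtain ⟨U, k⟩ := t
  have h1 := (formallySummable_structTensor_X b U k).hasFormalSum.map
    (coeffFinite_substHom (A := ℚ) (hasSubst_pFamily_vars (I := I)))
  have h2 := (formallySummable_productSet b U).hasFormalSum.map
    (coeffFinite_powerSumHom k.succ_ne_zero)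
  simp only [map_zsmul, map_mul, substHom_X, pFamily_apply, letters_inl, letters_inr] at h1 h2
  rw [productPower, map_add, map_add, substHom_X, substHom_X, pFamily_apply, pFamily_apply,
    pFamily_apply, productSet, map_add, map_add]
  exact congrArg _ (h1.unique h2)

/-- The Schur product at the product set is thereby a power series in the power sums of `𝐱` and `𝐲`,
the form required by `hasFormalSum_schurCoeff`. -/
theorem substHom_aeval_productPower (lam : MultiPartition I) :
    substHom ℚ hasSubst_pFamily_vars (MvPolynomial.aeval (productPower b) (schurPoly lam)) =
      schurProd lam (productSet b) := by
  rw [← evalPoly_schurPoly]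
  have : (substHom ℚ hasSubst_pFamily_vars).comp
      (MvPolynomial.aeval (productPower b) : _ →ₐ[ℚ] _).toRingHom =
      (evalPoly (productSet b)).toRingHom := by
    refine MvPolynomial.ringHom_ext (fun q => ?_) fun t => ?_
    -- Any two ring homomorphisms out of `ℚ` agree, which settles the constants.
    · exact RingHom.congr_fun (Subsingleton.elim
        (((substHom ℚ hasSubst_pFamily_vars).comp
          (MvPolynomial.aeval (productPower b) : _ →ₐ[ℚ] _).toRingHom).comp MvPolynomial.C)
        ((evalPoly (productSet b)).toRingHom.comp MvPolynomial.C)) q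
    · show substHom ℚ hasSubst_pFamily_vars (MvPolynomial.aeval (productPower b) (MvPolynomial.X t)) =
        evalPoly (productSet b) (MvPolynomial.X t)
      rw [MvPolynomial.aeval_X, evalPoly_X, substHom_productPower]
  exact RingHom.congr_fun this (schurPoly lam)

/-- The coefficient of `∏ s_{μ(V)}(𝐱_V) ∏ s_{ν(W)}(𝐲_W)` in
`∏ s_{λ(U)}(𝐱_U, 𝐲_U, ⨁ (𝐱_V 𝐲_W)^{⊕ N_{V,W}^U})`. -/
def structConst (lam mu nu : MultiPartition I) : ℤ :=
  (exists_int_schurDual (e := varsEquiv I) (schurProd_mem_intSeries lam (productSet b))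
    (pairEquiv I (mu, nu))).choose

theorem structConst_eq (lam mu nu : MultiPartition I) : schurDual (varsEquiv I)
    (pairEquiv I (mu, nu)) (schurProd lam (productSet b)) = structConst b lam mu nu :=
  (exists_int_schurDual (e := varsEquiv I) (schurProd_mem_intSeries lam (productSet b))
    (pairEquiv I (mu, nu))).choose_spec

theorem isSchurExpansion_iff {f : MvPowerSeries (Vars I) ℚ}
    {c : MultiPartition I → MultiPartition I → ℤ} : IsSchurExpansion xSet ySet f c ↔
      HasFormalSum (fun q => tens (schurProd q (letters (varsEquiv I)))
        (c ((pairEquiv I).symm q).1 ((pairEquiv I).symm q).2 : ℚ)) f := by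
  rw [← hasFormalSum_pairEquiv (c := fun p => (c p.1 p.2 : ℚ)), IsSchurExpansion]
  simp only [tens_one_right]

/-- Re-expansion in Schur functions gives rational coefficients; the dual functionals identify them
with the integers already obtained. -/
theorem isSchurExpansion_structConst (lam : MultiPartition I) :
    IsSchurExpansion xSet ySet (schurProd lam (productSet b)) (structConst b lam) := by
  rw [isSchurExpansion_iff]
  have h := hasFormalSum_schurCoeff (hasSubst_pFamily_vars (I := I))
    (MvPolynomial.aeval (productPower b) (schurPoly lam))
  rw [substHom_aeval_productPower] at h
  have hq : ∀ q, schurCoeff (MvPolynomial.aeval (productPower b) (schurPoly lam)) q =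
      (structConst b lam ((pairEquiv I).symm q).1 ((pairEquiv I).symm q).2 : ℚ) := fun q => by
    rw [← structConst_eq, Prod.mk.eta, Equiv.apply_symm_apply]
    exact (h.schurDual_eq q).symm
  simpa only [hq] using h

variable {b} in
theorem IsSchurExpansion.eq {f : MvPowerSeries (Vars I) ℚ}
    {c c' : MultiPartition I → MultiPartition I → ℤ} (h : IsSchurExpansion xSet ySet f c)
    (h' : IsSchurExpansion xSet ySet f c') : c = c' := by
  funext mu nu
  have h1 := (isSchurExpansion_iff.1 h).schurDual_eq (pairEquiv I (mu, nu))
  have h2 := (isSchurExpansion_iff.1 h').schurDual_eq (pairEquiv I (mu, nu))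
  rw [Equiv.symm_apply_apply] at h1 h2
  exact Int.cast_injective (h1.symm.trans h2)

/-- For varying `lam` the Schur products at the product set form a summable family, and a dual
functional is nonzero on only finitely many of its members. -/
theorem finite_structConst_ne_zero (mu nu : MultiPartition I) :
    {lam | structConst b lam mu nu ≠ 0}.Finite := by
  refine (((formallySummable_schurProd (hasSubst_pFamily_productSet b)).hasFormalSum.schurDual
    (e := varsEquiv I) (pairEquiv I (mu, nu))).1).subset fun lam h => ?_
  rw [Set.mem_ofPred_eq, structConst_eq]
  exact Int.cast_ne_zero.2 h

/-- The functional dual to `(mu, nu)` is applied to the identity of generating functions: the left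
side gives the product, the right side its expansion. -/
theorem Zelt_mul_Zelt (mu nu : MultiPartition I) :
    Zelt b mu * Zelt b nu = ∑ᶠ lam, structConst b lam mu nu • Zelt b lam := by
  have h1 := (hasFormalSum_zTerm b hasSubst_pFamily_xSet).mul
    (hasFormalSum_zTerm b hasSubst_pFamily_ySet)
  rw [generatingFunction_mul] at h1
  simp only [zTerm, tens_mul_tens] at h1
  have h2 := (hasFormalSum_pairEquiv (c := fun p => Zelt b p.1 * Zelt b p.2)).1 h1
  have h3 := h2.schurDual_eq (pairEquiv I (mu, nu))
  rw [Equiv.symm_apply_apply] at h3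
  rw [← h3, ((hasFormalSum_zTerm b (hasSubst_pFamily_productSet b)).schurDual
    (e := varsEquiv I) _).2]
  refine finsum_congr fun lam => ?_
  rw [zTerm, schurDual_tens, structConst_eq, Int.cast_smul_eq_zsmul]

end StructureConstants

end

end WreathLimit

end

open WreathLimit in
theorem theorem4p12 {R : Type*} [Ring R] {I : Type*} (b : Module.Basis I ℤ R) :
    -- the family `Z` is well defined by its generating function
    (IsZFamily b (Zelt b) ∧ ∀ Z, IsZFamily b Z → Z = Zelt b) ∧
    -- the product of two generating functions
    (FormallySummable (zTerm b xSet) ∧ FormallySummable (zTerm b ySet) ∧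
      FormallySummable (zTerm b (productSet b)) ∧
      formalSum (zTerm b xSet) * formalSum (zTerm b ySet) = formalSum (zTerm b (productSet b))) ∧
    -- the structure constants
    (∃ a : MultiPartition I → MultiPartition I → MultiPartition I → ℤ,
      (∀ lam, IsSchurExpansion xSet ySet (schurProd lam (productSet b)) (a lam) ∧
        ∀ c, IsSchurExpansion xSet ySet (schurProd lam (productSet b)) c → c = a lam) ∧
      ∀ mu nu, {lam | a lam mu nu ≠ 0}.Finite ∧
        Zelt b mu * Zelt b nu = ∑ᶠ lam, a lam mu nu • Zelt b lam) := by
  have hx := hasFormalSum_zTerm b hasSubst_pFamily_xSet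
  have hy := hasFormalSum_zTerm b hasSubst_pFamily_ySet
  have hp := hasFormalSum_zTerm b (hasSubst_pFamily_productSet b)
  refine ⟨⟨isZFamily_Zelt b, fun Z hZ => hZ.eq (isZFamily_Zelt b)⟩,
    ⟨hx.summable, hy.summable, hp.summable, ?_⟩, structConst b, fun lam =>
      ⟨isSchurExpansion_structConst b lam, fun c hc => hc.eq (isSchurExpansion_structConst b lam)⟩,
    fun mu nu => ⟨finite_structConst_ne_zero b mu nu, Zelt_mul_Zelt b mu nu⟩⟩
  rw [hx.formalSum_eq, hy.formalSum_eq, hp.formalSum_eq, generatingFunction_mul]
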